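/- **Setting.** Let $0<L<\infty$, $\gamma>0$, $0\ne f\in L^2_{per}[0,L]$ (time independent, complex valued). Write $\|\cdot\|$ for the norm of $L^2[0,L]$ and $\|u\|_{H^2}^2=\|u\|^2+\|u_{xx}\|^2$. For $m\in\mathbb N$ let $P_m$ be the $L^2$-orthogonal projection onto $\mathrm{span}\{e^{2\pi i kx/L}:|k|\le m\}$. Consider, with $L$-periodic boundary conditions, the damped driven NLS $$iu_t+u_{xx}+|u|^2u+i\gamma u=f \qquad (1)$$ with solution operator $S(t)$ on $H^2_{per}$, whose global attractor $\mathcal A$ is the maximal compact invariant set ($S(t)\mathcal A=\mathcal A$ for $t\ge 0$) in $H^2_{per}$, and the feedback equation $$iw_s+w_{xx}+|w|^2w+i\gamma w=f-i\mu[P_mw-v]. \qquad (2)$$ Solutions are continuous in time with values in $H^2_{per}$, differentiable in time with values in $L^2_{per}$, and satisfy the equation in $L^2_{per}$ at every time. A bounded solution of (2) is a solution on all of $\mathbb R$ with $\sup_{s\in\mathbb R}\|w(s)\|_{H^2}<\infty$. Put $|v|_X=\sup_s\|v(s)\|+\sup_s\|v_s(s)\|$. **Bounding expressions.** For $c>0$,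 with $F=\|f\|$ and $V=|v|_X$, let $$\tilde{\mathcal R}_0=\tfrac{F}{\gamma}+\sqrt{\tfrac{\mu}{\gamma}}\,V,\qquad \mathcal R_0=\tfrac{F}{\sqrt{\gamma(\gamma+\mu)}}+\sqrt{\tfrac{\mu}{\gamma+\mu}}\,V+\sqrt{\tfrac{\mu}{\gamma+\mu}},$$ and, as functions of $r,\rho\ge 0$, $$\kappa_1(r)=6\gamma Fr+6\mu\gamma Vr+\tfrac{\mu^2c^2r^6}{\gamma}+2\mu Fr+2\mu^2Vr+2\mu Vr,$$ $$\kappa_2(r)=\tfrac{7c^2r^6}{16}+\tfrac12cr^4+2Fr+2\mu Vr+\tfrac67r^2,\qquad h_1(r)=\sqrt{\tfrac{28}{3}\kappa_2(r)+\tfrac{7}{3\gamma}\kappa_1(r)},$$ $$\kappa_5(r,\rho)=\tfrac{c(r^{1/2}\rho^2)^4}{\gamma^3}+\tfrac{c\{r\rho[r^2\rho+(\gamma+\mu)r+\mu V+F]\}^2}{\gamma},$$ $$\kappa_6(r,\rho)=2\kappa_5(r,\rho)+\tfrac{c\mu^2V^2}{\gamma}+c\gamma\mu^2V^2+c\gamma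 F^2+c\mu(r^2\rho)^2+c\mu F^2+c\mu^3V^2,$$ $$\kappa_7(r,\rho)=c(r\rho^3+F^2+\mu^2V^2),\qquad h_2(r,\rho)=\sqrt{\tfrac{4\kappa_6(r,\rho)}{\gamma}+4\kappa_7(r,\rho)}+r.$$ Set $\tilde{\tilde{\mathcal R}}_1=h_1(\tilde{\mathcal R}_0)$, $\tilde{\mathcal R}_1=h_1(\mathcal R_0)$, $\tilde{\mathcal R}_2=h_2(\mathcal R_0,\tilde{\mathcal R}_1)$, $$K_1=6\gamma F\mathcal R_0+6\mu\gamma V\mathcal R_0+\mu(c^2\mathcal R_0^6+\mathcal R_0^2)+2\mu+2\mu F\mathcal R_0+2\mu V\mathcal R_0,$$ $$K_2=\tfrac{3c^2\mathcal R_0^6}{16}+\tfrac12c\mathcal R_0^4+2F\mathcal R_0+2\mu V\mathcal R_0+\tfrac23\mathcal R_0^2,\qquad \mathcal R_1=\sqrt{\tfrac{(\frac32\mu+6\gamma)K_2+K_1}{\gamma+\mu}},$$ $$\mathcal R_2=h_2(\mathcal R_0,\mathcal R_1),\quad \mathcal R'=\mathcal R_2+c\mathcal R_0^2\mathcal R_1+(\gamma+\mu)\mathcal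 R_0+F+\mu V,\quad \mathcal R_\infty=c\,\mathcal R_0\mathcal R_1.$$ A superscript $0$ means that $\mu=0$ is inserted in the formula. Finally $$K_8=\mu(\mathcal R_\infty+\mathcal R_\infty^0)+\mu\mathcal R_\infty^{1/2}(\mathcal R_\infty^0)^{1/2}+(\mathcal R_\infty^0)^{1/2}\mathcal R'+\gamma^{-1/3}(\mathcal R_\infty^0)^{2/3}(\mathcal R')^{4/3}+\mathcal R_\infty^{1/2}\mathcal R'^0+\gamma^{-1/3}\mathcal R_\infty^{2/3}(\mathcal R'^0)^{4/3},$$ $$K_9=\mathcal R_\infty^{1/2}(\mathcal R_\infty^0)^{1/2}\big[K_8+\gamma\big(\mathcal R_\infty+\mathcal R_\infty^0+\mathcal R_\infty^{1/2}(\mathcal R_\infty^0)^{1/2}\big)\big].$$ **Proposition.** For every $L_0>0$ there is a constant $c>0$, depending only on $L_0$, such that the following holds for all periods $L\ge L_0$, all $\gamma>0$, $\mu\in\mathbb R$, $m\in\mathbb N$ and all $0\neq f\in L^2_{per}[0,L]$. Let $u(s)$, $s\in\mathbb R$, be a trajectory of (1) on the global attractor $\mathcal A$, and let $w$ be a bounded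 solution of (2) with $v=P_mu$. If $$\mathcal R_\infty^{1/2}(\mathcal R_\infty^0)^{1/2}<\mu,\qquad \max\Big\{\frac{\tilde{\tilde{\mathcal R}}_1L}{2\pi(m+1)},\frac{\tilde{\mathcal R}_2L}{2\pi(m+1)}\Big\}\le 1,\qquad \frac{cL^2K_9}{\gamma^2(m+1)^2}\le 1,$$ then $w\equiv u$. -/

import Mathlib

open MeasureTheory
open scoped ContDiff

noncomputable section

namespace DampedNLS

/-! ### Periodic function spaces -/

section Spaces

variable (L : ℝ) [Fact (0 < L)]

/-- The space `L²_per[0, L]` of complex `L`-periodic functions. The measure is Lebesgue measure on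
`ℝ / Lℤ`, of total mass `L`, so that `‖u‖² = ∫₀ᴸ |u|²`. -/
abbrev L2per : Type := Lp ℂ 2 (volume : Measure (AddCircle L))

variable {L}

/-- `g` is the weak derivative of the periodic function `h`:
`∫₀ᴸ h φ' = - ∫₀ᴸ g φ` for every smooth `L`-periodic `φ`. -/
def IsWeakDeriv (h g : L2per L) : Prop :=
  ∀ φ : ℝ → ℂ, ContDiff ℝ ∞ φ → Function.Periodic φ L →
    ∫ x in (0 : ℝ)..L, h (x : AddCircle L) * deriv φ x
      = - ∫ x in (0 : ℝ)..L, g (x : AddCircle L) * φ x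

variable (L) in
/-- The Sobolev space `H²_per[0, L]`. An element is stored as the triple `(u, u_x, u_xx)` of an
`L²_per` function and its first two weak derivatives (which are determined by `u`). The subspace
topology of `L² × L² × L²` is the topology of the norm of `H²`. -/
abbrev H2per : Type :=
  {p : L2per L × L2per L × L2per L // IsWeakDeriv p.1 p.2.1 ∧ IsWeakDeriv p.2.1 p.2.2}

/-- The underlying function `u ∈ L²_per` of `u ∈ H²_per`. -/
def H2per.fn (u : H2per L) : L2per L := u.1.1

/-- `u_x`. -/
def H2per.dx (u : H2per L) : L2per L := u.1.2.1

/-- `u_xx`. -/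
def H2per.dxx (u : H2per L) : L2per L := u.1.2.2

/-- The norm `‖u‖_{H²} = (‖u‖² + ‖u_xx‖²)^{1/2}`. -/
def H2per.norm (u : H2per L) : ℝ := √(‖u.fn‖ ^ 2 + ‖u.dxx‖ ^ 2)

variable (L) in
/-- `H_m = span {e^{2πikx/L} : |k| ≤ m}`. -/
def lowModes (m : ℕ) : Submodule ℂ (L2per L) :=
  Submodule.span ℂ
    ((fun k : ℤ => ContinuousMap.toLp 2 (volume : Measure (AddCircle L)) ℂ (fourier k)) ''
      Set.Icc (-(m : ℤ)) m)

instance (m : ℕ) : FiniteDimensional ℂ (lowModes L m) :=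
  FiniteDimensional.span_of_finite ℂ ((Set.finite_Icc _ _).image _)

variable (L) in
/-- `P_m`, the orthogonal projection of `L²` onto `H_m`. -/
def modeProj (m : ℕ) : L2per L →L[ℂ] L2per L := (lowModes L m).starProjection

/-- The norm `|v|_X = sup_s ‖v(s)‖ + sup_s ‖v_s(s)‖`. -/
def normX (v : ℝ → L2per L) : ℝ := (⨆ s, ‖v s‖) + ⨆ s, ‖deriv v s‖

end Spaces

/-! ### The equations and the global attractor -/

section Equations

variable {L : ℝ} [Fact (0 < L)]

/-- `w` solves `i w_s + w_xx + |w|² w + iγ w = g` on the time interval `J`: it is continuous into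
`H²_per`, differentiable into `L²_per`, and the equation holds in `L²_per` at each time in `J`. -/
def SolvesOn (J : Set ℝ) (γ : ℝ) (g : ℝ → L2per L) (w : ℝ → H2per L) : Prop :=
  ContinuousOn w J ∧
  ∀ s ∈ J, ∃ ws : L2per L, HasDerivWithinAt (fun t => (w t).fn) ws J s ∧
    ∀ᵐ x : AddCircle L,
      Complex.I * ws x + (w s).dxx x + ((‖(w s).fn x‖ ^ 2 : ℝ) : ℂ) * (w s).fn x
        + Complex.I * (γ : ℂ) * (w s).fn x = g s x

/-- `S(t) a = b`: the solution of the damped, driven NLS with initial datum `a` equals `b` at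
time `t`. -/
def Evolves (γ : ℝ) (f : L2per L) (t : ℝ) (a b : H2per L) : Prop :=
  ∃ u : ℝ → H2per L, SolvesOn (Set.Ici 0) γ (fun _ => f) u ∧ u 0 = a ∧ u t = b

/-- `S(t) K = K` for all `t ≥ 0`. -/
def IsInvariant (γ : ℝ) (f : L2per L) (K : Set (H2per L)) : Prop :=
  ∀ t : ℝ, 0 ≤ t → {b | ∃ a ∈ K, Evolves γ f t a b} = K

/-- `A` is the global attractor: the maximal compact invariant set. -/
def IsGlobalAttractor (γ : ℝ) (f : L2per L) (A : Set (H2per L)) : Prop :=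
  IsGreatest {K : Set (H2per L) | IsCompact K ∧ IsInvariant γ f K} A

/-- `u(s)`, `s ∈ ℝ`, is a trajectory of the damped, driven NLS on the set `A`. -/
def IsTrajectoryOn (γ : ℝ) (f : L2per L) (A : Set (H2per L)) (u : ℝ → H2per L) : Prop :=
  SolvesOn Set.univ γ (fun _ => f) u ∧ ∀ s, u s ∈ A

/-- `w ∈ Y = C_b(ℝ, H²)` is a bounded solution on `ℝ` of the feedback control equation
`i w_s + w_xx + |w|² w + iγ w = f - iμ [P_m w - v]`. -/
def IsBoundedFeedbackSolution (γ μ : ℝ) (m : ℕ) (f : L2per L) (v : ℝ → L2per L)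
    (w : ℝ → H2per L) : Prop :=
  SolvesOn Set.univ γ (fun s => f - (Complex.I * (μ : ℂ)) • (modeProj L m (w s).fn - v s)) w ∧
  ∃ M : ℝ, ∀ s, (w s).norm ≤ M

end Equations

/-! ### The bounding expressions

Here `c` is the generic constant, `F = ‖f‖` and `V = |v|_X`. A suffix `tt` or `t` stands for a
double or a single tilde. -/

section Bounds

/-- The expression giving `K₁` with one or two tildes from the current `L²` bound `R0`. -/
def K1form (c γ F μ V R0 : ℝ) : ℝ :=
  6 * γ * F * R0 + 6 * μ * γ * V * R0 + μ ^ 2 * c ^ 2 * R0 ^ 6 / γ + 2 * μ * F * R0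
    + 2 * μ ^ 2 * V * R0 + 2 * μ * V * R0

/-- The expression giving `K₂` with one or two tildes from the current `L²` bound `R0`,
with the choice `ξ = 1/7`. -/
def K2form (c F μ V R0 : ℝ) : ℝ :=
  c ^ 2 * R0 ^ 6 / (16 * (1 / 7)) + 1 / 2 * c * R0 ^ 4 + 2 * F * R0 + 2 * μ * V * R0
    + (1 - 1 / 7) * R0 ^ 2

/-- The expression giving an `H¹` bound (with tildes) from the current `L²` bound `R0`. -/
def R1form (c γ F μ V R0 : ℝ) : ℝ :=
  √(28 / 3 * K2form c F μ V R0 + 7 / (3 * γ) * K1form c γ F μ V R0)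

/-- The expression giving `K₅` from an `L²` bound `R0` and an `H¹` bound `R1`. -/
def K5form (c γ F μ V R0 R1 : ℝ) : ℝ :=
  c * (√R0 * R1 ^ 2) ^ 4 / γ ^ 3
    + c * (R0 * R1 * (R0 ^ 2 * R1 + (γ + μ) * R0 + μ * V + F)) ^ 2 / γ

/-- The expression giving `K₆` from an `L²` bound `R0` and an `H¹` bound `R1`. -/
def K6form (c γ F μ V R0 R1 : ℝ) : ℝ :=
  2 * K5form c γ F μ V R0 R1 + c * μ ^ 2 * V ^ 2 / γ + c * γ * μ ^ 2 * V ^ 2 + c * γ * F ^ 2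
    + c * μ * (R0 ^ 2 * R1) ^ 2 + c * μ * F ^ 2 + c * μ ^ 3 * V ^ 2

/-- The expression giving `K₇` from an `L²` bound `R0` and an `H¹` bound `R1`. -/
def K7form (c F μ V R0 R1 : ℝ) : ℝ :=
  c * (R0 * R1 ^ 3 + F ^ 2 + μ ^ 2 * V ^ 2)

/-- The expression giving an `H²` bound from an `L²` bound `R0` and an `H¹` bound `R1`. -/
def R2form (c γ F μ V R0 R1 : ℝ) : ℝ :=
  √(4 * K6form c γ F μ V R0 R1 / γ + 4 * K7form c F μ V R0 R1) + R0

/-- The first `L²` bound. -/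
def R0t (γ F μ V : ℝ) : ℝ := F / γ + √(μ / γ) * V

/-- The first `H¹` bound. -/
def R1tt (c γ F μ V : ℝ) : ℝ := R1form c γ F μ V (R0t γ F μ V)

/-- The improved `L²` bound `R₀`. -/
def R0 (γ F μ V : ℝ) : ℝ :=
  F / √(γ * (γ + μ)) + √(μ / (γ + μ)) * V + √(μ / (γ + μ))

/-- The second `H¹` bound. -/
def R1t (c γ F μ V : ℝ) : ℝ := R1form c γ F μ V (R0 γ F μ V)

/-- The first `H²` bound. -/
def R2t (c γ F μ V : ℝ) : ℝ := R2form c γ F μ V (R0 γ F μ V) (R1t c γ F μ V)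

/-- `K₁`. -/
def K1 (c γ F μ V : ℝ) : ℝ :=
  6 * γ * F * R0 γ F μ V + 6 * μ * γ * V * R0 γ F μ V
    + μ * (c ^ 2 * R0 γ F μ V ^ 6 + R0 γ F μ V ^ 2) + 2 * μ + 2 * μ * F * R0 γ F μ V
    + 2 * μ * V * R0 γ F μ V

/-- `K₂`. -/
def K2 (c γ F μ V : ℝ) : ℝ :=
  3 * c ^ 2 * R0 γ F μ V ^ 6 / 16 + 1 / 2 * c * R0 γ F μ V ^ 4 + 2 * F * R0 γ F μ V
    + 2 * μ * V * R0 γ F μ V + 2 / 3 * R0 γ F μ V ^ 2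

/-- The final `H¹` bound `R₁`. -/
def R1 (c γ F μ V : ℝ) : ℝ :=
  √(((3 / 2 * μ + 6 * γ) * K2 c γ F μ V + K1 c γ F μ V) / (γ + μ))

/-- The final `H²` bound `R₂`. -/
def R2 (c γ F μ V : ℝ) : ℝ := R2form c γ F μ V (R0 γ F μ V) (R1 c γ F μ V)

/-- The time derivative bound `R'`. -/
def Rprime (c γ F μ V : ℝ) : ℝ :=
  R2 c γ F μ V + c * R0 γ F μ V ^ 2 * R1 c γ F μ V + (γ + μ) * R0 γ F μ V + F + μ * V

/-- `R_∞ = c R₀ R₁`. -/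
def Rinf (c γ F μ V : ℝ) : ℝ := c * (R0 γ F μ V * R1 c γ F μ V)

/-- `R_∞^{1/2} (R_∞⁰)^{1/2}`, where the superscript `0` means that `μ = 0` is inserted. -/
def RinfMix (c γ F μ V : ℝ) : ℝ := √(Rinf c γ F μ V) * √(Rinf c γ F 0 V)

/-- `K₈`. -/
def K8 (c γ F μ V : ℝ) : ℝ :=
  μ * (Rinf c γ F μ V + Rinf c γ F 0 V) + μ * RinfMix c γ F μ V
    + √(Rinf c γ F 0 V) * Rprime c γ F μ V
    + 1 / γ ^ (1 / 3 : ℝ) * Rinf c γ F 0 V ^ (2 / 3 : ℝ) * Rprime c γ F μ V ^ (4 / 3 : ℝ)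
    + √(Rinf c γ F μ V) * Rprime c γ F 0 V
    + 1 / γ ^ (1 / 3 : ℝ) * Rinf c γ F μ V ^ (2 / 3 : ℝ) * Rprime c γ F 0 V ^ (4 / 3 : ℝ)

/-- `K₉`. -/
def K9 (c γ F μ V : ℝ) : ℝ :=
  RinfMix c γ F μ V *
    (K8 c γ F μ V + γ * (Rinf c γ F μ V + Rinf c γ F 0 V + RinfMix c γ F μ V))

end Bounds

end DampedNLS

end

/-!
Both `u` and `w` solve the feedback equation with the same datum `v = P_m u`: on the attractor the
feedback term `P_m u - v` vanishes. So the claim is uniqueness of bounded solutions on the whole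
line, and it follows from a differential inequality `y' ≤ -κ y` for a bounded `y ≥ 0`, which forces
`y = 0` (`le_of_deriv_le`). Three ingredients make the inequality available.

*A priori bounds.* The same principle, applied to `‖w‖²` and to the Hamiltonian
(`IsSol.hasDerivAt_energy`), bounds `w` in `L²` and in `H¹`. With the first condition on `m`, the
Poincaré inequality makes the `L²` norm of the modes above `m` at most `1`, so that the feedback
acts as a damping of rate `μ` on all of `w`, up to a loss `μ`; this is how `R₀` arises. For `H²`,
the functional `‖w_s‖² + Re ∫ w² \bar{w_x}²` is used (`IsSol.hasDerivAt_velocity`), in which the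
worst terms of the derivative cancel. The solutions are only once differentiable in time with values
in `L²`, so `‖w_s‖²` is differentiated through difference quotients, whose derivatives converge
locally uniformly (`hasDerivAt_norm_sq_velocity`). The second condition on `m` then makes
the high modes of `w_x` at most `1`, which gives `R₁`, and Agmon's inequality gives
`‖w‖_∞² ≤ R_∞` (`IsSol.norm_sq_le_Rinf_of_modes`). Without feedback these bounds hold for all `m`
(`IsSol.bounds_of_no_feedback`).

*The difference in `L²`.* For `δ = w - u`, only the term `w u \bar δ` of the nonlinearity
contributes to the balance of `‖δ‖²`. The assumption `√R_∞ √R_∞⁰ < μ` lets the feedback absorb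
its low modes, and the Poincaré inequality bounds the rest by a small multiple of `‖δ_x‖²`
(`IsSol.sub_inner_le`).

*The difference in `H¹`.* In the energy of `δ`, expanded about `u`, the quartic terms form a
nonnegative quantity controlled by `‖δ‖²` (`potential_eq`), and of the velocities only `u_s`
enters (`IsSol.hasDerivAt_sub_energy`). A large multiple of `‖δ‖²`, added to this energy, absorbs
the terms of lower order, and the condition on `K₉` ensures that the resulting multiple of
`‖δ_x‖²` is still absorbed by the damping. Hence `δ = 0` (`IsSol.incl_eq`).

Weak derivatives are handled through Fourier coefficients (`HasWD`), and functions in `H¹` through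
their continuous representatives, so that products of functions are products in `C(AddCircle L, ℂ)`
or multiplication operators `mulL` on `L²`. The norm of `C(AddCircle L, ℂ)` is the sup norm.
-/

noncomputable section

namespace DampedNLS

/-! ### Multiplication operators and conjugation on `L²` of the circle -/

section Operators

variable {L : ℝ} [Fact (0 < L)]

/-- The inclusion of the continuous periodic functions into `L²_per`. -/
def incl : C(AddCircle L, ℂ) →L[ℂ] L2per L :=
  ContinuousMap.toLp 2 (volume : Measure (AddCircle L)) ℂ

lemma incl_ae (a : C(AddCircle L, ℂ)) : incl a =ᵐ[volume] a :=
  ContinuousMap.coeFn_toLp volume a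

lemma incl_injective : Function.Injective (incl : C(AddCircle L, ℂ) → L2per L) :=
  ContinuousMap.toLp_injective volume

/-- Multiplication of an `L²` function by a continuous function, as a bounded bilinear map. -/
def mulL : C(AddCircle L, ℂ) →L[ℂ] L2per L →L[ℂ] L2per L :=
  ((ContinuousLinearMap.mul ℂ ℂ).holderL (volume : Measure (AddCircle L)) ⊤ 2 2).comp
    (ContinuousMap.toLp ⊤ (volume : Measure (AddCircle L)) ℂ)

/-- Complex conjugation on `L²`. -/
def conjL : L2per L →L[ℝ] L2per L :=
  ((Complex.conjCLE : ℂ →L[ℝ] ℂ)).compLpL 2 (volume : Measure (AddCircle L))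

lemma mulL_ae (a : C(AddCircle L, ℂ)) (x : L2per L) :
    mulL a x =ᵐ[volume] fun t => a t * x t := by
  have h1 := ContinuousLinearMap.coeFn_holder (r := 2) (ContinuousLinearMap.mul ℂ ℂ)
    (ContinuousMap.toLp ⊤ (volume : Measure (AddCircle L)) ℂ a) x
  have h2 := ContinuousMap.coeFn_toLp (p := ⊤) (𝕜 := ℂ) (volume : Measure (AddCircle L)) a
  filter_upwards [h1, h2] with t ht1 ht2
  rw [← ht2]
  exact ht1

lemma conjL_ae (x : L2per L) : conjL x =ᵐ[volume] fun t => star (x t) :=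
  ContinuousLinearMap.coeFn_compLp (Complex.conjCLE : ℂ →L[ℝ] ℂ) x

lemma norm_mulL_le (a : C(AddCircle L, ℂ)) (x : L2per L) : ‖mulL a x‖ ≤ ‖a‖ * ‖x‖ := by
  refine Lp.norm_le_mul_norm_of_ae_le_mul ?_
  filter_upwards [mulL_ae a x] with t ht
  rw [ht, norm_mul]
  exact mul_le_mul_of_nonneg_right (a.norm_coe_le_norm t) (norm_nonneg _)

lemma norm_conjL (x : L2per L) : ‖conjL x‖ = ‖x‖ := by
  refine le_antisymm (Lp.norm_le_norm_of_ae_le ?_) (Lp.norm_le_norm_of_ae_le ?_) <;>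
  · filter_upwards [conjL_ae x] with t ht
    rw [ht, norm_star]

lemma mulL_incl (a b : C(AddCircle L, ℂ)) : mulL a (incl b) = incl (a * b) := by
  refine Lp.ext ?_
  filter_upwards [mulL_ae a (incl b), incl_ae b, incl_ae (a * b)] with t h1 h2 h3
  rw [h1, h2, h3, ContinuousMap.mul_apply]

lemma conjL_incl (a : C(AddCircle L, ℂ)) : conjL (incl a) = incl (star a) := by
  refine Lp.ext ?_
  filter_upwards [conjL_ae (incl a), incl_ae a, incl_ae (star a)] with t h1 h2 h3
  rw [h1, h2, h3, ContinuousMap.star_apply]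

lemma conjL_conjL (x : L2per L) : conjL (conjL x) = x := by
  refine Lp.ext ?_
  filter_upwards [conjL_ae (conjL x), conjL_ae x] with t h1 h2
  rw [h1, h2, star_star]

lemma conjL_mulL (a : C(AddCircle L, ℂ)) (x : L2per L) :
    conjL (mulL a x) = mulL (star a) (conjL x) := by
  refine Lp.ext ?_
  filter_upwards [conjL_ae (mulL a x), mulL_ae a x, mulL_ae (star a) (conjL x), conjL_ae x]
    with t h1 h2 h3 h4
  rw [h1, h2, h3, h4, ContinuousMap.star_apply, star_mul']

lemma conjL_smul (c : ℂ) (x : L2per L) : conjL (c • x) = star c • conjL x := by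
  refine Lp.ext ?_
  filter_upwards [conjL_ae (c • x), Lp.coeFn_smul c x, Lp.coeFn_smul (star c) (conjL x), conjL_ae x]
    with t h1 h2 h3 h4
  rw [h1, h2, h3, Pi.smul_apply, Pi.smul_apply, h4, smul_eq_mul, star_mul', smul_eq_mul]

lemma mulL_smul_left (c : ℂ) (a : C(AddCircle L, ℂ)) (x : L2per L) :
    mulL (c • a) x = c • mulL a x := by
  rw [map_smul]; rfl

lemma mulL_add_left (a b : C(AddCircle L, ℂ)) (x : L2per L) :
    mulL (a + b) x = mulL a x + mulL b x := by
  rw [map_add]; rfl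

lemma inner_mulL (a : C(AddCircle L, ℂ)) (x y : L2per L) :
    inner ℂ x (mulL a y) = inner ℂ (mulL (star a) x) y := by
  rw [L2.inner_def, L2.inner_def]
  refine integral_congr_ae ?_
  filter_upwards [mulL_ae a y, mulL_ae (star a) x] with t h1 h2
  rw [h1, h2, RCLike.inner_apply, RCLike.inner_apply, ContinuousMap.star_apply, map_mul,
    starRingEnd_apply, starRingEnd_apply, star_star]
  ring

lemma inner_conjL (x y : L2per L) : inner ℂ (conjL x) (conjL y) = star (inner ℂ x y) := by
  rw [L2.inner_def, L2.inner_def, ← starRingEnd_apply, ← integral_conj]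
  refine integral_congr_ae ?_
  filter_upwards [conjL_ae x, conjL_ae y] with t h1 h2
  rw [h1, h2, RCLike.inner_apply, RCLike.inner_apply, map_mul]
  rfl

lemma real_inner_eq_re (x y : L2per L) : inner ℝ x y = (inner ℂ x y).re := by
  have h := integral_re (𝕜 := ℂ) (L2.integrable_inner (𝕜 := ℂ) x y)
  rw [L2.inner_def, L2.inner_def]
  simpa using h

lemma real_inner_mulL (a : C(AddCircle L, ℂ)) (x y : L2per L) :
    inner ℝ x (mulL a y) = inner ℝ (mulL (star a) x) y := by
  rw [real_inner_eq_re, real_inner_eq_re, inner_mulL]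

lemma real_inner_conjL (x y : L2per L) : inner ℝ (conjL x) (conjL y) = inner ℝ x y := by
  rw [real_inner_eq_re, real_inner_eq_re, inner_conjL]; rfl

lemma real_inner_I_smul_right (x y : L2per L) :
    inner ℝ x (Complex.I • y) = - inner ℝ (Complex.I • x) y := by
  rw [real_inner_eq_re, real_inner_eq_re, inner_smul_right, inner_smul_left]
  simp

lemma real_inner_I_smul_self (x : L2per L) : inner ℝ (Complex.I • x) x = 0 := by
  have h := real_inner_I_smul_right x x
  rw [real_inner_comm] at h
  linarith

lemma norm_incl_le (a : C(AddCircle L, ℂ)) : ‖incl a‖ ^ 2 ≤ L * ‖a‖ ^ 2 := by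
  have hL : (0 : ℝ) < L := Fact.out
  have h := ContinuousMap.inner_toLp (volume : Measure (AddCircle L)) a a
  rw [← @real_inner_self_eq_norm_sq, real_inner_eq_re]
  have h2 : inner ℂ (incl a) (incl a) = ∫ x : AddCircle L, a x * (starRingEnd ℂ) (a x) := h
  rw [h2]
  refine (Complex.re_le_norm _).trans ((norm_integral_le_of_norm_le_const
    (C := ‖a‖ ^ 2) (Filter.Eventually.of_forall fun x => ?_)).trans ?_)
  · rw [norm_mul, RCLike.norm_conj, ← sq]
    exact pow_le_pow_left₀ (norm_nonneg _) (a.norm_coe_le_norm x) 2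
  · rw [Measure.real, AddCircle.measure_univ, ENNReal.toReal_ofReal hL.le, mul_comm]

end Operators

/-! ### Fourier series and weak derivatives -/

section Fourier

variable {L : ℝ}

lemma fourier_star (k : ℤ) : star (fourier k : C(AddCircle L, ℂ)) = fourier (-k) := by
  ext x
  rw [ContinuousMap.star_apply, fourier_neg]; rfl

lemma fourier_mul (j k : ℤ) : (fourier j * fourier k : C(AddCircle L, ℂ)) = fourier (j + k) := by
  ext x
  rw [ContinuousMap.mul_apply, fourier_add]

/-- The symbol `2πik/L` of the derivative. -/
def dsymb (L : ℝ) (k : ℤ) : ℂ := 2 * Real.pi * Complex.I * k / L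

lemma star_dsymb (k : ℤ) : star (dsymb L k) = - dsymb L k := by
  simp [dsymb]
  ring

variable [Fact (0 < L)]

/-- The exponential `e^{2πikx/L}` in `L²`. -/
def em (k : ℤ) : L2per L := incl (fourier k)

lemma inner_em (j k : ℤ) : inner ℂ (em j : L2per L) (em k) = if j = k then (L : ℂ) else 0 := by
  have hL : (0 : ℝ) < L := Fact.out
  have h := (orthonormal_iff_ite.mp (orthonormal_fourier (T := L))) j k
  rw [ContinuousMap.inner_toLp] at h
  have h2 : inner ℂ (em j : L2per L) (em k)
      = ∫ x : AddCircle L, fourier k x * (starRingEnd ℂ) (fourier j x) :=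
    ContinuousMap.inner_toLp _ _ _
  rw [h2]
  rw [AddCircle.integral_haarAddCircle] at h
  have h3 := congrArg (fun z => (L : ℂ) * z) h
  simp only [Complex.real_smul, Complex.ofReal_inv] at h3
  rw [mul_inv_cancel_left₀ (by exact_mod_cast hL.ne')] at h3
  rw [h3]
  split_ifs <;> simp

variable (L) in
/-- The normalised exponentials `L^{-1/2} e^{2πikx/L}`. -/
def emUnit (k : ℤ) : L2per L := ((√L)⁻¹ : ℂ) • em k

lemma orthonormal_emUnit : Orthonormal ℂ (emUnit L) := by
  have hL : (0 : ℝ) < L := Fact.out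
  rw [orthonormal_iff_ite]
  intro j k
  rw [emUnit, emUnit, inner_smul_left, inner_smul_right, inner_em]
  split_ifs
  · rw [map_inv₀, Complex.conj_ofReal, ← mul_assoc, ← mul_inv, ← Complex.ofReal_mul,
      Real.mul_self_sqrt hL.le, inv_mul_cancel₀ (by exact_mod_cast hL.ne')]
  · simp

variable (L) in
/-- The Fourier basis of `L²_per`, for Lebesgue measure of total mass `L`. -/
def fourierHB : HilbertBasis ℤ ℂ (L2per L) :=
  HilbertBasis.mk (v := emUnit L) orthonormal_emUnit (by
    have hL : (0 : ℝ) < L := Fact.out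
    have h := (ContinuousMap.toLp_denseRange (p := 2) ℂ (volume : Measure (AddCircle L)) ℂ
      (by simp)).topologicalClosure_map_submodule span_fourier_closure_eq_top
    rw [← h]
    refine Submodule.topologicalClosure_mono ?_
    rw [Submodule.map_span, Submodule.span_le]
    rintro _ ⟨_, ⟨k, rfl⟩, rfl⟩
    have h2 : (√L : ℂ) • emUnit L k ∈ Submodule.span ℂ (Set.range (emUnit L)) :=
      Submodule.smul_mem _ _ (Submodule.subset_span ⟨k, rfl⟩)
    rw [emUnit, smul_smul, mul_inv_cancel₀, one_smul] at h2
    · exact h2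
    · exact_mod_cast (Real.sqrt_pos.mpr hL).ne')

lemma fourierHB_apply (k : ℤ) : fourierHB L k = ((√L)⁻¹ : ℂ) • em k := by
  rw [fourierHB, HilbertBasis.coe_mk, emUnit]

lemma inner_fourierHB (k : ℤ) (h : L2per L) :
    inner ℂ (fourierHB L k) h = ((√L)⁻¹ : ℂ) * inner ℂ (em k) h := by
  rw [fourierHB_apply, inner_smul_left, map_inv₀, Complex.conj_ofReal]

/-- `g` is the weak derivative of `h`, expressed by the Fourier coefficients (here without the
factor `1 / L`, which cancels). -/
def HasWD (h g : L2per L) : Prop :=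
  ∀ k : ℤ, inner ℂ (em k) g = dsymb L k * inner ℂ (em k) h

lemma ext_em {h g : L2per L} (H : ∀ k : ℤ, inner ℂ (em k) h = inner ℂ (em k) g) : h = g := by
  refine (fourierHB L).repr.injective ?_
  ext k
  rw [HilbertBasis.repr_apply_apply, HilbertBasis.repr_apply_apply, inner_fourierHB,
    inner_fourierHB, H k]

lemma HasWD.unique {h g g' : L2per L} (H : HasWD h g) (H' : HasWD h g') : g = g' :=
  ext_em fun k => by rw [H k, H' k]

lemma HasWD.add {h g h' g' : L2per L} (H : HasWD h g) (H' : HasWD h' g') :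
    HasWD (h + h') (g + g') := fun k => by
  rw [inner_add_right, inner_add_right, H k, H' k, mul_add]

lemma HasWD.sub {h g h' g' : L2per L} (H : HasWD h g) (H' : HasWD h' g') :
    HasWD (h - h') (g - g') := fun k => by
  rw [inner_sub_right, inner_sub_right, H k, H' k, mul_sub]

lemma HasWD.smul {h g : L2per L} (H : HasWD h g) (c : ℂ) : HasWD (c • h) (c • g) := fun k => by
  rw [inner_smul_right, inner_smul_right, H k, mul_left_comm]

lemma HasWD.zero : HasWD (0 : L2per L) 0 := fun k => by
  rw [inner_zero_right, mul_zero]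

lemma conjL_em (k : ℤ) : conjL (em k : L2per L) = em (-k) := by
  rw [em, conjL_incl, fourier_star, em]

lemma HasWD.conj {h g : L2per L} (H : HasWD h g) : HasWD (conjL h) (conjL g) := fun k => by
  have h1 : (em k : L2per L) = conjL (em (-k)) := by rw [conjL_em, neg_neg]
  rw [h1, inner_conjL, inner_conjL, H (-k), star_mul', star_dsymb]
  congr 1
  simp [dsymb]
  ring

lemma HasWD.inner_eq {h g h' g' : L2per L} (H : HasWD h g) (H' : HasWD h' g') :
    inner ℂ h g' = - inner ℂ g h' := by
  rw [← (fourierHB L).tsum_inner_mul_inner h g', ← (fourierHB L).tsum_inner_mul_inner g h',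
    ← tsum_neg]
  refine tsum_congr fun k => ?_
  rw [← inner_conj_symm h, ← inner_conj_symm g, inner_fourierHB, inner_fourierHB, inner_fourierHB,
    inner_fourierHB, H k, H' k, map_mul, map_mul, map_mul, starRingEnd_apply (dsymb L k),
    star_dsymb]
  ring

/-- Integration by parts. -/
lemma HasWD.real_inner_eq {h g h' g' : L2per L} (H : HasWD h g) (H' : HasWD h' g') :
    inner ℝ h g' = - inner ℝ g h' := by
  rw [real_inner_eq_re, real_inner_eq_re, H.inner_eq H']; rfl

/-- Testing with `e^{-2πikx/L}` gives the relation of the Fourier coefficients. -/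
lemma IsWeakDeriv.hasWD {h g : L2per L} (H : IsWeakDeriv h g) : HasWD h g := by
  intro k
  have hL : (0 : ℝ) < L := Fact.out
  set φ : ℝ → ℂ := fun x => Complex.exp (- dsymb L k * x) with hφ
  have hφ' : ∀ x : ℝ, φ x = (starRingEnd ℂ) (fourier k (x : AddCircle L)) := by
    intro x
    rw [← fourier_neg, fourier_coe_apply, hφ]
    simp only [dsymb]
    push_cast
    ring_nf
  have hper : Function.Periodic φ L := by
    intro x
    rw [hφ', hφ', AddCircle.coe_add_period]
  have hderiv : ∀ x, deriv φ x = - dsymb L k * φ x := by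
    intro x
    have h1 : HasDerivAt (fun x : ℝ => - dsymb L k * (x : ℂ)) (- dsymb L k * 1) x :=
      (Complex.ofRealCLM.hasDerivAt (x := x)).const_mul _
    rw [(h1.cexp).deriv, mul_one, mul_comm]
  have hsm : ContDiff ℝ ∞ φ := by
    have : ContDiff ℝ ∞ (fun x : ℝ => (x : ℂ)) := Complex.ofRealCLM.contDiff
    fun_prop
  have key := H φ hsm hper
  have hcoef : ∀ y : L2per L, inner ℂ (em k) y
      = ∫ x in (0 : ℝ)..L, y (x : AddCircle L) * φ x := by
    intro y
    have h1 : inner ℂ (em k) y = ∫ t : AddCircle L, y t * (starRingEnd ℂ) (fourier k t) := by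
      rw [L2.inner_def]
      refine integral_congr_ae ?_
      filter_upwards [incl_ae (fourier k : C(AddCircle L, ℂ))] with t ht
      rw [em, ht, RCLike.inner_apply]
    have h2 := AddCircle.intervalIntegral_preimage L 0
      (fun t : AddCircle L => y t * (starRingEnd ℂ) (fourier k t))
    rw [h1, ← h2, zero_add]
    simp only [hφ']
  rw [hcoef, hcoef]
  simp only [hderiv] at key
  have h3 : ∫ x in (0 : ℝ)..L, h (x : AddCircle L) * (- dsymb L k * φ x)
      = - dsymb L k * ∫ x in (0 : ℝ)..L, h (x : AddCircle L) * φ x := by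
    rw [← intervalIntegral.integral_const_mul]
    congr 1
    ext x
    ring
  rw [h3] at key
  linear_combination key

end Fourier

/-! ### The mode projection and the Poincaré inequality -/

section Projection

variable {L : ℝ} [Fact (0 < L)] {m : ℕ}

lemma inner_modeProj (x y : L2per L) :
    inner ℂ (modeProj L m x) y = inner ℂ x (modeProj L m y) :=
  Submodule.inner_starProjection_left_eq_right _ x y

lemma real_inner_modeProj (x y : L2per L) :
    inner ℝ (modeProj L m x) y = inner ℝ x (modeProj L m y) := by
  rw [real_inner_eq_re, real_inner_eq_re, inner_modeProj]

lemma modeProj_modeProj (x : L2per L) : modeProj L m (modeProj L m x) = modeProj L m x :=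
  Submodule.starProjection_eq_self_iff.mpr (Submodule.starProjection_apply_mem _ x)

lemma norm_modeProj_le (x : L2per L) : ‖modeProj L m x‖ ≤ ‖x‖ :=
  Submodule.norm_starProjection_apply_le _ x

lemma modeProj_em_of_mem {k : ℤ} (hk : k ∈ Set.Icc (-(m : ℤ)) m) :
    modeProj L m (em k) = em k :=
  Submodule.starProjection_eq_self_iff.mpr (Submodule.subset_span ⟨k, hk, rfl⟩)

lemma modeProj_em_of_notMem {k : ℤ} (hk : k ∉ Set.Icc (-(m : ℤ)) m) :
    modeProj L m (em k : L2per L) = 0 := by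
  refine (Submodule.starProjection_apply_eq_zero_iff _).mpr ?_
  rw [lowModes, Submodule.mem_orthogonal]
  intro x hx
  induction hx using Submodule.span_induction with
  | mem x h =>
    obtain ⟨j, hj, rfl⟩ := h
    have h1 := inner_em (L := L) j k
    rw [if_neg (fun h : j = k => hk (h ▸ hj))] at h1
    exact h1
  | zero => exact inner_zero_left _
  | add x y _ _ hx hy => rw [inner_add_left, hx, hy, add_zero]
  | smul c x _ hx => rw [inner_smul_left, hx, mul_zero]

lemma inner_em_modeProj (k : ℤ) (h : L2per L) : inner ℂ (em k) (modeProj L m h)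
    = if k ∈ Set.Icc (-(m : ℤ)) m then inner ℂ (em k) h else 0 := by
  rw [← inner_modeProj]
  split_ifs with hk
  · rw [modeProj_em_of_mem hk]
  · rw [modeProj_em_of_notMem hk, inner_zero_left]

lemma HasWD.modeProj {h g : L2per L} (H : HasWD h g) (m : ℕ) :
    HasWD (modeProj L m h) (DampedNLS.modeProj L m g) := fun k => by
  rw [inner_em_modeProj, inner_em_modeProj, H k]
  split_ifs <;> simp

lemma norm_sq_eq_add_modeProj (x : L2per L) :
    ‖x‖ ^ 2 = ‖modeProj L m x‖ ^ 2 + ‖x - modeProj L m x‖ ^ 2 := by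
  have h := @norm_sub_sq_real _ _ _ x (modeProj L m x)
  have h2 : inner ℝ x (modeProj L m x) = ‖modeProj L m x‖ ^ 2 := by
    rw [← real_inner_self_eq_norm_sq, real_inner_modeProj, modeProj_modeProj]
  rw [h2] at h
  linarith

lemma hasSum_norm_sq (x : L2per L) :
    HasSum (fun k => ‖inner ℂ (fourierHB L k) x‖ ^ 2) (‖x‖ ^ 2) := by
  have h := (fourierHB L).hasSum_inner_mul_inner x x
  have h2 := Complex.hasSum_re h
  rw [← real_inner_eq_re, real_inner_self_eq_norm_sq] at h2
  convert h2 using 2 with k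
  rw [← inner_conj_symm x, mul_comm, Complex.mul_conj, Complex.ofReal_re, Complex.normSq_eq_norm_sq]

/-- The Poincaré inequality on the high modes. -/
lemma HasWD.norm_sub_modeProj_le {h g : L2per L} (H : HasWD h g) (m : ℕ) :
    ‖h - DampedNLS.modeProj L m h‖
      ≤ L / (2 * Real.pi * ((m : ℝ) + 1)) * ‖g - DampedNLS.modeProj L m g‖ := by
  have hL : (0 : ℝ) < L := Fact.out
  have hpi := Real.pi_pos
  set x := h - DampedNLS.modeProj L m h with hx
  set y := g - DampedNLS.modeProj L m g with hy
  set r := L / (2 * Real.pi * ((m : ℝ) + 1)) with hr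
  have hr0 : 0 < r := by positivity
  have hxy : HasWD x y := H.sub (H.modeProj m)
  have hle : ‖x‖ ^ 2 ≤ r ^ 2 * ‖y‖ ^ 2 := by
    refine hasSum_le (fun k => ?_) (hasSum_norm_sq x) ((hasSum_norm_sq y).mul_left (r ^ 2))
    rw [inner_fourierHB, inner_fourierHB, hxy k]
    by_cases hk : k ∈ Set.Icc (-(m : ℤ)) m
    · have : inner ℂ (em k) x = 0 := by
        rw [hx, inner_sub_right, inner_em_modeProj, if_pos hk, sub_self]
      rw [this]; simp
    · have hk1 : ((m : ℝ) + 1) ≤ |(k : ℝ)| := by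
        have : (m : ℤ) + 1 ≤ |k| := by
          by_contra hc
          exact hk (abs_le.mp (by omega))
        exact_mod_cast this
      have hd : 1 ≤ r * ‖dsymb L k‖ := by
        have : ‖dsymb L k‖ = 2 * Real.pi * |(k : ℝ)| / L := by
          simp [dsymb, abs_of_pos hpi, abs_of_pos hL]
        rw [this, hr, div_mul_div_comm, le_div_iff₀ (by positivity)]
        nlinarith [mul_pos hL hpi]
      rw [norm_mul, norm_mul, norm_mul]
      have e : r ^ 2 * (‖((√L)⁻¹ : ℂ)‖ * (‖dsymb L k‖ * ‖inner ℂ (em k) x‖)) ^ 2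
        = (r * ‖dsymb L k‖) ^ 2 * (‖((√L)⁻¹ : ℂ)‖ * ‖inner ℂ (em k) x‖) ^ 2 := by ring
      rw [e]
      exact le_mul_of_one_le_left (sq_nonneg _) (one_le_pow₀ hd)
  rw [← mul_pow] at hle
  exact le_of_sq_le_sq hle (by positivity)
where
  le_of_sq_le_sq {a b : ℝ} (h : a ^ 2 ≤ b ^ 2) (hb : 0 ≤ b) : a ≤ b := abs_le_of_sq_le_sq' h hb |>.2

end Projection

/-! ### Agmon's inequality and continuous representatives -/

section Agmon

variable {L : ℝ} [Fact (0 < L)]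

/-- Agmon's inequality for a continuously differentiable periodic function. -/
lemma norm_sq_le_of_hasDerivAt (φ ψ : C(AddCircle L, ℂ))
    (hd : ∀ x : ℝ, HasDerivAt (fun t : ℝ => φ (t : AddCircle L)) (ψ (x : AddCircle L)) x) :
    ‖φ‖ ^ 2 ≤ ‖incl φ‖ ^ 2 / L + 2 * ‖incl φ‖ * ‖incl ψ‖ := by
  have hL : (0 : ℝ) < L := Fact.out
  set C := ‖incl φ‖ * ‖incl ψ‖ with hC
  set F : ℝ → ℂ := fun t => φ (t : AddCircle L) with hF
  set G : ℝ → ℂ := fun t => ψ (t : AddCircle L) with hG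
  have hFc : Continuous F := φ.continuous.comp (AddCircle.continuous_mk' L)
  have hGc : Continuous G := ψ.continuous.comp (AddCircle.continuous_mk' L)
  -- the absolute values, as elements of `L²`
  let A : C(AddCircle L, ℂ) := ⟨fun t => ((‖φ t‖ : ℝ) : ℂ), by fun_prop⟩
  let B : C(AddCircle L, ℂ) := ⟨fun t => ((‖ψ t‖ : ℝ) : ℂ), by fun_prop⟩
  have hA : ‖incl A‖ ≤ ‖incl φ‖ := by
    refine Lp.norm_le_norm_of_ae_le ?_
    filter_upwards [incl_ae A, incl_ae φ] with t h1 h2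
    rw [h1, h2]
    simp [A]
  have hB : ‖incl B‖ ≤ ‖incl ψ‖ := by
    refine Lp.norm_le_norm_of_ae_le ?_
    filter_upwards [incl_ae B, incl_ae ψ] with t h1 h2
    rw [h1, h2]
    simp [B]
  have hint : ∀ p q : C(AddCircle L, ℂ), ∀ x : ℝ, inner ℂ (incl p) (incl q)
      = ∫ t in x..(x + L), q (t : AddCircle L) * (starRingEnd ℂ) (p (t : AddCircle L)) := by
    intro p q x
    have h1 := ContinuousMap.inner_toLp (volume : Measure (AddCircle L)) p q
    rw [AddCircle.intervalIntegral_preimage L x (fun t => q t * (starRingEnd ℂ) (p t))]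
    exact h1
  have hAB : ∀ x : ℝ, ∫ t in x..(x + L), ‖F t‖ * ‖G t‖ ≤ C := by
    intro x
    have h1 := hint A B x
    have h2 : (inner ℂ (incl A) (incl B)).re = ∫ t in x..(x + L), ‖F t‖ * ‖G t‖ := by
      rw [h1, ← Complex.reCLM_apply, ← ContinuousLinearMap.intervalIntegral_comp_comm]
      · congr 1
        ext t
        simp [A, B, hF, hG, mul_comm]
      · apply Continuous.intervalIntegrable
        simp only [A, B, ContinuousMap.coe_mk, Complex.conj_ofReal]
        fun_prop
    rw [← h2]
    refine (Complex.re_le_norm _).trans ((norm_inner_le_norm _ _).trans ?_)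
    exact mul_le_mul hA hB (norm_nonneg _) (norm_nonneg _)
  have hsq : ∀ x : ℝ, ∫ t in x..(x + L), ‖F t‖ ^ 2 = ‖incl φ‖ ^ 2 := by
    intro x
    rw [← @real_inner_self_eq_norm_sq, real_inner_eq_re, hint φ φ x, ← Complex.reCLM_apply,
      ← ContinuousLinearMap.intervalIntegral_comp_comm]
    · congr 1
      ext t
      simp only [hF, Complex.mul_conj, Complex.reCLM_apply, Complex.ofReal_re,
        Complex.normSq_eq_norm_sq]
    · apply Continuous.intervalIntegrable
      exact hFc.mul (Complex.continuous_conj.comp hFc)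
  -- pointwise bound by the fundamental theorem of calculus and averaging
  have hpt : ∀ x : ℝ, ‖F (x + L)‖ ^ 2 ≤ ‖incl φ‖ ^ 2 / L + 2 * C := by
    intro x
    have hder : ∀ t, HasDerivAt (fun t => ‖F t‖ ^ 2) (2 * inner ℝ (F t) (G t)) t :=
      fun t => (hd t).norm_sq
    have hcont : Continuous fun t => 2 * inner ℝ (F t) (G t) := by fun_prop
    have hy : ∀ y ∈ Set.Icc x (x + L), ‖F (x + L)‖ ^ 2 ≤ ‖F y‖ ^ 2 + 2 * C := by
      intro y hy
      have h1 := intervalIntegral.integral_eq_sub_of_hasDerivAt (a := y) (b := x + L)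
        (fun t _ => hder t) (hcont.intervalIntegrable _ _)
      have h2 : ∫ t in y..(x + L), 2 * inner ℝ (F t) (G t)
          ≤ ∫ t in y..(x + L), 2 * (‖F t‖ * ‖G t‖) := by
        refine intervalIntegral.integral_mono_on hy.2 (hcont.intervalIntegrable _ _)
          (Continuous.intervalIntegrable (by fun_prop) _ _) fun t _ => ?_
        have := real_inner_le_norm (F t) (G t)
        linarith
      have h3 : ∫ t in y..(x + L), 2 * (‖F t‖ * ‖G t‖)
          ≤ ∫ t in x..(x + L), 2 * (‖F t‖ * ‖G t‖) := by
        refine intervalIntegral.integral_mono_interval hy.1 hy.2 le_rfl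
          (Filter.Eventually.of_forall fun t => by positivity)
          (Continuous.intervalIntegrable (by fun_prop) _ _)
      have h4 := hAB x
      simp only [intervalIntegral.integral_const_mul] at h1 h2 h3
      linarith
    have h5 : ∫ _y in x..(x + L), ‖F (x + L)‖ ^ 2 ≤ ∫ y in x..(x + L), (‖F y‖ ^ 2 + 2 * C) :=
      intervalIntegral.integral_mono_on (by linarith) (by simp)
        (Continuous.intervalIntegrable (by fun_prop) _ _) hy
    rw [intervalIntegral.integral_add (Continuous.intervalIntegrable (by fun_prop) _ _) (by simp),
      hsq x, intervalIntegral.integral_const, intervalIntegral.integral_const, add_sub_cancel_left,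
      smul_eq_mul, smul_eq_mul] at h5
    rw [div_add' _ _ _ hL.ne', le_div_iff₀ hL]
    linarith
  have hfin : ‖φ‖ ≤ √(‖incl φ‖ ^ 2 / L + 2 * C) := by
    refine (ContinuousMap.norm_le _ (Real.sqrt_nonneg _)).mpr fun t => ?_
    induction t using QuotientAddGroup.induction_on with
    | H t =>
      refine Real.le_sqrt_of_sq_le ?_
      have := hpt (t - L)
      rwa [sub_add_cancel] at this
  have := pow_le_pow_left₀ (norm_nonneg _) hfin 2
  rw [Real.sq_sqrt (by positivity)] at this
  rw [mul_assoc]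
  exact this

/-- The partial Fourier sum of `h` over the frequencies in `F`. -/
def trig (F : Finset ℤ) (h : L2per L) : C(AddCircle L, ℂ) :=
  ∑ k ∈ F, ((L : ℂ)⁻¹ * inner ℂ (em k) h) • fourier k

lemma tendsto_incl_trig (h : L2per L) :
    Filter.Tendsto (fun F => incl (trig F h)) Filter.atTop (nhds h) := by
  have hL : (0 : ℝ) < L := Fact.out
  have h1 := (fourierHB L).hasSum_repr h
  refine Filter.Tendsto.congr (fun F => ?_) h1
  rw [trig, map_sum]
  refine Finset.sum_congr rfl fun k _ => ?_
  change (fourierHB L).repr h k • fourierHB L k = _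
  rw [HilbertBasis.repr_apply_apply, inner_fourierHB, fourierHB_apply, map_smul, smul_smul, em]
  congr 1
  have : ((√L : ℝ) : ℂ) * ((√L : ℝ) : ℂ) = L := by
    rw [← Complex.ofReal_mul, Real.mul_self_sqrt hL.le]
  rw [← this, mul_inv]
  ring

lemma hasDerivAt_trig {h g : L2per L} (H : HasWD h g) (F : Finset ℤ) (x : ℝ) :
    HasDerivAt (fun t : ℝ => trig F h (t : AddCircle L)) (trig F g (x : AddCircle L)) x := by
  simp only [trig, ContinuousMap.sum_apply, ContinuousMap.smul_apply]
  refine HasDerivAt.fun_sum fun k _ => ?_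
  have h1 : HasDerivAt (fun t : ℝ => ((L : ℂ)⁻¹ * inner ℂ (em k) h) • fourier k (t : AddCircle L))
      (((L : ℂ)⁻¹ * inner ℂ (em k) h) • (dsymb L k * fourier k (x : AddCircle L))) x :=
    (_root_.hasDerivAt_fourier L k x).fun_const_smul _
  refine h1.congr_deriv ?_
  rw [H k, smul_eq_mul, smul_eq_mul]
  ring

lemma trig_sub_apply {h g : L2per L} (H : HasWD h g) (F F' : Finset ℤ) :
    ‖trig F h - trig F' h‖ ^ 2 ≤ ‖incl (trig F h - trig F' h)‖ ^ 2 / L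
      + 2 * ‖incl (trig F h - trig F' h)‖ * ‖incl (trig F g - trig F' g)‖ := by
  refine norm_sq_le_of_hasDerivAt _ _ fun x => ?_
  exact (hasDerivAt_trig H F x).fun_sub (hasDerivAt_trig H F' x)

/-- A function with a weak derivative has a continuous representative, which is the uniform limit
of the Fourier sums. -/
lemma HasWD.exists_rep {h g : L2per L} (H : HasWD h g) :
    ∃ a : C(AddCircle L, ℂ), incl a = h ∧
      Filter.Tendsto (fun F => trig F h) Filter.atTop (nhds a) := by
  have hL : (0 : ℝ) < L := Fact.out
  have hc : CauchySeq (fun F => trig F h) := by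
    have ch := (tendsto_incl_trig h).cauchySeq
    have cg := (tendsto_incl_trig g).cauchySeq
    rw [cauchySeq_iff_tendsto_dist_atTop_0] at ch cg ⊢
    have h1 := (((ch.pow 2).div_const L).add ((ch.const_mul 2).mul cg)).sqrt
    simp only [ne_eq, OfNat.ofNat_ne_zero, not_false_eq_true, zero_pow, zero_div, mul_zero,
      add_zero, Real.sqrt_zero] at h1
    refine squeeze_zero (fun _ => dist_nonneg) (fun p => ?_) h1
    rw [dist_eq_norm, dist_eq_norm, dist_eq_norm]
    refine Real.le_sqrt_of_sq_le ?_
    have := trig_sub_apply H p.1 p.2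
    rwa [map_sub, map_sub] at this
  obtain ⟨a, ha⟩ := cauchySeq_tendsto_of_complete hc
  refine ⟨a, ?_, ha⟩
  exact tendsto_nhds_unique ((incl.continuous.tendsto a).comp ha) (tendsto_incl_trig h)

lemma HasWD.tendsto_trig {a : C(AddCircle L, ℂ)} {g : L2per L} (H : HasWD (incl a) g) :
    Filter.Tendsto (fun F => trig F (incl a)) Filter.atTop (nhds a) := by
  obtain ⟨b, hb, hb'⟩ := H.exists_rep
  rwa [incl_injective hb] at hb'

/-- Agmon's inequality. -/
lemma HasWD.norm_sq_le {a : C(AddCircle L, ℂ)} {g : L2per L} (H : HasWD (incl a) g) :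
    ‖a‖ ^ 2 ≤ ‖incl a‖ ^ 2 / L + 2 * ‖incl a‖ * ‖g‖ := by
  have h1 := H.tendsto_trig
  have h2 := (tendsto_incl_trig (incl a)).norm
  have h3 := (tendsto_incl_trig g).norm
  refine le_of_tendsto_of_tendsto' (h1.norm.pow 2)
    (((h2.pow 2).div_const L).add ((h2.const_mul 2).mul h3)) fun F => ?_
  exact norm_sq_le_of_hasDerivAt _ _ (hasDerivAt_trig H F)

/-- Agmon's inequality for derivatives: as they have mean zero, no lower order term is needed. -/
lemma HasWD.norm_sq_le_of_deriv {h : L2per L} {b : C(AddCircle L, ℂ)} {g : L2per L}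
    (H0 : HasWD h (incl b)) (H : HasWD (incl b) g) : ‖b‖ ^ 2 ≤ 3 * ‖incl b‖ * ‖g‖ := by
  have hL : (0 : ℝ) < L := Fact.out
  have h1 := H.norm_sq_le
  have h2 := H.norm_sub_modeProj_le 0
  have h0 : DampedNLS.modeProj L 0 (incl b) = 0 := by
    refine ext_em fun k => ?_
    rw [inner_em_modeProj, inner_zero_right]
    split_ifs with hk
    · have : k = 0 := by simpa using hk
      rw [H0 k, this]; simp [dsymb]
    · rfl
  have h0' : DampedNLS.modeProj L 0 g = 0 := by
    have h3 := H.modeProj 0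
    rw [h0] at h3
    exact h3.unique HasWD.zero
  rw [h0, h0', sub_zero, sub_zero] at h2
  simp only [Nat.cast_zero, zero_add, mul_one] at h2
  have h4 : ‖incl b‖ ^ 2 / L ≤ ‖incl b‖ * ‖g‖ := by
    rw [div_le_iff₀ hL, sq, mul_assoc]
    refine mul_le_mul_of_nonneg_left (h2.trans ?_) (norm_nonneg _)
    rw [mul_comm]
    refine mul_le_mul_of_nonneg_left ?_ (norm_nonneg _)
    refine div_le_self hL.le ?_
    nlinarith [Real.pi_gt_three]
  linarith

lemma hasWD_em_mul (j : ℤ) {b : C(AddCircle L, ℂ)} {g : L2per L} (H : HasWD (incl b) g) :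
    HasWD (incl (fourier j * b)) (dsymb L j • incl (fourier j * b) + mulL (fourier j) g) := by
  intro k
  have h1 : ∀ x : L2per L, inner ℂ (em k) (mulL (fourier j) x) = inner ℂ (em (k - j)) x := by
    intro x
    rw [inner_mulL, em, mulL_incl, fourier_star, fourier_mul, em]
    congr 3
    ring
  rw [inner_add_right, inner_smul_right, ← mulL_incl, h1, h1, H (k - j)]
  simp [dsymb]
  ring

lemma hasWD_trig_mul {h h' : L2per L} (H' : HasWD h h') (F : Finset ℤ)
    {b : C(AddCircle L, ℂ)} {g : L2per L} (H : HasWD (incl b) g) :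
    HasWD (incl (trig F h * b)) (mulL b (incl (trig F h')) + mulL (trig F h) g) := by
  induction F using Finset.induction_on with
  | empty => simpa [trig] using HasWD.zero
  | insert j F hj ih =>
    have h1 := ((hasWD_em_mul j H).smul ((L : ℂ)⁻¹ * inner ℂ (em j) h)).add ih
    have e : ∀ y : L2per L, trig (insert j F) y
        = ((L : ℂ)⁻¹ * inner ℂ (em j) y) • fourier j + trig F y := by
      intro y
      rw [trig, Finset.sum_insert hj, trig]
    rw [e, e, add_mul, map_add, smul_mul_assoc, map_smul, map_add, map_add, mulL_add_left, map_smul,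
      map_smul, mulL_smul_left, mulL_incl, mulL_incl, H' j]
    convert h1 using 1
    rw [smul_add, smul_smul, mul_comm b]
    rw [mul_comm b (trig F h'), mul_left_comm, mul_comm (dsymb L j), mulL_incl,
      mul_comm (trig F h')]
    abel

/-- The product rule for weak derivatives. -/
lemma HasWD.mul {a b : C(AddCircle L, ℂ)} {g g' : L2per L} (H : HasWD (incl a) g)
    (H' : HasWD (incl b) g') : HasWD (incl (a * b)) (mulL b g + mulL a g') := by
  intro k
  have h1 := H.tendsto_trig
  have hc1 : Continuous fun c : C(AddCircle L, ℂ) => incl (c * b) :=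
    incl.continuous.comp (continuous_id.mul continuous_const)
  have hc2 : Continuous fun c : C(AddCircle L, ℂ) => mulL c g' :=
    mulL.continuous.clm_apply continuous_const
  have h2 : Filter.Tendsto (fun F => inner ℂ (em k) (incl (trig F (incl a) * b))) Filter.atTop
      (nhds (inner ℂ (em k) (incl (a * b)))) :=
    Filter.Tendsto.inner tendsto_const_nhds ((hc1.tendsto a).comp h1)
  have h3 : Filter.Tendsto (fun F => inner ℂ (em k) (mulL b (incl (trig F g))
      + mulL (trig F (incl a)) g')) Filter.atTop
      (nhds (inner ℂ (em k) (mulL b g + mulL a g'))) :=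
    Filter.Tendsto.inner tendsto_const_nhds
      ((((mulL b).continuous.tendsto g).comp (tendsto_incl_trig g)).add ((hc2.tendsto a).comp h1))
  refine tendsto_nhds_unique h3 ?_
  refine Filter.Tendsto.congr (fun F => ?_) (h2.const_mul (dsymb L k))
  exact (hasWD_trig_mul H F H' k).symm

end Agmon

/-! ### Calculus in time -/

section TimeCalculus

/-- If the increments of `Φ` from `s` factor through those of `W` by operators depending
continuously on time, then `Φ` is differentiable at `s` where `W` is. -/
lemma hasDerivAt_of_factor {E F : Type*} [NormedAddCommGroup E] [NormedSpace ℝ E]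
    [NormedAddCommGroup F] [NormedSpace ℝ F] {T : ℝ → E → F} {W : ℝ → E} {Φ : ℝ → F} {z : E} {s : ℝ}
    (hT : Continuous fun p : ℝ × E => T p.1 p.2) (hsmul : ∀ t (r : ℝ) x, T t (r • x) = r • T t x)
    (hW : HasDerivAt W z s) (h : ∀ t, Φ t - Φ s = T t (W t - W s)) : HasDerivAt Φ (T s z) s := by
  rw [hasDerivAt_iff_tendsto_slope] at hW ⊢
  have h1 : Filter.Tendsto (fun t : ℝ => (t, slope W s t)) (nhdsWithin s {s}ᶜ) (nhds (s, z)) :=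
    (tendsto_nhdsWithin_of_tendsto_nhds Filter.tendsto_id).prodMk_nhds hW
  refine ((hT.tendsto (s, z)).comp h1).congr fun t => ?_
  simp only [Function.comp, slope, vsub_eq_sub]
  rw [h t, hsmul]

/-- A function on the whole line that is bounded above and satisfies `y' ≤ κ (K - y)` is at most
`K`. -/
lemma le_of_deriv_le {y y' : ℝ → ℝ} {κ K M : ℝ} (hκ : 0 < κ) (hy : ∀ s, HasDerivAt y (y' s) s)
    (h : ∀ s, y' s ≤ κ * (K - y s)) (hM : ∀ s, y s ≤ M) (s : ℝ) : y s ≤ K := by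
  have hd : ∀ t, HasDerivAt (fun t => Real.exp (κ * t) * (y t - K))
      (Real.exp (κ * t) * κ * (y t - K) + Real.exp (κ * t) * y' t) t := by
    intro t
    have h1 : HasDerivAt (fun t => Real.exp (κ * t)) (Real.exp (κ * t) * κ) t := by
      simpa using ((hasDerivAt_id t).const_mul κ).exp
    exact h1.mul ((hy t).sub_const K)
  have hanti : Antitone fun t => Real.exp (κ * t) * (y t - K) := by
    refine antitone_of_hasDerivAt_nonpos hd fun t => ?_
    have h2 := h t
    have h3 := Real.exp_pos (κ * t)
    have : Real.exp (κ * t) * (κ * (y t - K) + y' t) ≤ 0 :=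
      mul_nonpos_of_nonneg_of_nonpos h3.le (by linarith)
    change _ ≤ (0 : ℝ)
    linarith
  have hlim : Filter.Tendsto (fun t => Real.exp (κ * t) * (M - K)) Filter.atBot (nhds 0) := by
    have h1 : Filter.Tendsto (fun t : ℝ => κ * t) Filter.atBot Filter.atBot :=
      Filter.tendsto_id.const_mul_atBot hκ
    simpa using (Real.tendsto_exp_atBot.comp h1).mul_const (M - K)
  have hle : Real.exp (κ * s) * (y s - K) ≤ 0 := by
    refine ge_of_tendsto hlim ?_
    filter_upwards [Filter.eventually_le_atBot s] with t ht
    refine (hanti ht).trans ?_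
    exact mul_le_mul_of_nonneg_left (by linarith [hM t]) (Real.exp_pos _).le
  have := nonpos_of_mul_nonpos_right hle (Real.exp_pos _)
  linarith

/-- Difference quotients of a continuously differentiable function converge to the derivative,
locally uniformly. -/
lemma tendsto_diffQuot {E : Type*} [NormedAddCommGroup E] [NormedSpace ℝ E] {w z : ℝ → E}
    (hw : ∀ s, HasDerivAt w (z s) s) (hz : Continuous z) (s : ℝ) :
    Filter.Tendsto (fun p : ℝ × ℝ => p.1⁻¹ • (w (p.2 + p.1) - w p.2))
      (nhdsWithin 0 {0}ᶜ ×ˢ nhds s) (nhds (z s)) := by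
  have h1 : HasStrictDerivAt w (z s) s :=
    hasStrictDerivAt_of_hasDerivAt_of_continuousAt (Filter.Eventually.of_forall hw) hz.continuousAt
  have h2 := (hasDerivAtFilter_iff_isLittleO.mp h1)
  have hmap : Filter.Tendsto (fun p : ℝ × ℝ => (p.2 + p.1, p.2))
      (nhdsWithin 0 {0}ᶜ ×ˢ nhds s) (nhds (s, s)) := by
    rw [nhds_prod_eq]
    refine Filter.Tendsto.prodMk ?_ Filter.tendsto_snd
    have h3 : Filter.Tendsto (fun p : ℝ × ℝ => p.2 + p.1) (nhds (0, s)) (nhds (s + 0)) :=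
      (continuous_snd.add continuous_fst).tendsto _
    rw [add_zero, nhds_prod_eq] at h3
    exact h3.mono_left (Filter.prod_mono_left _ nhdsWithin_le_nhds)
  have h4 := h2.comp_tendsto hmap
  rw [tendsto_iff_norm_sub_tendsto_zero]
  rw [Asymptotics.isLittleO_iff] at h4
  rw [Metric.tendsto_nhds]
  intro ε hε
  have hne : ∀ᶠ p : ℝ × ℝ in nhdsWithin 0 {0}ᶜ ×ˢ nhds s, p.1 ≠ 0 :=
    Filter.tendsto_fst.eventually (eventually_mem_nhdsWithin)
  filter_upwards [h4 (half_pos hε), hne] with p hp hp0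
  simp only [Function.comp, add_sub_cancel_left] at hp
  have e : p.1⁻¹ • (w (p.2 + p.1) - w p.2) - z s
      = p.1⁻¹ • (w (p.2 + p.1) - w p.2 - p.1 • z s) := by
    rw [smul_sub, smul_sub, smul_smul p.1⁻¹ p.1, inv_mul_cancel₀ hp0, one_smul, smul_sub]
  rw [e, norm_smul, norm_inv, Real.dist_eq, sub_zero, abs_of_nonneg (by positivity)]
  have hp1 : 0 < ‖p.1‖ := norm_pos_iff.mpr hp0
  calc ‖p.1‖⁻¹ * ‖w (p.2 + p.1) - w p.2 - p.1 • z s‖ ≤ ‖p.1‖⁻¹ * (ε / 2 * ‖p.1‖) := by gcongr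
    _ = ε / 2 := by field_simp
    _ < ε := half_lt_self hε

/-- For a Schrödinger type equation `w_t = z = i (g + n)`, in which `g` is `w_xx` (of which only
the symmetry of `∂_xx` is used), `‖z‖²` is differentiable, although `z` itself need not be:
the difference quotients of `w` satisfy the differentiated equation. -/
lemma hasDerivAt_norm_sq_velocity {L : ℝ} [Fact (0 < L)] {w z g n n' : ℝ → L2per L}
    (hw : ∀ s, HasDerivAt w (z s) s) (hz : Continuous z) (hn : ∀ s, HasDerivAt n (n' s) s)
    (hn' : Continuous n') (heq : ∀ s, z s = Complex.I • (g s + n s))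
    (horth : ∀ s t, inner ℝ (w t - w s) (Complex.I • (g t - g s)) = 0) (s : ℝ) :
    HasDerivAt (fun t => ‖z t‖ ^ 2) (2 * inner ℝ (z s) (Complex.I • n' s)) s := by
  let Dw : ℝ → ℝ → L2per L := fun h t => h⁻¹ • (w (t + h) - w t)
  let Dn : ℝ → ℝ → L2per L := fun h t => h⁻¹ • (n (t + h) - n t)
  have hYd : ∀ h t, HasDerivAt (fun t => ‖Dw h t‖ ^ 2)
      (2 * inner ℝ (Dw h t) (Complex.I • Dn h t)) t := by
    intro h t
    have h1 : HasDerivAt (fun t => w (t + h)) (z (t + h)) t := (hw (t + h)).comp_add_const t h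
    have h2 : HasDerivAt (Dw h) (h⁻¹ • (z (t + h) - z t)) t := (h1.sub (hw t)).const_smul h⁻¹
    refine h2.norm_sq.congr_deriv ?_
    have h3 : h⁻¹ • (z (t + h) - z t) = h⁻¹ • (Complex.I • (g (t + h) - g t))
        + Complex.I • Dn h t := by
      rw [heq, heq, smul_comm Complex.I h⁻¹, ← smul_add, ← smul_add, ← smul_sub]
      congr 2
      abel
    rw [h3, inner_add_right, inner_smul_left, inner_smul_right, horth, mul_zero, mul_zero, zero_add]
  have hlim : Filter.Tendsto (fun p : ℝ × ℝ => 2 * inner ℝ (Dw p.1 p.2) (Complex.I • Dn p.1 p.2))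
      (nhdsWithin 0 {0}ᶜ ×ˢ nhds s) (nhds (2 * inner ℝ (z s) (Complex.I • n' s))) := by
    have h1 := tendsto_diffQuot hw hz s
    have h2 := tendsto_diffQuot hn hn' s
    exact (h1.inner (h2.const_smul Complex.I)).const_mul 2
  have hcont : Continuous fun t => 2 * inner ℝ (z t) (Complex.I • n' t) := by fun_prop
  refine hasDerivAt_of_tendstoUniformlyOnFilter (l := nhdsWithin 0 {0}ᶜ)
    (f := fun h t => ‖Dw h t‖ ^ 2) (f' := fun h t => 2 * inner ℝ (Dw h t) (Complex.I • Dn h t))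
    (g' := fun t => 2 * inner ℝ (z t) (Complex.I • n' t)) ?_ ?_ ?_
  · rw [Metric.tendstoUniformlyOnFilter_iff]
    intro ε hε
    have h1 : ∀ᶠ p : ℝ × ℝ in nhdsWithin 0 {0}ᶜ ×ˢ nhds s,
        dist (2 * inner ℝ (z p.2) (Complex.I • n' p.2)) (2 * inner ℝ (z s) (Complex.I • n' s))
          < ε / 2 :=
      Filter.tendsto_snd.eventually (Metric.tendsto_nhds.mp (hcont.tendsto s) _ (half_pos hε))
    filter_upwards [h1, Metric.tendsto_nhds.mp hlim _ (half_pos hε)] with p hp1 hp2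
    rw [dist_comm] at hp2
    exact (dist_triangle _ _ _).trans_lt (by linarith)
  · exact Filter.Eventually.of_forall fun p => hYd p.1 p.2
  · refine Filter.Eventually.of_forall fun t => ?_
    have h1 := (hasDerivAt_iff_tendsto_slope_zero.mp (hw t))
    exact h1.norm.pow 2

end TimeCalculus

/-! ### Bounded solutions of the forced equation -/

section Solutions

variable {L : ℝ} [Fact (0 < L)]

/-- A bounded solution on the whole line of
`w_s = i (w_xx + |w|² w - f) - γ w - μ (P_m w - v)`, in which `w` and `w_x` are given by their
continuous representatives `a`, `b`, while `g = w_xx` and `z = w_s`. The datum `v`, with derivative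
`v'`, takes values in the span of the modes up to `m`. -/
structure IsSol (γ μ : ℝ) (m : ℕ) (f : L2per L) (v v' : ℝ → L2per L)
    (a b : ℝ → C(AddCircle L, ℂ)) (g z : ℝ → L2per L) : Prop where
  cont_a : Continuous a
  cont_b : Continuous b
  cont_g : Continuous g
  wd_a : ∀ s, HasWD (incl (a s)) (incl (b s))
  wd_b : ∀ s, HasWD (incl (b s)) (g s)
  deriv_a : ∀ s, HasDerivAt (fun t => incl (a t)) (z s) s
  eqn : ∀ s, z s = Complex.I • (g s + incl (a s * star (a s) * a s) - f) - γ • incl (a s)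
    - μ • (modeProj L m (incl (a s)) - v s)
  deriv_v : ∀ s, HasDerivAt v (v' s) s
  cont_v' : Continuous v'
  proj_v : ∀ s, modeProj L m (v s) = v s
  proj_v' : ∀ s, modeProj L m (v' s) = v' s
  bdd : ∃ M, ∀ s, ‖a s‖ ≤ M ∧ ‖b s‖ ≤ M ∧ ‖g s‖ ≤ M ∧ ‖z s‖ ≤ M

lemma continuous_mulL {Y : Type*} [TopologicalSpace Y] {c : Y → C(AddCircle L, ℂ)}
    {x : Y → L2per L} (hc : Continuous c) (hx : Continuous x) :
    Continuous fun p => mulL (c p) (x p) :=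
  (mulL.continuous.comp hc).clm_apply hx

lemma mulL_smul_real (a : C(AddCircle L, ℂ)) (r : ℝ) (x : L2per L) :
    mulL a (r • x) = r • mulL a x :=
  (mulL a).map_smul_of_tower r x

/-- The derivative of `w ↦ |w|² w` at `a`, in the direction `z`. -/
def cubicD (a : C(AddCircle L, ℂ)) (z : L2per L) : L2per L :=
  mulL (a * star a + a * star a) z + mulL (a * a) (conjL z)

lemma continuous_cubicD {Y : Type*} [TopologicalSpace Y] {c : Y → C(AddCircle L, ℂ)}
    {x : Y → L2per L} (hc : Continuous c) (hx : Continuous x) :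
    Continuous fun p => cubicD (c p) (x p) := by
  refine (continuous_mulL ?_ hx).add (continuous_mulL (hc.mul hc) (conjL.continuous.comp hx))
  exact (hc.mul hc.star).add (hc.mul hc.star)

variable {a b : ℝ → C(AddCircle L, ℂ)} {g z : ℝ → L2per L} {s : ℝ}

lemma hasDerivAt_incl_sq (ha : Continuous a) (hd : HasDerivAt (fun t => incl (a t)) (z s) s) :
    HasDerivAt (fun t => incl (a t * a t)) (mulL (a s + a s) (z s)) s := by
  refine hasDerivAt_of_factor (T := fun t x => mulL (a t + a s) x)
    (continuous_mulL (by fun_prop) continuous_snd) (fun t r x => mulL_smul_real _ r x) hd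
    fun t => ?_
  rw [← map_sub, ← map_sub, mulL_incl]
  congr 1
  ring

lemma hasDerivAt_cubic (ha : Continuous a) (hd : HasDerivAt (fun t => incl (a t)) (z s) s) :
    HasDerivAt (fun t => incl (a t * star (a t) * a t)) (cubicD (a s) (z s)) s := by
  refine hasDerivAt_of_factor (T := fun t x => mulL (a t * star (a t) + a s * star (a s)) x
    + mulL (a s * a t) (conjL x)) ?_ ?_ hd fun t => ?_
  · refine (continuous_mulL ?_ continuous_snd).add
      (continuous_mulL (by fun_prop) (conjL.continuous.comp continuous_snd))
    have h1 : Continuous fun p : ℝ × L2per L => a p.1 := ha.comp continuous_fst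
    exact (h1.mul h1.star).add continuous_const
  · intro t r x
    rw [conjL.map_smul, mulL_smul_real, mulL_smul_real, smul_add]
  · rw [← map_sub, ← map_sub, conjL_incl, mulL_incl, mulL_incl, ← map_add]
    congr 1
    rw [star_sub]
    ring

/-- The derivative `- 2 Re ⟨w_t, w_xx⟩` of `‖w_x‖²`. That `w_x` is differentiable in time is not
needed: the increments of `‖w_x‖²` are pairings of those of `w` with `w_xx`. -/
lemma hasDerivAt_norm_sq_dx (hg : Continuous g) (h1 : ∀ s, HasWD (incl (a s)) (incl (b s)))
    (h2 : ∀ s, HasWD (incl (b s)) (g s)) (hd : HasDerivAt (fun t => incl (a t)) (z s) s) :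
    HasDerivAt (fun t => ‖incl (b t)‖ ^ 2) (- 2 * inner ℝ (z s) (g s)) s := by
  refine (hasDerivAt_of_factor (T := fun t x => - inner ℝ x (g t + g s))
    (by fun_prop) ?_ hd fun t => ?_).congr_deriv ?_
  · intro t r x
    rw [inner_smul_left, smul_eq_mul, mul_neg]; rfl
  · rw [((h1 t).sub (h1 s)).real_inner_eq ((h2 t).add (h2 s)), neg_neg, inner_sub_left,
      inner_add_right, inner_add_right, real_inner_self_eq_norm_sq, real_inner_self_eq_norm_sq,
      real_inner_comm (incl (b s))]
    ring
  · rw [inner_add_right]; ring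

/-- The derivative of `Re ∫ w² \bar{w_x}²`, with the derivative of `w_s` integrated by parts. -/
lemma hasDerivAt_sq_dx_sq (ha : Continuous a) (hb : Continuous b) (hg : Continuous g)
    (h1 : ∀ s, HasWD (incl (a s)) (incl (b s))) (h2 : ∀ s, HasWD (incl (b s)) (g s))
    (hd : HasDerivAt (fun t => incl (a t)) (z s) s) :
    HasDerivAt (fun t => inner ℝ (incl (b t * b t)) (incl (a t * a t)))
      (2 * inner ℝ (incl (b s * b s)) (mulL (a s) (z s))
        - 2 * inner ℝ (z s) (mulL (a s * a s) (conjL (g s)))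
        - 4 * inner ℝ (z s) (incl (star (b s) * (a s * b s)))) s := by
  refine (hasDerivAt_of_factor (T := fun t x => inner ℝ (incl (b t * b t)) (mulL (a t + a s) x)
      - inner ℝ x (mulL (a s * a s) (conjL (g t + g s))
        + incl (star (b t + b s) * (a s * b s + a s * b s)))) ?_ ?_ hd fun t => ?_).congr_deriv ?_
  · have hb1 : Continuous fun p : ℝ × L2per L => b p.1 := hb.comp continuous_fst
    refine Continuous.sub (Continuous.inner (incl.continuous.comp (hb1.mul hb1))
      (continuous_mulL (by fun_prop) continuous_snd)) (Continuous.inner continuous_snd ?_)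
    refine (continuous_mulL continuous_const (conjL.continuous.comp (by fun_prop))).add
      (incl.continuous.comp ?_)
    exact (hb1.add continuous_const).star.mul continuous_const
  · intro t r x
    rw [mulL_smul_real, inner_smul_right, inner_smul_left, smul_eq_mul, mul_sub]; rfl
  · have hA : HasWD (incl (a t) - incl (a s)) (incl (b t) - incl (b s)) := (h1 t).sub (h1 s)
    have hB : HasWD (incl (star (b t + b s))) (conjL (g t + g s)) := by
      have := ((h2 t).add (h2 s)).conj
      rwa [← map_add, conjL_incl] at this
    have hC := hB.mul ((h1 s).mul (h1 s))
    have hD : inner ℝ (incl (b t) - incl (b s)) (incl (star (b t + b s) * (a s * a s)))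
        = - inner ℝ (incl (a t) - incl (a s)) (mulL (a s * a s) (conjL (g t + g s))
          + incl (star (b t + b s) * (a s * b s + a s * b s))) := by
      rw [mulL_incl, ← map_add, mulL_incl] at hC
      rw [hA.real_inner_eq hC, neg_neg]
    rw [sub_eq_add_neg _ (inner ℝ (incl (a t) - incl (a s)) _), ← hD, ← map_sub, ← map_sub,
      mulL_incl]
    have e1 : (a t + a s) * (a t - a s) = a t * a t - a s * a s := by ring
    have e2 : inner ℝ (incl (b t - b s)) (incl (star (b t + b s) * (a s * a s)))
        = inner ℝ (incl (b t * b t - b s * b s)) (incl (a s * a s)) := by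
      rw [← mulL_incl, real_inner_mulL, mulL_incl, star_star]
      congr 2
      ring
    rw [e1, e2, map_sub, map_sub, inner_sub_right, inner_sub_left]
    ring
  · rw [map_add conjL, map_add (mulL (a s * a s)), mulL_add_left, inner_add_right, inner_add_right,
      inner_add_right]
    have : incl (star (b s + b s) * (a s * b s + a s * b s))
        = incl (star (b s) * (a s * b s)) + incl (star (b s) * (a s * b s))
          + (incl (star (b s) * (a s * b s)) + incl (star (b s) * (a s * b s))) := by
      rw [← map_add, ← map_add, star_add]
      congr 1
      ring
    rw [this, inner_add_right, inner_add_right]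
    ring

end Solutions

/-! ### The energy balances of a solution -/

section Balances

variable {L : ℝ} [Fact (0 < L)] {γ μ : ℝ} {m : ℕ} {f : L2per L} {v v' : ℝ → L2per L}
  {a b : ℝ → C(AddCircle L, ℂ)} {g z : ℝ → L2per L}

lemma real_inner_I_smul_mulL_self {r : C(AddCircle L, ℂ)} (hr : star r = r) (x : L2per L) :
    inner ℝ x (Complex.I • mulL r x) = 0 := by
  have h1 : inner ℝ x (Complex.I • mulL r x) = - inner ℝ x (Complex.I • mulL r x) := by
    conv_lhs => rw [real_inner_I_smul_right, real_inner_mulL, hr, map_smul, real_inner_comm]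
  linarith

/-- The operator `i ∂_xx` is skew-symmetric. -/
lemma HasWD.real_inner_I_smul_self {h g g' : L2per L} (H : HasWD h g) (H' : HasWD g g') :
    inner ℝ h (Complex.I • g') = 0 := by
  rw [H.real_inner_eq (H'.smul Complex.I), real_inner_comm, DampedNLS.real_inner_I_smul_self,
    neg_zero]

lemma real_inner_modeProj_self (x : L2per L) :
    inner ℝ (modeProj L m x) x = ‖modeProj L m x‖ ^ 2 := by
  rw [← real_inner_self_eq_norm_sq, real_inner_modeProj, real_inner_modeProj, modeProj_modeProj]

lemma HasWD.real_inner_modeProj_I {h g g' : L2per L} (H : HasWD h g) (H' : HasWD g g') (m : ℕ) :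
    inner ℝ (DampedNLS.modeProj L m h) (Complex.I • g') = 0 := by
  rw [(H.modeProj m).real_inner_eq (H'.smul Complex.I), real_inner_I_smul_right, neg_neg,
    ← map_smul, real_inner_modeProj, ← modeProj_modeProj, ← real_inner_modeProj, map_smul,
    DampedNLS.real_inner_I_smul_self]

lemma modeProj_I_smul (x : L2per L) :
    modeProj L m (Complex.I • x) = Complex.I • modeProj L m x := map_smul _ _ _

lemma cubic_eq_mulL (c : C(AddCircle L, ℂ)) :
    incl (c * star c * c) = mulL (c * star c) (incl c) := by
  rw [mulL_incl]

lemma norm_cubic_le (c : C(AddCircle L, ℂ)) : ‖incl (c * star c * c)‖ ≤ ‖c‖ ^ 2 * ‖incl c‖ := by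
  rw [cubic_eq_mulL]
  refine (norm_mulL_le _ _).trans (mul_le_mul_of_nonneg_right ?_ (norm_nonneg _))
  refine (norm_mul_le _ _).trans ?_
  rw [norm_star, sq]

lemma star_mul_star_self {X : Type*} [TopologicalSpace X] (c : C(X, ℂ)) :
    star (c * star c) = c * star c := by
  rw [star_mul, star_star]

namespace IsSol

variable (S : IsSol γ μ m f v v' a b g z)
include S

lemma cont_incl_a : Continuous fun s => incl (a s) := incl.continuous.comp S.cont_a

lemma cont_v : Continuous v := continuous_iff_continuousAt.mpr fun s => (S.deriv_v s).continuousAt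

lemma cont_cubic : Continuous fun s => incl (a s * star (a s) * a s) :=
  incl.continuous.comp ((S.cont_a.mul S.cont_a.star).mul S.cont_a)

lemma cont_z : Continuous z := by
  have h1 := S.cont_incl_a
  have h2 := S.cont_cubic
  have h3 := S.cont_v
  have h4 := S.cont_g
  have h5 : Continuous fun s => modeProj L m (incl (a s)) := (modeProj L m).continuous.comp h1
  rw [funext S.eqn]
  fun_prop

/-- The balance of the `L²` norm. -/
lemma inner_z (s : ℝ) : inner ℝ (incl (a s)) (z s) = - inner ℝ (incl (a s)) (Complex.I • f)
    - γ * ‖incl (a s)‖ ^ 2 - μ * ‖modeProj L m (incl (a s))‖ ^ 2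
    + μ * inner ℝ (modeProj L m (incl (a s))) (v s) := by
  have h1 := (S.wd_a s).real_inner_I_smul_self (S.wd_b s)
  have h2 := real_inner_I_smul_mulL_self (star_mul_star_self (a s)) (incl (a s))
  rw [S.eqn s, smul_sub, smul_add, inner_sub_right, inner_sub_right, inner_sub_right,
    inner_add_right, h1, cubic_eq_mulL, h2, inner_smul_right, inner_smul_right, inner_sub_right,
    real_inner_self_eq_norm_sq, real_inner_comm (modeProj L m _), real_inner_modeProj_self,
    real_inner_modeProj, S.proj_v]
  ring

lemma hasDerivAt_norm_sq (s : ℝ) :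
    HasDerivAt (fun t => ‖incl (a t)‖ ^ 2) (2 * inner ℝ (incl (a s)) (z s)) s :=
  (S.deriv_a s).norm_sq

/-- The balance of the low modes in `L²`. -/
lemma inner_modeProj_z (s : ℝ) : inner ℝ (modeProj L m (incl (a s))) (z s)
    = inner ℝ (modeProj L m (incl (a s))) (Complex.I • (incl (a s * star (a s) * a s) - f))
      - (γ + μ) * ‖modeProj L m (incl (a s))‖ ^ 2
      + μ * inner ℝ (modeProj L m (incl (a s))) (v s) := by
  have h1 := (S.wd_a s).real_inner_modeProj_I (S.wd_b s) m
  have h2 : inner ℝ (modeProj L m (incl (a s))) (modeProj L m (incl (a s)))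
      = ‖modeProj L m (incl (a s))‖ ^ 2 := real_inner_self_eq_norm_sq _
  rw [S.eqn s, add_sub_assoc, smul_add, inner_sub_right, inner_sub_right,
    inner_add_right, h1, inner_smul_right, inner_smul_right, inner_sub_right,
    real_inner_modeProj_self, h2]
  ring

/-- The `L²` bound. The constant `κ` is the rate at which all modes are damped, up to a loss `C`. -/
lemma norm_sq_le {κ C V : ℝ} (hγ : 0 < γ) (hμ : 0 ≤ μ) (hκ : 0 < κ) (hv : ∀ s, ‖v s‖ ≤ V)
    (h : ∀ s, κ * ‖incl (a s)‖ ^ 2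
      ≤ γ * ‖incl (a s)‖ ^ 2 + μ * ‖modeProj L m (incl (a s))‖ ^ 2 + C) (s : ℝ) :
    ‖incl (a s)‖ ^ 2 ≤ (‖f‖ ^ 2 / γ + μ * V ^ 2 + C) / κ := by
  obtain ⟨M, hM⟩ := S.bdd
  refine le_of_deriv_le (M := L * M ^ 2) hκ S.hasDerivAt_norm_sq (fun s => ?_) (fun s => ?_) s
  · rw [S.inner_z s, mul_sub, mul_div_cancel₀ _ hκ.ne']
    have h1 : - inner ℝ (incl (a s)) (Complex.I • f) ≤ ‖incl (a s)‖ * ‖f‖ := by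
      have := neg_le_of_abs_le (abs_real_inner_le_norm (incl (a s)) (Complex.I • f))
      rw [norm_smul, Complex.norm_I, one_mul] at this
      linarith
    have h2 : inner ℝ (modeProj L m (incl (a s))) (v s) ≤ ‖modeProj L m (incl (a s))‖ * V :=
      (real_inner_le_norm _ _).trans (mul_le_mul_of_nonneg_left (hv s) (norm_nonneg _))
    have h3 := h s
    have h4 : 2 * (‖incl (a s)‖ * ‖f‖) ≤ γ * ‖incl (a s)‖ ^ 2 + ‖f‖ ^ 2 / γ := by
      have := sq_nonneg (γ * ‖incl (a s)‖ - ‖f‖)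
      have e : γ * ‖incl (a s)‖ ^ 2 + ‖f‖ ^ 2 / γ - 2 * (‖incl (a s)‖ * ‖f‖)
          = (γ * ‖incl (a s)‖ - ‖f‖) ^ 2 / γ := by field_simp; ring
      have := div_nonneg this hγ.le
      linarith
    have h5 : 2 * (μ * (‖modeProj L m (incl (a s))‖ * V))
        ≤ μ * ‖modeProj L m (incl (a s))‖ ^ 2 + μ * V ^ 2 := by
      nlinarith [mul_nonneg hμ (sq_nonneg (‖modeProj L m (incl (a s))‖ - V))]
    have h6 := mul_le_mul_of_nonneg_left h2 hμ
    linarith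
  · have hL : (0 : ℝ) < L := Fact.out
    refine (norm_incl_le (a s)).trans (mul_le_mul_of_nonneg_left ?_ hL.le)
    exact pow_le_pow_left₀ (norm_nonneg _) (hM s).1 2

/-- The `H¹` energy of the solution, up to its sign conventions the Hamiltonian of the undamped
equation driven by `f + iμv`. -/
lemma hasDerivAt_energy (s : ℝ) :
    HasDerivAt (fun t => ‖incl (b t)‖ ^ 2 - 1 / 2 * ‖incl (a t * a t)‖ ^ 2
        + 2 * inner ℝ f (incl (a t)) + 2 * μ * inner ℝ (Complex.I • v t) (incl (a t)))
      (2 * γ * (- ‖incl (b s)‖ ^ 2 + ‖incl (a s * a s)‖ ^ 2 - inner ℝ f (incl (a s))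
          - μ * inner ℝ (Complex.I • v s) (incl (a s)))
        + 2 * μ * (- ‖modeProj L m (incl (b s))‖ ^ 2
          + inner ℝ (modeProj L m (incl (a s))) (incl (a s * star (a s) * a s))
          - inner ℝ f (modeProj L m (incl (a s)))
          - μ * inner ℝ (Complex.I • v s) (incl (a s)))
        + 2 * μ * inner ℝ (Complex.I • v' s) (incl (a s))) s := by
  have hz := S.deriv_a s
  have h1 := hasDerivAt_norm_sq_dx S.cont_g S.wd_a S.wd_b hz
  have h2 := (hasDerivAt_incl_sq S.cont_a hz).norm_sq
  have h3 : HasDerivAt (fun t => inner ℝ f (incl (a t))) (inner ℝ f (z s)) s := by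
    simpa using (hasDerivAt_const s f).inner ℝ hz
  have h4 : HasDerivAt (fun t => inner ℝ (Complex.I • v t) (incl (a t)))
      (inner ℝ (Complex.I • v s) (z s) + inner ℝ (Complex.I • v' s) (incl (a s))) s :=
    ((S.deriv_v s).fun_const_smul Complex.I).inner ℝ hz
  have h5 := ((h1.sub (h2.const_mul (1 / 2))).add (h3.const_mul 2)).add (h4.const_mul (2 * μ))
  refine h5.congr_deriv ?_
  set G := g s + incl (a s * star (a s) * a s) - f - μ • Complex.I • v s with hG
  have hzG : z s = Complex.I • G - γ • incl (a s) - μ • modeProj L m (incl (a s)) := by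
    rw [S.eqn s, hG, smul_sub _ _ (μ • Complex.I • v s), smul_comm Complex.I μ, smul_smul Complex.I,
      Complex.I_mul_I, neg_one_smul, smul_sub μ, smul_neg]
    abel
  have h6 : inner ℝ (incl (a s * a s)) (mulL (a s + a s) (z s))
      = 2 * inner ℝ (incl (a s * star (a s) * a s)) (z s) := by
    rw [mulL_add_left, inner_add_right, real_inner_mulL, mulL_incl]
    have e : star (a s) * (a s * a s) = a s * star (a s) * a s := by ring
    rw [e]; ring
  have h7 : inner ℝ (z s) G = - γ * inner ℝ (incl (a s)) G
      - μ * inner ℝ (modeProj L m (incl (a s))) G := by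
    rw [hzG, inner_sub_left, inner_sub_left, real_inner_I_smul_self, inner_smul_left,
      inner_smul_left]
    simp
  have h8 : inner ℝ (z s) G = inner ℝ (z s) (g s)
      + inner ℝ (incl (a s * star (a s) * a s)) (z s) - inner ℝ f (z s)
      - μ * inner ℝ (Complex.I • v s) (z s) := by
    rw [hG, inner_sub_right, inner_sub_right, inner_add_right, inner_smul_right,
      real_inner_comm (incl _), real_inner_comm f, real_inner_comm (Complex.I • v s)]
  have h9 : inner ℝ (incl (a s)) G = - ‖incl (b s)‖ ^ 2 + ‖incl (a s * a s)‖ ^ 2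
      - inner ℝ f (incl (a s)) - μ * inner ℝ (Complex.I • v s) (incl (a s)) := by
    have e1 : inner ℝ (incl (a s)) (incl (a s * star (a s) * a s)) = ‖incl (a s * a s)‖ ^ 2 := by
      rw [← real_inner_self_eq_norm_sq, ← mulL_incl (a s) (a s), real_inner_mulL (a s), mulL_incl,
        mulL_incl, real_inner_comm]
      congr 2
      ring
    rw [hG, inner_sub_right, inner_sub_right, inner_add_right, inner_smul_right, e1,
      (S.wd_a s).real_inner_eq (S.wd_b s), real_inner_self_eq_norm_sq, real_inner_comm f,
      real_inner_comm (Complex.I • v s)]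
  have h10 : inner ℝ (modeProj L m (incl (a s))) G = - ‖modeProj L m (incl (b s))‖ ^ 2
      + inner ℝ (modeProj L m (incl (a s))) (incl (a s * star (a s) * a s))
      - inner ℝ f (modeProj L m (incl (a s)))
      - μ * inner ℝ (Complex.I • v s) (incl (a s)) := by
    rw [hG, inner_sub_right, inner_sub_right, inner_add_right, inner_smul_right,
      ((S.wd_a s).modeProj m).real_inner_eq (S.wd_b s), real_inner_modeProj_self,
      real_inner_modeProj _ (Complex.I • v s), modeProj_I_smul, S.proj_v, real_inner_comm f,
      real_inner_comm (Complex.I • v s)]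
  rw [h6]
  linear_combination (-2 : ℝ) * h7 + (2 : ℝ) * h8 + 2 * γ * h9 + 2 * μ * h10

end IsSol

end Balances

/-! ### A priori bounds in `H¹` -/

section FirstOrder

variable {L : ℝ} [Fact (0 < L)] {γ μ : ℝ} {m : ℕ} {f : L2per L} {v v' : ℝ → L2per L}
  {a b : ℝ → C(AddCircle L, ℂ)} {g z : ℝ → L2per L}

lemma norm_I_smul (x : L2per L) : ‖Complex.I • x‖ = ‖x‖ := by
  rw [norm_smul, Complex.norm_I, one_mul]

lemma norm_incl_sq_le (c : C(AddCircle L, ℂ)) : ‖incl (c * c)‖ ≤ ‖c‖ * ‖incl c‖ := by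
  rw [← mulL_incl]; exact norm_mulL_le _ _

/-- The pairings with the forcing that occur in the energy balance. -/
lemma pairing_bounds {R V : ℝ} {x y y' : L2per L} (f : L2per L) (m : ℕ) (hv : ‖y‖ ≤ V)
    (hv' : ‖y'‖ ≤ V) (hR : ‖x‖ ≤ R) :
    inner ℝ f x ≤ ‖f‖ * R ∧ - (‖f‖ * R) ≤ inner ℝ f (modeProj L m x) ∧
    - (V * R) ≤ inner ℝ (Complex.I • y) x ∧ inner ℝ (Complex.I • y') x ≤ V * R := by
  have hV0 : 0 ≤ V := (norm_nonneg _).trans hv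
  refine ⟨?_, ?_, ?_, ?_⟩
  · exact (real_inner_le_norm _ _).trans (mul_le_mul_of_nonneg_left hR (norm_nonneg _))
  · refine neg_le_of_abs_le ((abs_real_inner_le_norm _ _).trans ?_)
    exact mul_le_mul_of_nonneg_left ((norm_modeProj_le _).trans hR) (norm_nonneg _)
  · refine neg_le_of_abs_le ((abs_real_inner_le_norm _ _).trans ?_)
    rw [norm_I_smul]
    exact mul_le_mul hv hR (norm_nonneg _) hV0
  · refine (real_inner_le_norm _ _).trans ?_
    rw [norm_I_smul]
    exact mul_le_mul hv' hR (norm_nonneg _) hV0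

namespace IsSol

variable (S : IsSol γ μ m f v v' a b g z)
include S

/-- Agmon's inequality, for periods `L` with `1 / L ≤ ℓ`. -/
lemma agmon {ℓ R X : ℝ} (hℓ : 1 / L ≤ ℓ) {s : ℝ} (hR : ‖incl (a s)‖ ≤ R) (hX : ‖incl (b s)‖ ≤ X) :
    ‖a s‖ ^ 2 ≤ ℓ * R ^ 2 + 2 * R * X := by
  have hL : (0 : ℝ) < L := Fact.out
  refine (S.wd_a s).norm_sq_le.trans ?_
  have h1 : ‖incl (a s)‖ ^ 2 ≤ R ^ 2 := pow_le_pow_left₀ (norm_nonneg _) hR 2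
  have h2 : ‖incl (a s)‖ ^ 2 / L ≤ ℓ * R ^ 2 := by
    rw [div_eq_mul_one_div, mul_comm]
    exact mul_le_mul hℓ h1 (sq_nonneg _) ((by positivity : 0 ≤ 1 / L).trans hℓ)
  have h3 : ‖incl (a s)‖ * ‖incl (b s)‖ ≤ R * X :=
    mul_le_mul hR hX (norm_nonneg _) ((norm_nonneg _).trans hR)
  linarith

/-- The `H¹` bound that follows from a differential inequality for the energy with damping rate
`κ`. -/
lemma norm_dx_sq_le {ℓ κ K R V : ℝ} (hκ : 0 < κ) (hμ : 0 ≤ μ) (hℓ : 1 / L ≤ ℓ)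
    (hv : ∀ s, ‖v s‖ ≤ V) (hR : ∀ s, ‖incl (a s)‖ ≤ R)
    (h : ∀ s X n4 pn fw fp vw vw' : ℝ, X = ‖incl (b s)‖ → n4 = ‖incl (a s * a s)‖ ^ 2 →
      pn = inner ℝ (modeProj L m (incl (a s))) (incl (a s * star (a s) * a s)) →
      fw = inner ℝ f (incl (a s)) → fp = inner ℝ f (modeProj L m (incl (a s))) →
      vw = inner ℝ (Complex.I • v s) (incl (a s)) → vw' = inner ℝ (Complex.I • v' s) (incl (a s)) →
      0 ≤ n4 → n4 ≤ ℓ * R ^ 4 + 2 * R ^ 3 * X → pn ≤ ℓ * R ^ 4 + 2 * R ^ 3 * X →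
      (2 * γ * (- X ^ 2 + n4 - fw - μ * vw)
        + 2 * μ * (- ‖modeProj L m (incl (b s))‖ ^ 2 + pn - fp - μ * vw) + 2 * μ * vw')
        ≤ κ * (K - (X ^ 2 - 1 / 2 * n4 + 2 * fw + 2 * μ * vw))) (s : ℝ) :
    ‖incl (b s)‖ ^ 2 ≤ 2 * K + ℓ * R ^ 4 + R ^ 6 + 4 * (‖f‖ * R) + 4 * (μ * V * R) := by
  have hL : (0 : ℝ) < L := Fact.out
  have hR0 : 0 ≤ R := (norm_nonneg _).trans (hR 0)
  have hV0 : 0 ≤ V := (norm_nonneg _).trans (hv 0)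
  have hF : ∀ s, |inner ℝ f (incl (a s))| ≤ ‖f‖ * R := fun s =>
    (abs_real_inner_le_norm _ _).trans (mul_le_mul_of_nonneg_left (hR s) (norm_nonneg _))
  have hvw : ∀ s, |inner ℝ (Complex.I • v s) (incl (a s))| ≤ V * R := fun s => by
    refine (abs_real_inner_le_norm _ _).trans ?_
    rw [norm_I_smul]
    exact mul_le_mul (hv s) (hR s) (norm_nonneg _) hV0
  have hag : ∀ s, ‖a s‖ ^ 2 * R ^ 2 ≤ ℓ * R ^ 4 + 2 * R ^ 3 * ‖incl (b s)‖ := fun s => by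
    have := mul_le_mul_of_nonneg_right (S.agmon hℓ (hR s) le_rfl) (sq_nonneg R)
    calc _ ≤ _ := this
      _ = _ := by ring
  have hn4 : ∀ s, ‖incl (a s * a s)‖ ^ 2 ≤ ℓ * R ^ 4 + 2 * R ^ 3 * ‖incl (b s)‖ := fun s => by
    refine le_trans ?_ (hag s)
    rw [← mul_pow]
    refine pow_le_pow_left₀ (norm_nonneg _) ((norm_incl_sq_le _).trans ?_) 2
    exact mul_le_mul_of_nonneg_left (hR s) (norm_nonneg _)
  have hpn : ∀ s, inner ℝ (modeProj L m (incl (a s))) (incl (a s * star (a s) * a s))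
      ≤ ℓ * R ^ 4 + 2 * R ^ 3 * ‖incl (b s)‖ := fun s => by
    refine (real_inner_le_norm _ _).trans (le_trans ?_ (hag s))
    have h1 : ‖modeProj L m (incl (a s))‖ ≤ R := (norm_modeProj_le _).trans (hR s)
    have h2 : ‖incl (a s * star (a s) * a s)‖ ≤ ‖a s‖ ^ 2 * R := (norm_cubic_le _).trans
      (mul_le_mul_of_nonneg_left (hR s) (sq_nonneg _))
    calc _ ≤ R * (‖a s‖ ^ 2 * R) := mul_le_mul h1 h2 (norm_nonneg _) hR0
      _ = _ := by ring
  obtain ⟨M, hM⟩ := S.bdd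
  have hE := le_of_deriv_le (K := K)
    (M := L * M ^ 2 + 2 * (‖f‖ * R) + 2 * μ * (V * R)) hκ S.hasDerivAt_energy
    (fun s => h s _ _ _ _ _ _ _ rfl rfl rfl rfl rfl rfl rfl (sq_nonneg _) (hn4 s) (hpn s))
    (fun s => by
      have h1 : ‖incl (b s)‖ ^ 2 ≤ L * M ^ 2 := (norm_incl_le (b s)).trans
        (mul_le_mul_of_nonneg_left (pow_le_pow_left₀ (norm_nonneg _) (hM s).2.1 2) hL.le)
      have h2 := le_of_abs_le (hF s)
      have h3 := mul_le_mul_of_nonneg_left (le_of_abs_le (hvw s)) hμ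
      have h4 := sq_nonneg ‖incl (a s * a s)‖
      linarith) s
  have h1 := neg_le_of_abs_le (hF s)
  have h2 := mul_le_mul_of_nonneg_left (neg_le_of_abs_le (hvw s)) hμ
  have h3 := hn4 s
  have h4 := sq_nonneg (‖incl (b s)‖ - R ^ 3)
  have h5 : (R ^ 3) ^ 2 = R ^ 6 := by ring
  nlinarith

/-- The `H¹` bound for which only the damping `γ` is used. -/
lemma norm_dx_le_R1form {ℓ c R V : ℝ} (hγ : 0 < γ) (hμ : 0 ≤ μ) (hℓ : 1 / L ≤ ℓ)
    (hc : 4 * (1 + ℓ) ≤ c) (hv : ∀ s, ‖v s‖ ≤ V) (hv' : ∀ s, ‖v' s‖ ≤ V)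
    (hR : ∀ s, ‖incl (a s)‖ ≤ R) (s : ℝ) : ‖incl (b s)‖ ≤ R1form c γ ‖f‖ μ V R := by
  have hL : (0 : ℝ) < L := Fact.out
  have hℓ0 : 0 ≤ ℓ := (by positivity : 0 ≤ 1 / L).trans hℓ
  have hR0 : 0 ≤ R := (norm_nonneg _).trans (hR 0)
  have hV0 : 0 ≤ V := (norm_nonneg _).trans (hv 0)
  set K := ((3 / 2 * γ + 2 * μ) * ℓ * R ^ 4 + (3 * γ + 4 * μ) ^ 2 * R ^ 6 / (4 * γ)
    + 2 * μ * (‖f‖ * R) + 2 * μ ^ 2 * (V * R) + 2 * μ * (V * R)) / γ with hK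
  have h1 := S.norm_dx_sq_le (κ := γ) (K := K) hγ hμ hℓ hv hR (fun s X n4 pn fw fp vw vw' _ _ _ hfw
      hfp hvw hvw' hn0 hn hpn => by
    obtain ⟨-, p2, p3, p4⟩ := pairing_bounds f m (hv s) (hv' s) (hR s)
    rw [← hfp] at p2
    rw [← hvw] at p3
    rw [← hvw'] at p4
    have e1 : γ * K = (3 / 2 * γ + 2 * μ) * ℓ * R ^ 4 + (3 * γ + 4 * μ) ^ 2 * R ^ 6 / (4 * γ)
      + 2 * μ * (‖f‖ * R) + 2 * μ ^ 2 * (V * R) + 2 * μ * (V * R) := by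
      rw [hK, mul_div_cancel₀ _ hγ.ne']
    have e2 : (3 * γ + 4 * μ) * (R ^ 3 * X)
        ≤ γ * X ^ 2 + (3 * γ + 4 * μ) ^ 2 * R ^ 6 / (4 * γ) := by
      have : γ * X ^ 2 + (3 * γ + 4 * μ) ^ 2 * R ^ 6 / (4 * γ) - (3 * γ + 4 * μ) * (R ^ 3 * X)
          = (2 * γ * X - (3 * γ + 4 * μ) * R ^ 3) ^ 2 / (4 * γ) := by
        field_simp; ring
      have := div_nonneg (sq_nonneg (2 * γ * X - (3 * γ + 4 * μ) * R ^ 3))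
        (by positivity : 0 ≤ 4 * γ)
      linarith
    have e3 := mul_le_mul_of_nonneg_left hn hγ.le
    have e4 := mul_le_mul_of_nonneg_left hpn hμ
    have e5 := mul_le_mul_of_nonneg_left p2 hμ
    have e6 := mul_le_mul_of_nonneg_left p3 (sq_nonneg μ)
    have e7 := mul_le_mul_of_nonneg_left p4 hμ
    have e8 := mul_nonneg hμ (sq_nonneg ‖modeProj L m (incl (b s))‖)
    rw [mul_sub γ K, e1]
    linarith) s
  refine Real.le_sqrt_of_sq_le (h1.trans ?_)
  obtain ⟨t, ht⟩ : ∃ t, t = μ / γ := ⟨_, rfl⟩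
  have ht0 : 0 ≤ t := by rw [ht]; positivity
  have hμt : μ = t * γ := by rw [ht]; field_simp
  clear_value K
  have eK : K = (3 / 2 + 2 * t) * ℓ * R ^ 4 + (3 + 4 * t) ^ 2 * R ^ 6 / 4
    + 2 * t * (‖f‖ * R) + 2 * t * μ * (V * R) + 2 * t * (V * R) := by
    rw [hK, hμt]; field_simp
  have eT : 28 / 3 * K2form c ‖f‖ μ V R + 7 / (3 * γ) * K1form c γ ‖f‖ μ V R
      = 49 / 12 * c ^ 2 * R ^ 6 + 14 / 3 * c * R ^ 4 + 56 / 3 * (‖f‖ * R) + 56 / 3 * (μ * V * R)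
        + 8 * R ^ 2 + 14 * (‖f‖ * R) + 14 * (μ * V * R) + 7 / 3 * (t ^ 2 * c ^ 2 * R ^ 6)
        + 14 / 3 * (t * (‖f‖ * R)) + 14 / 3 * (t * μ * (V * R)) + 14 / 3 * (t * (V * R)) := by
    rw [K2form, K1form, hμt]; field_simp; ring
  rw [eK, eT]
  have hF0 := norm_nonneg f
  have q1 : 0 ≤ ‖f‖ * R := by positivity
  have q2 : 0 ≤ μ * V * R := by positivity
  have q3 : 0 ≤ t * (‖f‖ * R) := by positivity
  have q4 : 0 ≤ t * μ * (V * R) := by positivity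
  have q5 : 0 ≤ t * (V * R) := by positivity
  have q6 : (3 + 4 * t) ^ 2 ≤ 18 + 32 * t ^ 2 := by nlinarith [sq_nonneg (3 - 4 * t)]
  have q7 : (3 + 4 * t) ^ 2 * R ^ 6 ≤ (18 + 32 * t ^ 2) * R ^ 6 :=
    mul_le_mul_of_nonneg_right q6 (by positivity)
  have q8 : 4 * t * ℓ * R ^ 4 ≤ 4 * t ^ 2 * ℓ ^ 2 * R ^ 6 + R ^ 2 := by
    nlinarith [sq_nonneg (2 * t * ℓ * R ^ 3 - R)]
  have q9 : 16 + 16 * ℓ ^ 2 ≤ c ^ 2 := by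
    have := pow_le_pow_left₀ (by positivity) hc 2
    linarith
  have q10 : (10 : ℝ) * R ^ 6 ≤ 49 / 12 * c ^ 2 * R ^ 6 :=
    mul_le_mul_of_nonneg_right (by linarith [sq_nonneg ℓ]) (by positivity)
  have q11 : (16 + 4 * ℓ ^ 2) * (t ^ 2 * R ^ 6) ≤ 7 / 3 * c ^ 2 * (t ^ 2 * R ^ 6) :=
    mul_le_mul_of_nonneg_right (by linarith [sq_nonneg ℓ]) (by positivity)
  have q12 : 4 * ℓ * R ^ 4 ≤ 14 / 3 * c * R ^ 4 :=
    mul_le_mul_of_nonneg_right (by linarith) (by positivity)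
  have q13 : 0 ≤ R ^ 2 := by positivity
  linarith

/-- The improved `H¹` bound, in which also the damping `μ` is used on all modes, up to a loss `μ`
caused by the high modes. -/
lemma norm_dx_le_R1 {ℓ c V : ℝ} (hγ : 0 < γ) (hμ : 0 ≤ μ) (hℓ : 1 / L ≤ ℓ)
    (hc : 4 * (1 + ℓ) ≤ c) (hv : ∀ s, ‖v s‖ ≤ V) (hv' : ∀ s, ‖v' s‖ ≤ V)
    (hR : ∀ s, ‖incl (a s)‖ ≤ R0 γ ‖f‖ μ V)
    (hq : ∀ s, μ * ‖incl (b s) - modeProj L m (incl (b s))‖ ^ 2 ≤ μ) (s : ℝ) :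
    ‖incl (b s)‖ ≤ 2 * R1 c γ ‖f‖ μ V := by
  have hL : (0 : ℝ) < L := Fact.out
  have hℓ0 : 0 ≤ ℓ := (by positivity : 0 ≤ 1 / L).trans hℓ
  have hR0 : 0 ≤ R0 γ ‖f‖ μ V := (norm_nonneg _).trans (hR 0)
  have hV0 : 0 ≤ V := (norm_nonneg _).trans (hv 0)
  have hc0 : 0 ≤ c := by linarith
  have hF0 := norm_nonneg f
  set R := R0 γ ‖f‖ μ V with hRdef
  set σ := γ + μ with hσdef
  have hσ : 0 < σ := by positivity
  set K := 2 * (μ / σ) + 2 * ℓ * R ^ 4 + 4 * R ^ 6 + 4 * (μ / σ * (‖f‖ * R))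
    + 2 * (μ / σ * (V * R)) with hK
  have h1 := S.norm_dx_sq_le (κ := σ) (K := K) hσ hμ hℓ hv hR (fun s X n4 pn fw fp vw vw' hX _ _ hfw
      hfp hvw hvw' hn0 hn hpn => by
    obtain ⟨p1, p2, -, p4⟩ := pairing_bounds f m (hv s) (hv' s) (hR s)
    rw [← hfw] at p1
    rw [← hfp] at p2
    rw [← hvw'] at p4
    have e1 : σ * K = 2 * μ + σ * (2 * ℓ * R ^ 4 + 4 * R ^ 6) + 4 * (μ * (‖f‖ * R))
        + 2 * (μ * (V * R)) := by
      rw [hK]; field_simp; ring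
    have e2 : μ * X ^ 2 - μ ≤ μ * ‖modeProj L m (incl (b s))‖ ^ 2 := by
      have h2 := norm_sq_eq_add_modeProj (m := m) (incl (b s))
      have h3 := hq s
      rw [hX, h2, mul_add]
      linarith
    have e3 := mul_le_mul_of_nonneg_left hn hγ.le
    have e3' : 0 ≤ μ * n4 := mul_nonneg hμ hn0
    have e4 := mul_le_mul_of_nonneg_left hpn hμ
    have e5 := mul_le_mul_of_nonneg_left p2 hμ
    have e6 := mul_le_mul_of_nonneg_left p1 hμ
    have e7 := mul_le_mul_of_nonneg_left p4 hμ
    have e8 : 0 ≤ σ * (X - 2 * R ^ 3) ^ 2 := by positivity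
    have e9 : 0 ≤ ℓ * R ^ 4 + 2 * R ^ 3 * X := hn0.trans hn
    have e10 := mul_nonneg hγ.le e9
    have e11 := mul_nonneg hμ e9
    have e12 : 0 ≤ μ * R ^ 6 := by positivity
    have e13 : 0 ≤ γ * R ^ 6 := by positivity
    rw [mul_sub σ, e1]
    rw [hσdef] at e8 ⊢
    linarith) s
  have hR1sq : 4 * (3 / 2 * K2 c γ ‖f‖ μ V + K1 c γ ‖f‖ μ V / σ) ≤ (2 * R1 c γ ‖f‖ μ V) ^ 2 := by
    have hK2 : 0 ≤ K2 c γ ‖f‖ μ V := by rw [K2]; positivity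
    have hK1 : 0 ≤ K1 c γ ‖f‖ μ V := by rw [K1]; positivity
    rw [R1, mul_pow, Real.sq_sqrt (by positivity)]
    have : 3 / 2 * K2 c γ ‖f‖ μ V + K1 c γ ‖f‖ μ V / σ
        ≤ ((3 / 2 * μ + 6 * γ) * K2 c γ ‖f‖ μ V + K1 c γ ‖f‖ μ V) / σ := by
      rw [add_div]
      refine add_le_add ?_ le_rfl
      rw [le_div_iff₀ hσ, hσdef]
      nlinarith [mul_nonneg hγ.le hK2]
    linarith
  have hK1 : 2 * (μ / σ) + 2 * (μ / σ * (‖f‖ * R)) + 2 * (μ / σ * (V * R))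
      ≤ K1 c γ ‖f‖ μ V / σ := by
    rw [le_div_iff₀ hσ]
    have e : (2 * (μ / σ) + 2 * (μ / σ * (‖f‖ * R)) + 2 * (μ / σ * (V * R))) * σ
      = 2 * μ + 2 * μ * ‖f‖ * R + 2 * μ * V * R := by field_simp
    rw [e, K1, ← hRdef]
    have : 0 ≤ 6 * γ * ‖f‖ * R + 6 * μ * γ * V * R + μ * (c ^ 2 * R ^ 6 + R ^ 2) := by positivity
    linarith
  have h2 : ‖incl (b s)‖ ^ 2 ≤ (2 * R1 c γ ‖f‖ μ V) ^ 2 := by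
    refine h1.trans (le_trans ?_ hR1sq)
    rw [K2, ← hRdef, hK]
    have q1 : 0 ≤ ‖f‖ * R := by positivity
    have q2 : 0 ≤ μ * V * R := by positivity
    have q3 : (9 : ℝ) * R ^ 6 ≤ 9 / 8 * c ^ 2 * R ^ 6 :=
      mul_le_mul_of_nonneg_right (by nlinarith) (by positivity)
    have q4 : 5 * ℓ * R ^ 4 ≤ 3 * c * R ^ 4 :=
      mul_le_mul_of_nonneg_right (by nlinarith) (by positivity)
    have q5 : 0 ≤ R ^ 2 := by positivity
    have q6 : 0 ≤ μ / σ := by positivity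
    have q7 : 0 ≤ μ / σ * (V * R) := by positivity
    linarith
  exact (abs_le_of_sq_le_sq' h2 (by rw [R1]; positivity)).2

end IsSol

end FirstOrder

/-! ### A priori bounds in `H²` -/

section SecondOrder

variable {L : ℝ} [Fact (0 < L)] {γ μ : ℝ} {m : ℕ} {f : L2per L} {v v' : ℝ → L2per L}
  {a b : ℝ → C(AddCircle L, ℂ)} {g z : ℝ → L2per L}

lemma norm_modeProj_sub_le (m : ℕ) (x : L2per L) : ‖x - modeProj L m x‖ ≤ ‖x‖ := by
  have h := norm_sq_eq_add_modeProj (m := m) x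
  exact (abs_le_of_sq_le_sq' (by nlinarith [sq_nonneg ‖modeProj L m x‖]) (norm_nonneg _)).2

lemma conjL_I_smul (x : L2per L) : conjL (Complex.I • x) = - (Complex.I • conjL x) := by
  rw [conjL_smul]; simp

/-- The arithmetic behind the bound for `‖w_s‖`: all terms are absorbed by the damping
`γ ‖w_s‖²`. -/
lemma velocity_absorb {γ Z Y G M k R ρ U D : ℝ} (hγ : 0 < γ) (hG : G ≤ Z + 3 * M)
    (hk : 0 ≤ k) (hR : 0 ≤ R) (hU : U ^ 2 ≤ 6 * k * R * ρ ^ 2 * G) :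
    2 * Y * Z + 6 * k * R * D * Z + 12 * ρ * U * Z
      ≤ 1 / 2 * (γ * Z ^ 2) + 8 * Y ^ 2 / γ + 72 * k ^ 2 * (R * D) ^ 2 / γ
        + 5 / 2 * (1728 * k) ^ 2 * (R ^ 2 * ρ ^ 8) / γ ^ 3 + 9 / 2 * (γ * M ^ 2) := by
  have key : ∀ x y : ℝ, x * y ≤ 1 / 8 * (γ * y ^ 2) + 2 * x ^ 2 / γ := fun x y => by
    have : 1 / 8 * (γ * y ^ 2) + 2 * x ^ 2 / γ - x * y = (γ * y - 4 * x) ^ 2 / (8 * γ) := by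
      field_simp; ring
    have := div_nonneg (sq_nonneg (γ * y - 4 * x)) (by positivity : 0 ≤ 8 * γ)
    linarith
  have h1 := key (2 * Y) Z
  have h2 := key (6 * k * R * D) Z
  have h3 := key (12 * ρ * U) Z
  set q := 1728 * k * R * ρ ^ 4 / γ with hq
  have hq0 : 0 ≤ q := by positivity
  have h4 : 2 * (12 * ρ * U) ^ 2 / γ ≤ q * (Z + 3 * M) := by
    have e : 2 * (12 * ρ * U) ^ 2 / γ = 288 * ρ ^ 2 / γ * U ^ 2 := by ring
    have e2 : q * G = 288 * ρ ^ 2 / γ * (6 * k * R * ρ ^ 2 * G) := by rw [hq]; ring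
    rw [e]
    refine le_trans ?_ (mul_le_mul_of_nonneg_left hG hq0)
    rw [e2]
    exact mul_le_mul_of_nonneg_left hU (by positivity)
  have h5 := key q Z
  have h6 : q * (3 * M) ≤ 1 / 2 * q ^ 2 / γ + 9 / 2 * (γ * M ^ 2) := by
    have : 1 / 2 * q ^ 2 / γ + 9 / 2 * (γ * M ^ 2) - q * (3 * M)
        = (q - 3 * γ * M) ^ 2 / (2 * γ) := by
      field_simp; ring
    have := div_nonneg (sq_nonneg (q - 3 * γ * M)) (by positivity : 0 ≤ 2 * γ)
    linarith
  have e1 : 5 / 2 * (1728 * k) ^ 2 * (R ^ 2 * ρ ^ 8) / γ ^ 3 = 5 / 2 * q ^ 2 / γ := by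
    rw [hq]; field_simp
  have e2 : 2 * (2 * Y) ^ 2 / γ = 8 * Y ^ 2 / γ := by ring
  have e3 : 2 * (6 * k * R * D) ^ 2 / γ = 72 * k ^ 2 * (R * D) ^ 2 / γ := by ring
  rw [e1]
  rw [e2] at h1
  rw [e3] at h2
  have e4 : 5 / 2 * q ^ 2 / γ = 2 * q ^ 2 / γ + 1 / 2 * q ^ 2 / γ := by ring
  rw [e4]
  linarith

/-- The comparison of the bound for `‖w_xx‖²` obtained below with the square of `R2form`. -/
lemma second_order_arith {c γ μ F V R ρ k M K Z G : ℝ} (hγ : 0 < γ) (hμ : 0 ≤ μ) (hF : 0 ≤ F)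
    (hV : 0 ≤ V) (hR : 0 ≤ R) (hρ : 0 ≤ ρ) (hk : 1 ≤ k) (hc : 2000000 * k ^ 4 ≤ c)
    (hM : M = μ * V + F + k * R ^ 2 * ρ)
    (hK : K = 4 * k * (R * ρ ^ 3) + (8 * (μ * V) ^ 2 / γ + 72 * k ^ 2 * (R * (ρ * M)) ^ 2 / γ
        + 5 / 2 * (1728 * k) ^ 2 * (R ^ 2 * ρ ^ 8) / γ ^ 3 + 9 / 2 * (γ * M ^ 2)) / γ)
    (hZ : Z ^ 2 ≤ K + 4 * k * (R * ρ ^ 3)) (hG0 : 0 ≤ G) (hG : G ≤ Z + 3 * M) :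
    G ≤ R2form c γ F μ V R ρ - R := by
  rw [R2form, add_sub_cancel_right]
  refine Real.le_sqrt_of_sq_le ?_
  have hk0 : 0 ≤ k := by linarith
  have hM0 : 0 ≤ M := by rw [hM]; positivity
  set D := R ^ 2 * ρ + (γ + μ) * R + μ * V + F with hD
  have hD0 : 0 ≤ D := by positivity
  have hG2 : G ^ 2 ≤ 2 * Z ^ 2 + 18 * M ^ 2 := by
    have := pow_le_pow_left₀ hG0 hG 2
    linarith [sq_nonneg (Z - 3 * M)]
  have hMD : M ≤ k * D := by
    have h1 : μ * V + F ≤ k * (μ * V + F) := le_mul_of_one_le_left (by positivity) hk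
    have h2 : 0 ≤ k * ((γ + μ) * R) := by positivity
    rw [hM, hD]
    linarith
  have hRM : (R * (ρ * M)) ^ 2 ≤ k ^ 2 * (R * ρ * D) ^ 2 := by
    have h1 : R * (ρ * M) ≤ R * (ρ * (k * D)) := by gcongr
    have := pow_le_pow_left₀ (by positivity) h1 2
    calc _ ≤ _ := this
      _ = _ := by ring
  have hM2 : M ^ 2 ≤ 3 * (μ ^ 2 * V ^ 2 + F ^ 2 + k ^ 2 * (R ^ 4 * ρ ^ 2)) := by
    rw [hM]
    linarith [sq_nonneg (μ * V - F), sq_nonneg (μ * V - k * R ^ 2 * ρ),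
      sq_nonneg (F - k * R ^ 2 * ρ)]
  have hRR : R ^ 4 * ρ ^ 2 ≤ (R * ρ * D) ^ 2 / γ ^ 2 := by
    rw [le_div_iff₀ (by positivity)]
    have h1 : γ * R ≤ D := by
      have : 0 ≤ R ^ 2 * ρ + μ * R + μ * V + F := by positivity
      rw [hD]; linarith
    have h2 : R * ρ * (γ * R) ≤ R * ρ * D := by gcongr
    have := pow_le_pow_left₀ (by positivity) h2 2
    calc _ = (R * ρ * (γ * R)) ^ 2 := by ring
      _ ≤ _ := this
  set A1 := R * ρ ^ 3 with hA1
  set A2 := μ ^ 2 * V ^ 2 / γ ^ 2 with hA2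
  set A3 := (R * ρ * D) ^ 2 / γ ^ 2 with hA3
  set A4 := R ^ 2 * ρ ^ 8 / γ ^ 4 with hA4
  have p1 : 0 ≤ A1 := by positivity
  have p2 : 0 ≤ A2 := by positivity
  have p3 : 0 ≤ A3 := by positivity
  have p4 : 0 ≤ A4 := by positivity
  have p5 : 0 ≤ μ ^ 2 * V ^ 2 := by positivity
  have p6 : 0 ≤ F ^ 2 := by positivity
  have hKle : K ≤ 4 * k * A1 + 8 * A2 + 72 * k ^ 2 * (k ^ 2 * A3) + 5 / 2 * (1728 * k) ^ 2 * A4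
      + 9 / 2 * M ^ 2 := by
    have e : K = 4 * k * A1 + 8 * A2 + 72 * k ^ 2 * ((R * (ρ * M)) ^ 2 / γ ^ 2)
        + 5 / 2 * (1728 * k) ^ 2 * A4 + 9 / 2 * M ^ 2 := by
      rw [hK, hA2, hA4]; field_simp; ring
    rw [e]
    have : (R * (ρ * M)) ^ 2 / γ ^ 2 ≤ k ^ 2 * A3 := by
      rw [hA3, ← mul_div_assoc]
      gcongr
    have := mul_le_mul_of_nonneg_left this (by positivity : 0 ≤ 72 * k ^ 2)
    linarith
  have hk2 : k ≤ k ^ 4 ∧ k ^ 2 ≤ k ^ 4 ∧ 1 ≤ k ^ 4 :=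
    ⟨le_self_pow₀ hk (by norm_num), pow_le_pow_right₀ hk (by norm_num), one_le_pow₀ hk⟩
  obtain ⟨k1, k2, k4⟩ := hk2
  have hc0 : 0 ≤ c := by linarith
  have hlow : 8 * (c * A4) + 8 * (c * A3) + 4 * (c * A2) + 4 * (c * A1) + 4 * (c * F ^ 2)
      + 4 * (c * (μ ^ 2 * V ^ 2))
      ≤ 4 * K6form c γ F μ V R ρ / γ + 4 * K7form c F μ V R ρ := by
    have hs : (√R * ρ ^ 2) ^ 4 = R ^ 2 * ρ ^ 8 := by
      have : (√R) ^ 4 = R ^ 2 := by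
        rw [show (4 : ℕ) = 2 * 2 from rfl, pow_mul, Real.sq_sqrt hR]
      rw [mul_pow, this]; ring
    have e : 4 * K6form c γ F μ V R ρ / γ + 4 * K7form c F μ V R ρ
        = 8 * (c * A4) + 8 * (c * A3) + 4 * (c * A2) + 4 * (c * A1) + 4 * (c * F ^ 2)
          + 4 * (c * (μ ^ 2 * V ^ 2)) + 4 * (c * γ * μ ^ 2 * V ^ 2 + c * γ * F ^ 2
          + c * μ * (R ^ 2 * ρ) ^ 2 + c * μ * F ^ 2 + c * μ ^ 3 * V ^ 2) / γ := by
      rw [K6form, K5form, K7form, hs, hA1, hA2, hA3, hA4, hD]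
      field_simp
      ring
    rw [e]
    have : 0 ≤ 4 * (c * γ * μ ^ 2 * V ^ 2 + c * γ * F ^ 2
          + c * μ * (R ^ 2 * ρ) ^ 2 + c * μ * F ^ 2 + c * μ ^ 3 * V ^ 2) / γ := by positivity
    linarith
  refine le_trans ?_ hlow
  have r1 := mul_le_mul_of_nonneg_right (by linarith : 4 * k ≤ c) p1
  have r2 := mul_le_mul_of_nonneg_right (by linarith : 4 ≤ c) p2
  have r3 := mul_le_mul_of_nonneg_right
    (by linarith : 144 * k ^ 4 + 81 * k ^ 2 ≤ 8 * c) p3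
  have r4 := mul_le_mul_of_nonneg_right (by linarith : 5 * (1728 * k) ^ 2 ≤ 8 * c) p4
  have r5 := mul_le_mul_of_nonneg_right (by linarith : 81 ≤ 4 * c) p5
  have r6 := mul_le_mul_of_nonneg_right (by linarith : 81 ≤ 4 * c) p6
  have r7 := mul_le_mul_of_nonneg_left hRR (sq_nonneg k)
  linarith

namespace IsSol

variable (S : IsSol γ μ m f v v' a b g z)
include S

/-- The damping controls the low modes at rate `γ + μ` and the high modes at rate `γ`, with the
nonlinearity treated as a forcing. -/
lemma damping_le {V n : ℝ} (hγ : 0 < γ) (hμ : 0 ≤ μ) (hv : ∀ s, ‖v s‖ ≤ V)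
    (hn : ∀ s, ‖incl (a s * star (a s) * a s)‖ ≤ n) (s : ℝ) :
    ‖γ • incl (a s) + μ • modeProj L m (incl (a s))‖ ≤ 2 * (μ * V + ‖f‖ + n) := by
  have hL : (0 : ℝ) < L := Fact.out
  have hV0 : 0 ≤ V := (norm_nonneg _).trans (hv 0)
  have hn0 : 0 ≤ n := (norm_nonneg _).trans (hn 0)
  have hM0 : 0 ≤ μ * V + ‖f‖ + n := by positivity
  set M := μ * V + ‖f‖ + n with hM
  obtain ⟨C, hC⟩ := S.bdd
  have hWC : ∀ s, ‖incl (a s)‖ ^ 2 ≤ L * C ^ 2 := fun s => (norm_incl_le (a s)).trans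
    (mul_le_mul_of_nonneg_left (pow_le_pow_left₀ (norm_nonneg _) (hC s).1 2) hL.le)
  -- a general bounded quantity with `y² ' ≤ 2 y (M - σ y)` is at most `M / σ`
  have gron : ∀ (σ : ℝ) (x x' : ℝ → L2per L), 0 < σ → (∀ s, HasDerivAt x (x' s) s) →
      (∀ s, ‖x s‖ ≤ ‖incl (a s)‖) → (∀ s, inner ℝ (x s) (x' s) ≤ ‖x s‖ * M - σ * ‖x s‖ ^ 2) →
      ∀ s, σ * ‖x s‖ ≤ M := by
    intro σ x x' hσ hx hxa hxx s
    have h1 := le_of_deriv_le (K := (M / σ) ^ 2) (M := L * C ^ 2) hσ (fun s => (hx s).norm_sq)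
      (fun s => by
        have e : σ * (M / σ) ^ 2 = M ^ 2 / σ := by field_simp
        rw [mul_sub, e]
        have h2 := div_nonneg (sq_nonneg (M - σ * ‖x s‖)) hσ.le
        have h3 : (M - σ * ‖x s‖) ^ 2 / σ = M ^ 2 / σ - 2 * (‖x s‖ * M) + σ * ‖x s‖ ^ 2 := by
          field_simp
          ring
        linarith [hxx s])
      (fun s => (pow_le_pow_left₀ (norm_nonneg _) (hxa s) 2).trans (hWC s)) s
    have h2 := (abs_le_of_sq_le_sq' h1 (by positivity)).2
    rw [le_div_iff₀ hσ] at h2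
    linarith
  have hNf : ∀ s, ‖incl (a s * star (a s) * a s) - f‖ ≤ n + ‖f‖ := fun s =>
    (norm_sub_le _ _).trans (by linarith [hn s])
  have hPd : ∀ s, HasDerivAt (fun t => modeProj L m (incl (a t))) (modeProj L m (z s)) s := by
    intro s
    exact ((modeProj L m).restrictScalars ℝ).hasFDerivAt.comp_hasDerivAt s (S.deriv_a s)
  have hp := gron (γ + μ) _ _ (by positivity) hPd (fun s => norm_modeProj_le _) (fun s => by
    rw [← real_inner_modeProj, modeProj_modeProj, S.inner_modeProj_z s]
    have h1 : inner ℝ (modeProj L m (incl (a s)))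
        (Complex.I • (incl (a s * star (a s) * a s) - f))
        ≤ ‖modeProj L m (incl (a s))‖ * (n + ‖f‖) := by
      refine (real_inner_le_norm _ _).trans ?_
      rw [norm_I_smul]
      exact mul_le_mul_of_nonneg_left (hNf s) (norm_nonneg _)
    have h2 : inner ℝ (modeProj L m (incl (a s))) (v s) ≤ ‖modeProj L m (incl (a s))‖ * V :=
      (real_inner_le_norm _ _).trans (mul_le_mul_of_nonneg_left (hv s) (norm_nonneg _))
    have h3 := mul_le_mul_of_nonneg_left h2 hμ
    rw [hM]
    linarith) s
  have hq := gron γ _ _ hγ (fun s => (S.deriv_a s).sub (hPd s))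
    (fun s => norm_modeProj_sub_le m _) (fun s => by
    change inner ℝ (incl (a s) - modeProj L m (incl (a s))) (z s - modeProj L m (z s)) ≤
      ‖incl (a s) - modeProj L m (incl (a s))‖ * M
        - γ * ‖incl (a s) - modeProj L m (incl (a s))‖ ^ 2
    set q := incl (a s) - modeProj L m (incl (a s)) with hq
    have hPq : modeProj L m q = 0 := by rw [hq, map_sub, modeProj_modeProj, sub_self]
    have h0 : inner ℝ q (modeProj L m (z s)) = 0 := by
      rw [← real_inner_modeProj, hPq, inner_zero_left]
    have h1 : inner ℝ q (Complex.I • g s) = 0 := by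
      rw [hq, inner_sub_left, (S.wd_a s).real_inner_I_smul_self (S.wd_b s),
        (S.wd_a s).real_inner_modeProj_I (S.wd_b s) m, sub_zero]
    have h2 : inner ℝ q (incl (a s)) = ‖q‖ ^ 2 := by
      have e : incl (a s) = q + modeProj L m (incl (a s)) := by rw [hq]; abel
      rw [e, inner_add_right, ← real_inner_modeProj, hPq, inner_zero_left, add_zero,
        real_inner_self_eq_norm_sq]
    have h3 : inner ℝ q (modeProj L m (incl (a s)) - v s) = 0 := by
      rw [inner_sub_right, ← S.proj_v s, ← real_inner_modeProj, ← real_inner_modeProj, hPq,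
        inner_zero_left, inner_zero_left, sub_zero]
    have h4 : inner ℝ q (Complex.I • (incl (a s * star (a s) * a s) - f)) ≤ ‖q‖ * (n + ‖f‖) := by
      refine (real_inner_le_norm _ _).trans ?_
      rw [norm_I_smul]
      exact mul_le_mul_of_nonneg_left (hNf s) (norm_nonneg _)
    have h5 : 0 ≤ ‖q‖ * (μ * V) := by positivity
    rw [inner_sub_right, h0, S.eqn s, add_sub_assoc, smul_add, inner_sub_right, inner_sub_right,
      inner_add_right, h1, inner_smul_right, inner_smul_right, h2, h3, hM]
    linarith) s
  have e : γ • incl (a s) + μ • modeProj L m (incl (a s))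
      = (γ + μ) • modeProj L m (incl (a s)) + γ • (incl (a s) - modeProj L m (incl (a s))) := by
    module
  rw [e]
  refine (norm_add_le _ _).trans ?_
  rw [norm_smul, norm_smul, Real.norm_of_nonneg hγ.le, Real.norm_of_nonneg (by positivity)]
  have hq' : γ * ‖incl (a s) - modeProj L m (incl (a s))‖ ≤ M := hq
  linarith

/-- The functional `‖w_s‖² + Re ∫ w² \bar{w_x}²`, whose derivative does not contain
`Re ∫ w² \bar{w_s} \bar{w_xx}`. Here `n` stands for the terms of lower order in the equation
`w_s = i (w_xx + n)`. -/
lemma hasDerivAt_velocity (s : ℝ) :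
    HasDerivAt (fun t => ‖z t‖ ^ 2 + inner ℝ (incl (b t * b t)) (incl (a t * a t)))
      (- 2 * γ * ‖z s‖ ^ 2 - 2 * μ * ‖modeProj L m (z s)‖ ^ 2 + 2 * μ * inner ℝ (z s) (v' s)
        + 2 * inner ℝ (z s) (mulL (a s * a s) (conjL (incl (a s * star (a s) * a s) - f
          + Complex.I • (γ • incl (a s) + μ • (modeProj L m (incl (a s)) - v s)))))
        + 2 * inner ℝ (incl (b s * b s)) (mulL (a s) (z s))
        - 4 * inner ℝ (z s) (incl (star (b s) * (a s * b s)))) s := by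
  set n : ℝ → L2per L := fun s => incl (a s * star (a s) * a s) - f
    + Complex.I • (γ • incl (a s) + μ • (modeProj L m (incl (a s)) - v s)) with hn
  set n' : ℝ → L2per L := fun s => cubicD (a s) (z s)
    + Complex.I • (γ • z s + μ • (modeProj L m (z s) - v' s)) with hn'
  have hPd : ∀ s, HasDerivAt (fun t => modeProj L m (incl (a t))) (modeProj L m (z s)) s := by
    intro s
    exact ((modeProj L m).restrictScalars ℝ).hasFDerivAt.comp_hasDerivAt s (S.deriv_a s)
  have hnd : ∀ s, HasDerivAt n (n' s) s := by
    intro s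
    have h1 := hasDerivAt_cubic S.cont_a (S.deriv_a s)
    have h2 := ((S.deriv_a s).fun_const_smul γ).fun_add
      (((hPd s).fun_sub (S.deriv_v s)).fun_const_smul μ)
    exact (h1.sub_const f).fun_add (h2.fun_const_smul Complex.I)
  have hn'c : Continuous n' := by
    have h1 := S.cont_z
    have h2 := S.cont_v'
    have h3 := continuous_cubicD S.cont_a h1
    have h4 : Continuous fun s => modeProj L m (z s) := (modeProj L m).continuous.comp h1
    fun_prop
  have heq : ∀ s, z s = Complex.I • (g s + n s) := by
    intro s
    rw [S.eqn s, hn]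
    simp only [smul_add, smul_sub, smul_smul, Complex.I_mul_I, neg_one_smul,
      smul_comm Complex.I γ, smul_comm Complex.I μ]
    simp only [smul_neg]
    abel
  have h1 := hasDerivAt_norm_sq_velocity S.deriv_a S.cont_z hnd hn'c heq (fun s t =>
    ((S.wd_a t).sub (S.wd_a s)).real_inner_I_smul_self ((S.wd_b t).sub (S.wd_b s))) s
  have h2 := hasDerivAt_sq_dx_sq S.cont_a S.cont_b S.cont_g S.wd_a S.wd_b (S.deriv_a s)
  refine (h1.add h2).congr_deriv ?_
  have e1 : inner ℝ (z s) (Complex.I • n' s) = inner ℝ (z s) (mulL (a s * a s) (conjL (g s)))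
      + inner ℝ (z s) (mulL (a s * a s) (conjL (n s))) - γ * ‖z s‖ ^ 2
      - μ * ‖modeProj L m (z s)‖ ^ 2 + μ * inner ℝ (z s) (v' s) := by
    have e2 : Complex.I • mulL (a s * a s) (conjL (z s))
        = mulL (a s * a s) (conjL (g s)) + mulL (a s * a s) (conjL (n s)) := by
      conv_lhs => rw [heq s, conjL_I_smul, map_neg, map_smul, smul_neg, smul_smul, Complex.I_mul_I,
        neg_one_smul, neg_neg, map_add, map_add]
    have e3 : inner ℝ (z s) (Complex.I • mulL (a s * star (a s) + a s * star (a s)) (z s)) = 0 := by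
      refine real_inner_I_smul_mulL_self ?_ _
      rw [star_add, star_mul_star_self]
    have e4 : Complex.I • Complex.I • (γ • z s + μ • (modeProj L m (z s) - v' s))
        = - (γ • z s + μ • (modeProj L m (z s) - v' s)) := by
      rw [smul_smul, Complex.I_mul_I, neg_one_smul]
    rw [hn']
    simp only [cubicD]
    rw [smul_add, smul_add, e4, e2, inner_add_right, inner_add_right, e3, inner_add_right,
      inner_neg_right, inner_add_right, inner_smul_right, inner_smul_right, inner_sub_right,
      real_inner_self_eq_norm_sq, real_inner_comm (modeProj L m _), real_inner_modeProj_self]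
    ring
  rw [e1]
  ring

/-- The `H²` bound. -/
lemma norm_dxx_le {ℓ c R ρ V : ℝ} (hγ : 0 < γ) (hμ : 0 ≤ μ) (hℓ : 1 / L ≤ ℓ)
    (hc : 2000000 * (ℓ + 4) ^ 4 ≤ c) (hv : ∀ s, ‖v s‖ ≤ V) (hv' : ∀ s, ‖v' s‖ ≤ V)
    (hR : ∀ s, ‖incl (a s)‖ ≤ R) (hρ : ∀ s, ‖incl (b s)‖ ≤ 2 * ρ) (hRρ : R ≤ ρ) (s : ℝ) :
    ‖g s‖ ≤ R2form c γ ‖f‖ μ V R ρ - R := by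
  have hL : (0 : ℝ) < L := Fact.out
  have hℓ0 : 0 ≤ ℓ := (by positivity : 0 ≤ 1 / L).trans hℓ
  have hR0 : 0 ≤ R := (norm_nonneg _).trans (hR 0)
  have hρ0 : 0 ≤ ρ := hR0.trans hRρ
  have hV0 : 0 ≤ V := (norm_nonneg _).trans (hv 0)
  have hF0 := norm_nonneg f
  set k := ℓ + 4 with hk
  have hk1 : 1 ≤ k := by linarith
  have hk0 : 0 ≤ k := by linarith
  have ha : ∀ s, ‖a s‖ ^ 2 ≤ k * R * ρ := fun s => by
    refine (S.agmon hℓ (hR s) (hρ s)).trans ?_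
    have : ℓ * R * R ≤ ℓ * R * ρ := by gcongr
    rw [hk]; linarith
  have hN : ∀ s, ‖incl (a s * star (a s) * a s)‖ ≤ k * R ^ 2 * ρ := fun s => by
    refine (norm_cubic_le _).trans ((mul_le_mul (ha s) (hR s) (norm_nonneg _)
      (by positivity)).trans (le_of_eq ?_))
    ring
  obtain ⟨M, hM⟩ : ∃ M, M = μ * V + ‖f‖ + k * R ^ 2 * ρ := ⟨_, rfl⟩
  have hM0 : 0 ≤ M := by rw [hM]; positivity
  obtain ⟨K, hK⟩ : ∃ K, K = 4 * k * (R * ρ ^ 3)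
      + (8 * (μ * V) ^ 2 / γ + 72 * k ^ 2 * (R * (ρ * M)) ^ 2 / γ
        + 5 / 2 * (1728 * k) ^ 2 * (R ^ 2 * ρ ^ 8) / γ ^ 3 + 9 / 2 * (γ * M ^ 2)) / γ := ⟨_, rfl⟩
  -- the lower order terms of the equation
  obtain ⟨n, hn⟩ : ∃ n : ℝ → L2per L, ∀ s, n s = incl (a s * star (a s) * a s) - f
    + Complex.I • (γ • incl (a s) + μ • (modeProj L m (incl (a s)) - v s)) := ⟨_, fun _ => rfl⟩
  have hnM : ∀ s, ‖n s‖ ≤ 3 * M := fun s => by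
    have h1 := S.damping_le hγ hμ hv hN s
    rw [← hM] at h1
    have h2 : γ • incl (a s) + μ • (modeProj L m (incl (a s)) - v s)
        = (γ • incl (a s) + μ • modeProj L m (incl (a s))) - μ • v s := by module
    have h3 : ‖μ • v s‖ ≤ μ * V := by
      rw [norm_smul, Real.norm_of_nonneg hμ]
      exact mul_le_mul_of_nonneg_left (hv s) hμ
    rw [hn, h2]
    refine (norm_add_le _ _).trans ?_
    rw [norm_I_smul]
    have h4 := norm_sub_le (incl (a s * star (a s) * a s)) f
    have h5 := norm_sub_le (γ • incl (a s) + μ • modeProj L m (incl (a s))) (μ • v s)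
    have h6 := hN s
    rw [hM] at h1 ⊢
    linarith
  have hgz : ∀ s, ‖g s‖ ≤ ‖z s‖ + 3 * M := fun s => by
    have h1 : g s = - (Complex.I • z s) - n s := by
      rw [hn, S.eqn s]
      simp only [smul_add, smul_sub, smul_smul, Complex.I_mul_I, neg_one_smul,
        smul_comm Complex.I γ, smul_comm Complex.I μ]
      abel
    rw [h1]
    refine (norm_sub_le _ _).trans ?_
    rw [norm_neg, norm_I_smul]
    linarith [hnM s]
  have hqle : ∀ s, |inner ℝ (incl (b s * b s)) (incl (a s * a s))| ≤ 4 * k * (R * ρ ^ 3) := by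
    intro s
    have h1 : inner ℝ (incl (b s * b s)) (incl (a s * a s))
        = inner ℝ (mulL (star (a s)) (incl (b s))) (mulL (a s) (incl (star (b s)))) := by
      rw [mulL_incl, mulL_incl, mul_comm (a s) (star (b s)), ← mulL_incl (star (b s)),
        real_inner_mulL, mulL_incl, star_star, ← mulL_incl (a s), real_inner_mulL, mulL_incl]
      congr 2
      ring
    rw [h1]
    refine (abs_real_inner_le_norm _ _).trans ?_
    have h2 : ‖mulL (star (a s)) (incl (b s))‖ ≤ ‖a s‖ * (2 * ρ) := by
      refine (norm_mulL_le _ _).trans ?_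
      rw [norm_star]
      exact mul_le_mul_of_nonneg_left (hρ s) (norm_nonneg _)
    have h3 : ‖mulL (a s) (incl (star (b s)))‖ ≤ ‖a s‖ * (2 * ρ) := by
      refine (norm_mulL_le _ _).trans ?_
      rw [← conjL_incl, norm_conjL]
      exact mul_le_mul_of_nonneg_left (hρ s) (norm_nonneg _)
    calc _ ≤ (‖a s‖ * (2 * ρ)) * (‖a s‖ * (2 * ρ)) :=
          mul_le_mul h2 h3 (norm_nonneg _) (by positivity)
      _ = ‖a s‖ ^ 2 * (4 * ρ ^ 2) := by ring
      _ ≤ k * R * ρ * (4 * ρ ^ 2) := mul_le_mul_of_nonneg_right (ha s) (by positivity)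
      _ = _ := by ring
  obtain ⟨C, hC⟩ := S.bdd
  have hΨ := le_of_deriv_le (K := K) (M := C ^ 2 + 4 * k * (R * ρ ^ 3)) hγ S.hasDerivAt_velocity
    (fun s => by
      rw [← hn s]
      set Z := ‖z s‖ with hZ
      have hZ0 : 0 ≤ Z := norm_nonneg _
      have h1 : inner ℝ (z s) (v' s) ≤ Z * V :=
        (real_inner_le_norm _ _).trans (mul_le_mul_of_nonneg_left (hv' s) hZ0)
      have h2 : inner ℝ (z s) (mulL (a s * a s) (conjL (n s))) ≤ 3 * k * R * (ρ * M) * Z := by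
        refine (real_inner_le_norm _ _).trans ?_
        have e1 : ‖mulL (a s * a s) (conjL (n s))‖ ≤ k * R * ρ * (3 * M) := by
          refine (norm_mulL_le _ _).trans ?_
          rw [norm_conjL]
          refine mul_le_mul ?_ (hnM s) (norm_nonneg _) (by positivity)
          refine (norm_mul_le _ _).trans ?_
          rw [← sq]; exact ha s
        calc _ ≤ Z * (k * R * ρ * (3 * M)) := mul_le_mul_of_nonneg_left e1 hZ0
          _ = _ := by ring
      set U := ‖a s‖ * ‖b s‖ with hU
      have h3 : inner ℝ (incl (b s * b s)) (mulL (a s) (z s)) ≤ 2 * ρ * U * Z := by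
        refine (real_inner_le_norm _ _).trans ?_
        have e1 : ‖incl (b s * b s)‖ ≤ ‖b s‖ * (2 * ρ) := (norm_incl_sq_le _).trans
          (mul_le_mul_of_nonneg_left (hρ s) (norm_nonneg _))
        calc _ ≤ (‖b s‖ * (2 * ρ)) * (‖a s‖ * Z) :=
              mul_le_mul e1 (norm_mulL_le _ _) (norm_nonneg _) (by positivity)
          _ = _ := by rw [hU]; ring
      have h4 : - inner ℝ (z s) (incl (star (b s) * (a s * b s))) ≤ 2 * ρ * U * Z := by
        refine (neg_le_abs _).trans ((abs_real_inner_le_norm _ _).trans ?_)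
        have e1 : ‖incl (star (b s) * (a s * b s))‖ ≤ ‖b s‖ * (‖a s‖ * (2 * ρ)) := by
          rw [← mulL_incl, ← mulL_incl]
          refine (norm_mulL_le _ _).trans ?_
          rw [norm_star]
          refine mul_le_mul_of_nonneg_left ((norm_mulL_le _ _).trans ?_) (norm_nonneg _)
          exact mul_le_mul_of_nonneg_left (hρ s) (norm_nonneg _)
        calc _ ≤ Z * (‖b s‖ * (‖a s‖ * (2 * ρ))) := mul_le_mul_of_nonneg_left e1 hZ0
          _ = _ := by rw [hU]; ring
      have h5 : U ^ 2 ≤ 6 * k * R * ρ ^ 2 * ‖g s‖ := by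
        have e1 := (S.wd_a s).norm_sq_le_of_deriv (S.wd_b s)
        have e2 : ‖b s‖ ^ 2 ≤ 6 * ρ * ‖g s‖ := by
          refine e1.trans ?_
          have := mul_le_mul_of_nonneg_right (hρ s) (norm_nonneg (g s))
          linarith
        rw [hU, mul_pow]
        calc _ ≤ k * R * ρ * (6 * ρ * ‖g s‖) :=
              mul_le_mul (ha s) e2 (sq_nonneg _) (by positivity)
          _ = _ := by ring
      have h6 := velocity_absorb (Y := μ * V) (D := ρ * M) hγ (hgz s) hk0 hR0 h5
      have h7 := le_of_abs_le (hqle s)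
      have h8 : γ * K = γ * (4 * k * (R * ρ ^ 3))
        + (8 * (μ * V) ^ 2 / γ + 72 * k ^ 2 * (R * (ρ * M)) ^ 2 / γ
        + 5 / 2 * (1728 * k) ^ 2 * (R ^ 2 * ρ ^ 8) / γ ^ 3 + 9 / 2 * (γ * M ^ 2)) := by
        rw [hK, mul_add, mul_div_cancel₀ _ hγ.ne']
      have h9 := mul_le_mul_of_nonneg_left h7 hγ.le
      have h10 := mul_le_mul_of_nonneg_left h1 hμ
      have h11 := mul_nonneg hμ (sq_nonneg ‖modeProj L m (z s)‖)
      have h12 := mul_nonneg hγ.le (sq_nonneg Z)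
      rw [mul_sub, h8]
      linarith)
    (fun s => by
      have h1 := pow_le_pow_left₀ (norm_nonneg _) (hC s).2.2.2 2
      have h2 := le_of_abs_le (hqle s)
      linarith) s
  have hZ2 : ‖z s‖ ^ 2 ≤ K + 4 * k * (R * ρ ^ 3) := by
    have := neg_le_of_abs_le (hqle s)
    linarith
  exact second_order_arith hγ hμ hF0 hV0 hR0 hρ0 hk1 hc hM hK hZ2 (norm_nonneg _) (hgz s)

end IsSol

end SecondOrder

/-! ### From the first bounds to the final ones -/

section Bootstrap

variable {L : ℝ} [Fact (0 < L)] {γ μ : ℝ} {m : ℕ} {f : L2per L} {v v' : ℝ → L2per L}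
  {a b : ℝ → C(AddCircle L, ℂ)} {g z : ℝ → L2per L}

lemma R0_nonneg {γ F μ V : ℝ} (hF : 0 ≤ F) (hV : 0 ≤ V) : 0 ≤ R0 γ F μ V := by
  rw [R0]; positivity

lemma R1_nonneg (c γ F μ V : ℝ) : 0 ≤ R1 c γ F μ V := Real.sqrt_nonneg _

lemma R0_le_R1 {c γ F μ V : ℝ} (hc : 0 ≤ c) (hγ : 0 < γ) (hμ : 0 ≤ μ) (hF : 0 ≤ F) (hV : 0 ≤ V) :
    R0 γ F μ V ≤ R1 c γ F μ V := by
  have hR := R0_nonneg (γ := γ) (μ := μ) hF hV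
  rw [R1]
  refine Real.le_sqrt_of_sq_le ?_
  rw [le_div_iff₀ (by positivity)]
  have h1 : 2 / 3 * R0 γ F μ V ^ 2 ≤ K2 c γ F μ V := by
    have : 0 ≤ 3 * c ^ 2 * R0 γ F μ V ^ 6 / 16 + 1 / 2 * c * R0 γ F μ V ^ 4
      + 2 * F * R0 γ F μ V + 2 * μ * V * R0 γ F μ V := by positivity
    rw [K2]; linarith
  have h2 : 0 ≤ K1 c γ F μ V := by rw [K1]; positivity
  have h3 := mul_le_mul_of_nonneg_left h1 (by positivity : 0 ≤ 3 / 2 * μ + 6 * γ)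
  have h4 : 0 ≤ γ * R0 γ F μ V ^ 2 := by positivity
  linarith

lemma le_R1form {c γ F μ V R : ℝ} (hc : 0 ≤ c) (hγ : 0 < γ) (hμ : 0 ≤ μ) (hF : 0 ≤ F)
    (hV : 0 ≤ V) (hR : 0 ≤ R) : R ≤ R1form c γ F μ V R := by
  rw [R1form]
  refine Real.le_sqrt_of_sq_le ?_
  have h1 : 6 / 7 * R ^ 2 ≤ K2form c F μ V R := by
    have : 0 ≤ c ^ 2 * R ^ 6 / (16 * (1 / 7)) + 1 / 2 * c * R ^ 4 + 2 * F * R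
      + 2 * μ * V * R := by positivity
    rw [K2form]; linarith
  have h2 : 0 ≤ 7 / (3 * γ) * K1form c γ F μ V R := by rw [K1form]; positivity
  linarith [sq_nonneg R]

/-- The loss caused by the high modes is at most `μ` as soon as the derivative is bounded by the
spectral gap `2π(m+1)/L`. -/
lemma HasWD.mul_norm_sub_modeProj_le {h g : L2per L} (H : HasWD h g) {B : ℝ} (hB : ‖g‖ ≤ B)
    (hBm : B * L / (2 * Real.pi * ((m : ℝ) + 1)) ≤ 1) (hμ : 0 ≤ μ) :
    μ * ‖h - DampedNLS.modeProj L m h‖ ^ 2 ≤ μ := by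
  have hL : (0 : ℝ) < L := Fact.out
  have hpi := Real.pi_pos
  have h1 := H.norm_sub_modeProj_le m
  have h2 : ‖h - DampedNLS.modeProj L m h‖ ≤ 1 := by
    refine h1.trans (le_trans ?_ hBm)
    rw [mul_comm, mul_div_assoc]
    exact mul_le_mul_of_nonneg_right ((norm_modeProj_sub_le m g).trans hB) (by positivity)
  exact mul_le_of_le_one_right hμ (pow_le_one₀ (norm_nonneg _) h2)

namespace IsSol

variable (S : IsSol γ μ m f v v' a b g z)
include S

lemma norm_le_R0t {V : ℝ} (hγ : 0 < γ) (hμ : 0 ≤ μ) (hv : ∀ s, ‖v s‖ ≤ V) (s : ℝ) :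
    ‖incl (a s)‖ ≤ R0t γ ‖f‖ μ V := by
  have hV0 : 0 ≤ V := (norm_nonneg _).trans (hv 0)
  have h1 := S.norm_sq_le (κ := γ) (C := 0) hγ hμ hγ hv (fun s => by
    have := mul_nonneg hμ (sq_nonneg ‖modeProj L m (incl (a s))‖)
    linarith) s
  have h2 : (‖f‖ ^ 2 / γ + μ * V ^ 2 + 0) / γ ≤ R0t γ ‖f‖ μ V ^ 2 := by
    have e : (‖f‖ ^ 2 / γ + μ * V ^ 2 + 0) / γ = (‖f‖ / γ) ^ 2 + (√(μ / γ) * V) ^ 2 := by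
      rw [mul_pow, Real.sq_sqrt (by positivity)]; field_simp; ring
    have : 0 ≤ ‖f‖ / γ * (√(μ / γ) * V) := by positivity
    rw [e, R0t]
    linarith
  exact (abs_le_of_sq_le_sq' (h1.trans h2) (by rw [R0t]; positivity)).2

/-- The `L²` bound with the damping `μ` used on all modes, up to a loss `μ` caused by the high
modes. -/
lemma norm_le_R0 {V : ℝ} (hγ : 0 < γ) (hμ : 0 ≤ μ) (hv : ∀ s, ‖v s‖ ≤ V)
    (hq : ∀ s, μ * ‖incl (a s) - modeProj L m (incl (a s))‖ ^ 2 ≤ μ) (s : ℝ) :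
    ‖incl (a s)‖ ≤ R0 γ ‖f‖ μ V := by
  have hV0 : 0 ≤ V := (norm_nonneg _).trans (hv 0)
  have hσ : 0 < γ + μ := by positivity
  have h1 := S.norm_sq_le (κ := γ + μ) (C := μ) hγ hμ hσ hv (fun s => by
    have h3 := norm_sq_eq_add_modeProj (m := m) (incl (a s))
    have h4 := hq s
    rw [add_mul, h3]
    linarith) s
  have h2 : (‖f‖ ^ 2 / γ + μ * V ^ 2 + μ) / (γ + μ) ≤ R0 γ ‖f‖ μ V ^ 2 := by
    have e : (‖f‖ ^ 2 / γ + μ * V ^ 2 + μ) / (γ + μ) = (‖f‖ / √(γ * (γ + μ))) ^ 2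
        + (√(μ / (γ + μ)) * V) ^ 2 + √(μ / (γ + μ)) ^ 2 := by
      rw [mul_pow, div_pow, Real.sq_sqrt (by positivity), Real.sq_sqrt (by positivity)]
      field_simp
    have p1 : 0 ≤ ‖f‖ / √(γ * (γ + μ)) * (√(μ / (γ + μ)) * V) := by positivity
    have p2 : 0 ≤ ‖f‖ / √(γ * (γ + μ)) * √(μ / (γ + μ)) := by positivity
    have p3 : 0 ≤ √(μ / (γ + μ)) * V * √(μ / (γ + μ)) := by positivity
    rw [e, R0]
    linarith
  exact (abs_le_of_sq_le_sq' (h1.trans h2) (R0_nonneg (norm_nonneg _) hV0)).2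

/-- The sup bound from the final `L²` and `H¹` bounds. -/
lemma norm_sq_le_Rinf {ℓ c V : ℝ} (hγ : 0 < γ) (hμ : 0 ≤ μ) (hℓ : 1 / L ≤ ℓ) (hc : ℓ + 4 ≤ c)
    (hV : 0 ≤ V) {s : ℝ} (hR : ‖incl (a s)‖ ≤ R0 γ ‖f‖ μ V)
    (hρ : ‖incl (b s)‖ ≤ 2 * R1 c γ ‖f‖ μ V) : ‖a s‖ ^ 2 ≤ Rinf c γ ‖f‖ μ V := by
  have hL : (0 : ℝ) < L := Fact.out
  have hℓ0 : 0 ≤ ℓ := (by positivity : 0 ≤ 1 / L).trans hℓ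
  have hR0 := R0_nonneg (γ := γ) (μ := μ) (norm_nonneg f) hV
  have hR1 := R1_nonneg c γ ‖f‖ μ V
  have h1 := R0_le_R1 (c := c) (by linarith) hγ hμ (norm_nonneg f) hV
  refine (S.agmon hℓ hR hρ).trans ?_
  have h2 : ℓ * R0 γ ‖f‖ μ V * R0 γ ‖f‖ μ V ≤ ℓ * R0 γ ‖f‖ μ V * R1 c γ ‖f‖ μ V := by gcongr
  have h3 : (ℓ + 4) * (R0 γ ‖f‖ μ V * R1 c γ ‖f‖ μ V)
      ≤ c * (R0 γ ‖f‖ μ V * R1 c γ ‖f‖ μ V) :=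
    mul_le_mul_of_nonneg_right hc (by positivity)
  rw [Rinf]
  linarith

/-- The sup bound for solutions of the feedback equation. The `H¹` bound from the damping `γ` alone
makes the high modes of `w` small, which improves the `L²` bound; the `H²` bound that follows makes
the high modes of `w_x` small, which improves the `H¹` bound. -/
lemma norm_sq_le_Rinf_of_modes {ℓ c V : ℝ} (hγ : 0 < γ) (hμ : 0 ≤ μ) (hℓ : 1 / L ≤ ℓ)
    (hc : 4 * (1 + ℓ) ≤ c) (hc' : 2000000 * (ℓ + 4) ^ 4 ≤ c) (hv : ∀ s, ‖v s‖ ≤ V)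
    (hv' : ∀ s, ‖v' s‖ ≤ V)
    (h1 : R1tt c γ ‖f‖ μ V * L / (2 * Real.pi * ((m : ℝ) + 1)) ≤ 1)
    (h2 : R2t c γ ‖f‖ μ V * L / (2 * Real.pi * ((m : ℝ) + 1)) ≤ 1) (s : ℝ) :
    ‖a s‖ ^ 2 ≤ Rinf c γ ‖f‖ μ V := by
  have hL : (0 : ℝ) < L := Fact.out
  have hℓ0 : 0 ≤ ℓ := (by positivity : 0 ≤ 1 / L).trans hℓ
  have hV : 0 ≤ V := (norm_nonneg _).trans (hv 0)
  have hc0 : 0 ≤ c := by linarith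
  have hF := norm_nonneg f
  have hR := R0_nonneg (γ := γ) (μ := μ) hF hV
  have s1 := S.norm_dx_le_R1form hγ hμ hℓ hc hv hv' (S.norm_le_R0t hγ hμ hv)
  have s2 := S.norm_le_R0 hγ hμ hv fun s => (S.wd_a s).mul_norm_sub_modeProj_le (s1 s) h1 hμ
  have s3 := S.norm_dx_le_R1form hγ hμ hℓ hc hv hv' s2
  have s4 := S.norm_dxx_le hγ hμ hℓ hc' hv hv' s2 (ρ := R1form c γ ‖f‖ μ V (R0 γ ‖f‖ μ V))
    (fun s => (s3 s).trans (by
      have := le_R1form (c := c) hc0 hγ hμ hF hV hR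
      linarith)) (le_R1form hc0 hγ hμ hF hV hR)
  have s5 : ∀ s, ‖g s‖ ≤ R2t c γ ‖f‖ μ V := fun s => by
    have := s4 s
    rw [R2t, R1t]
    linarith
  have s6 := S.norm_dx_le_R1 hγ hμ hℓ hc hv hv' s2 fun s =>
    (S.wd_b s).mul_norm_sub_modeProj_le (s5 s) h2 hμ
  exact S.norm_sq_le_Rinf hγ hμ hℓ (by linarith) hV (s2 s) (s6 s)

end IsSol

/-- The bounds for solutions without feedback: no condition on the modes is needed. -/
lemma IsSol.bounds_of_no_feedback {ℓ c V : ℝ} (S : IsSol γ 0 m f v v' a b g z) (hγ : 0 < γ)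
    (hℓ : 1 / L ≤ ℓ) (hc : 4 * (1 + ℓ) ≤ c) (hc' : 2000000 * (ℓ + 4) ^ 4 ≤ c)
    (hv : ∀ s, ‖v s‖ ≤ V) (hv' : ∀ s, ‖v' s‖ ≤ V) (s : ℝ) :
    ‖a s‖ ^ 2 ≤ Rinf c γ ‖f‖ 0 V ∧ ‖z s‖ ≤ Rprime c γ ‖f‖ 0 V := by
  have hL : (0 : ℝ) < L := Fact.out
  have hℓ0 : 0 ≤ ℓ := (by positivity : 0 ≤ 1 / L).trans hℓ
  have hV : 0 ≤ V := (norm_nonneg _).trans (hv 0)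
  have hc0 : 0 ≤ c := by linarith
  have hF := norm_nonneg f
  have s2 := S.norm_le_R0 hγ le_rfl hv fun s => by rw [zero_mul]
  have s6 := S.norm_dx_le_R1 hγ le_rfl hℓ hc hv hv' s2 fun s => by rw [zero_mul]
  have s7 := S.norm_dxx_le hγ le_rfl hℓ hc' hv hv' s2 s6 (R0_le_R1 hc0 hγ le_rfl hF hV) s
  have s8 := S.norm_sq_le_Rinf hγ le_rfl hℓ (by linarith) hV (s2 s) (s6 s)
  refine ⟨s8, ?_⟩
  have hR := R0_nonneg (γ := γ) (μ := 0) hF hV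
  have h1 : ‖incl (a s * star (a s) * a s)‖ ≤ c * R0 γ ‖f‖ 0 V ^ 2 * R1 c γ ‖f‖ 0 V := by
    refine (norm_cubic_le _).trans ((mul_le_mul s8 (s2 s) (norm_nonneg _)
      ((sq_nonneg _).trans s8)).trans (le_of_eq ?_))
    rw [Rinf]; ring
  have h2 : ‖γ • incl (a s)‖ ≤ γ * R0 γ ‖f‖ 0 V := by
    rw [norm_smul, Real.norm_of_nonneg hγ.le]
    exact mul_le_mul_of_nonneg_left (s2 s) hγ.le
  rw [S.eqn s, zero_smul, sub_zero]
  have h3 := norm_sub_le (Complex.I • (g s + incl (a s * star (a s) * a s) - f)) (γ • incl (a s))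
  rw [norm_I_smul] at h3
  have h4 := norm_sub_le (g s + incl (a s * star (a s) * a s)) f
  have h5 := norm_add_le (g s) (incl (a s * star (a s) * a s))
  have e : Rprime c γ ‖f‖ 0 V = R2form c γ ‖f‖ 0 V (R0 γ ‖f‖ 0 V) (R1 c γ ‖f‖ 0 V)
      + c * R0 γ ‖f‖ 0 V ^ 2 * R1 c γ ‖f‖ 0 V + γ * R0 γ ‖f‖ 0 V + ‖f‖ := by
    rw [Rprime, R2]; ring
  rw [e]
  linarith

/-- Without feedback, or if the feedback term vanishes, the data `μ` and `v` may be changed. -/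
lemma IsSol.change_feedback {μ' : ℝ} {y y' : ℝ → L2per L} (S : IsSol γ 0 m f v v' a b g z)
    (hy : ∀ s, HasDerivAt y (y' s) s) (hy' : Continuous y') (hP : ∀ s, modeProj L m (y s) = y s)
    (hP' : ∀ s, modeProj L m (y' s) = y' s)
    (h : ∀ s, μ' • (modeProj L m (incl (a s)) - y s) = 0) :
    IsSol γ μ' m f y y' a b g z where
  cont_a := S.cont_a
  cont_b := S.cont_b
  cont_g := S.cont_g
  wd_a := S.wd_a
  wd_b := S.wd_b
  deriv_a := S.deriv_a
  eqn := fun s => by rw [S.eqn s, h s, zero_smul]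
  deriv_v := hy
  cont_v' := hy'
  proj_v := hP
  proj_v' := hP'
  bdd := S.bdd

end Bootstrap

/-! ### Solutions with values in `H²_per` -/

section Transfer

variable {L : ℝ} [Fact (0 < L)]

/-- The continuous representative of `u ∈ H²_per`. -/
def H2per.rep (p : H2per L) : C(AddCircle L, ℂ) :=
  Classical.choose (p.2.1.hasWD.exists_rep)

/-- The continuous representative of `u_x`. -/
def H2per.repDx (p : H2per L) : C(AddCircle L, ℂ) :=
  Classical.choose (p.2.2.hasWD.exists_rep)

lemma H2per.incl_rep (p : H2per L) : incl p.rep = p.fn :=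
  (Classical.choose_spec (p.2.1.hasWD.exists_rep)).1

lemma H2per.incl_repDx (p : H2per L) : incl p.repDx = p.dx :=
  (Classical.choose_spec (p.2.2.hasWD.exists_rep)).1

lemma H2per.hasWD_fn (p : H2per L) : HasWD p.fn p.dx := p.2.1.hasWD

lemma H2per.hasWD_dx (p : H2per L) : HasWD p.dx p.dxx := p.2.2.hasWD

lemma H2per.continuous_fn : Continuous (H2per.fn : H2per L → L2per L) :=
  continuous_fst.comp continuous_subtype_val

lemma H2per.continuous_dx : Continuous (H2per.dx : H2per L → L2per L) :=
  continuous_fst.comp (continuous_snd.comp continuous_subtype_val)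

lemma H2per.continuous_dxx : Continuous (H2per.dxx : H2per L → L2per L) :=
  continuous_snd.comp (continuous_snd.comp continuous_subtype_val)

lemma H2per.continuous_norm : Continuous (H2per.norm : H2per L → ℝ) :=
  ((H2per.continuous_fn.norm.pow 2).add (H2per.continuous_dxx.norm.pow 2)).sqrt

/-- Representatives depend continuously on the function and its derivative. -/
lemma continuous_rep {Y : Type*} [TopologicalSpace Y] {r : Y → C(AddCircle L, ℂ)}
    {x x' : Y → L2per L} (hr : ∀ y, incl (r y) = x y) (hx : ∀ y, HasWD (x y) (x' y))
    (hc : Continuous x) (hc' : Continuous x') : Continuous r := by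
  rw [continuous_iff_continuousAt]
  intro y₀
  have h1 : Continuous fun y => √(‖x y - x y₀‖ ^ 2 / L + 2 * ‖x y - x y₀‖ * ‖x' y - x' y₀‖) := by
    fun_prop
  have h2 := h1.tendsto y₀
  simp only [sub_self, norm_zero, ne_eq, OfNat.ofNat_ne_zero, not_false_eq_true, zero_pow,
    zero_div, mul_zero, add_zero, Real.sqrt_zero] at h2
  rw [ContinuousAt, tendsto_iff_norm_sub_tendsto_zero]
  refine squeeze_zero (fun _ => norm_nonneg _) (fun y => ?_) h2
  refine Real.le_sqrt_of_sq_le ?_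
  have h3 := (hx y).sub (hx y₀)
  rw [← hr y, ← hr y₀, ← map_sub] at h3
  have h4 := h3.norm_sq_le
  rwa [map_sub, hr, hr] at h4

lemma H2per.norm_fn_le (p : H2per L) : ‖p.fn‖ ≤ p.norm :=
  Real.le_sqrt_of_sq_le (le_add_of_nonneg_right (sq_nonneg _))

lemma H2per.norm_dxx_le (p : H2per L) : ‖p.dxx‖ ≤ p.norm :=
  Real.le_sqrt_of_sq_le (le_add_of_nonneg_left (sq_nonneg _))

lemma H2per.norm_dx_le (p : H2per L) : ‖p.dx‖ ≤ p.norm := by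
  have h0 : 0 ≤ p.norm := Real.sqrt_nonneg _
  have h1 := p.hasWD_fn.real_inner_eq p.hasWD_dx
  rw [real_inner_self_eq_norm_sq] at h1
  have h2 := neg_le_of_abs_le (abs_real_inner_le_norm p.fn p.dxx)
  have h3 := mul_le_mul p.norm_fn_le p.norm_dxx_le (norm_nonneg _) h0
  exact (abs_le_of_sq_le_sq' (by nlinarith) h0).2

/-- An `H²_per` function is determined by its underlying function. -/
lemma H2per.ext_fn {p q : H2per L} (h : p.fn = q.fn) : p = q := by
  have h1 : p.dx = q.dx := by
    have := p.hasWD_fn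
    rw [h] at this
    exact this.unique q.hasWD_fn
  have h2 : p.dxx = q.dxx := by
    have := p.hasWD_dx
    rw [h1] at this
    exact this.unique q.hasWD_dx
  exact Subtype.ext (Prod.ext h (Prod.ext h1 h2))

/-- A bounded solution in the sense of the definitions, written with continuous representatives. -/
lemma SolvesOn.isSol {γ μ M V : ℝ} {m : ℕ} {f : L2per L} {v v' : ℝ → L2per L} {w : ℝ → H2per L}
    (hw : SolvesOn Set.univ γ
      (fun s => f - (Complex.I * (μ : ℂ)) • (modeProj L m (w s).fn - v s)) w)
    (hM : ∀ s, (w s).norm ≤ M) (hv : ∀ s, HasDerivAt v (v' s) s) (hv' : Continuous v')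
    (hP : ∀ s, modeProj L m (v s) = v s) (hP' : ∀ s, modeProj L m (v' s) = v' s)
    (hV : ∀ s, ‖v s‖ ≤ V) :
    IsSol γ μ m f v v' (fun s => (w s).rep) (fun s => (w s).repDx) (fun s => (w s).dxx)
      (fun s => deriv (fun t => (w t).fn) s) := by
  have hL : (0 : ℝ) < L := Fact.out
  have hwc : Continuous w := continuousOn_univ.mp hw.1
  have hfn : (fun t => incl (w t).rep) = fun t => (w t).fn := funext fun t => (w t).incl_rep
  have hder : ∀ s, HasDerivAt (fun t => incl (w t).rep) (deriv (fun t => (w t).fn) s) s := by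
    intro s
    obtain ⟨ws, h1, -⟩ := hw.2 s (Set.mem_univ s)
    rw [hasDerivWithinAt_univ] at h1
    rw [hfn, h1.deriv]
    exact h1
  have heqn : ∀ s, deriv (fun t => (w t).fn) s
      = Complex.I • ((w s).dxx + incl ((w s).rep * star (w s).rep * (w s).rep) - f)
        - γ • incl (w s).rep - μ • (modeProj L m (incl (w s).rep) - v s) := by
    intro s
    obtain ⟨ws, h1, h2⟩ := hw.2 s (Set.mem_univ s)
    rw [hasDerivWithinAt_univ] at h1
    rw [h1.deriv]
    have h3 : Complex.I • ws + (w s).dxx + incl ((w s).rep * star (w s).rep * (w s).rep)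
        + (Complex.I * (γ : ℂ)) • (w s).fn
        = f - (Complex.I * (μ : ℂ)) • (modeProj L m (w s).fn - v s) := by
      refine Lp.ext ?_
      have h4 := incl_ae (w s).rep
      rw [(w s).incl_rep] at h4
      filter_upwards [h2, h4, incl_ae ((w s).rep * star (w s).rep * (w s).rep),
        Lp.coeFn_add (Complex.I • ws + (w s).dxx
          + incl ((w s).rep * star (w s).rep * (w s).rep)) ((Complex.I * (γ : ℂ)) • (w s).fn),
        Lp.coeFn_add (Complex.I • ws + (w s).dxx)
          (incl ((w s).rep * star (w s).rep * (w s).rep)),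
        Lp.coeFn_add (Complex.I • ws) (w s).dxx, Lp.coeFn_smul Complex.I ws,
        Lp.coeFn_smul (Complex.I * (γ : ℂ)) (w s).fn] with x e1 e2 e3 e4 e5 e6 e7 e8
      rw [← e1, e4, Pi.add_apply, e5, Pi.add_apply, e6, Pi.add_apply, e7, Pi.smul_apply, e8,
        Pi.smul_apply, e3, smul_eq_mul, smul_eq_mul]
      congr 2
      rw [ContinuousMap.mul_apply, ContinuousMap.mul_apply, ContinuousMap.star_apply, e2]
      congr 1
      rw [← Complex.normSq_eq_norm_sq, ← Complex.mul_conj]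
      rfl
    have h5 : ws = - (Complex.I • (Complex.I • ws)) := by
      rw [smul_smul, Complex.I_mul_I, neg_one_smul, neg_neg]
    have h6 : Complex.I • ws = f - (Complex.I * (μ : ℂ)) • (modeProj L m (w s).fn - v s)
        - (w s).dxx - incl ((w s).rep * star (w s).rep * (w s).rep)
        - (Complex.I * (γ : ℂ)) • (w s).fn := by
      rw [← h3]; abel
    have e1 : ∀ (r : ℝ) (x : L2per L), Complex.I • ((Complex.I * (r : ℂ)) • x) = - (r • x) := by
      intro r x
      rw [smul_smul, ← mul_assoc, Complex.I_mul_I, neg_one_mul, neg_smul]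
      rfl
    rw [h5, h6, (w s).incl_rep]
    simp only [smul_sub Complex.I, smul_add Complex.I, e1]
    abel
  have hM0 : 0 ≤ M := (Real.sqrt_nonneg _).trans (hM 0)
  refine ⟨?_, ?_, H2per.continuous_dxx.comp hwc, ?_, ?_, hder, heqn, hv, hv', hP, hP', ?_⟩
  · exact continuous_rep (fun s => (w s).incl_rep) (fun s => (w s).hasWD_fn)
      (H2per.continuous_fn.comp hwc) (H2per.continuous_dx.comp hwc)
  · exact continuous_rep (fun s => (w s).incl_repDx) (fun s => (w s).hasWD_dx)
      (H2per.continuous_dx.comp hwc) (H2per.continuous_dxx.comp hwc)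
  · intro s
    rw [(w s).incl_rep, (w s).incl_repDx]
    exact (w s).hasWD_fn
  · intro s
    rw [(w s).incl_repDx]
    exact (w s).hasWD_dx
  · have hfM : ∀ s, ‖(w s).fn‖ ≤ M := fun s => (w s).norm_fn_le.trans (hM s)
    have hdM : ∀ s, ‖(w s).dx‖ ≤ M := fun s => (w s).norm_dx_le.trans (hM s)
    have hgM : ∀ s, ‖(w s).dxx‖ ≤ M := fun s => (w s).norm_dxx_le.trans (hM s)
    have sup : ∀ (c : C(AddCircle L, ℂ)) (x x' : L2per L), incl c = x → HasWD x x' → ‖x‖ ≤ M →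
        ‖x'‖ ≤ M → ‖c‖ ≤ √(M ^ 2 / L + 2 * M * M) := by
      intro c x x' hc hx h1 h2
      refine Real.le_sqrt_of_sq_le ?_
      rw [← hc] at hx h1
      refine hx.norm_sq_le.trans ?_
      gcongr
    set C := √(M ^ 2 / L + 2 * M * M) with hC
    have hC0 : 0 ≤ C := Real.sqrt_nonneg _
    have ha : ∀ s, ‖(w s).rep‖ ≤ C := fun s =>
      sup _ _ _ (w s).incl_rep (w s).hasWD_fn (hfM s) (hdM s)
    have hb : ∀ s, ‖(w s).repDx‖ ≤ C := fun s =>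
      sup _ _ _ (w s).incl_repDx (w s).hasWD_dx (hdM s) (hgM s)
    have hz : ∀ s, ‖deriv (fun t => (w t).fn) s‖
        ≤ (M + C ^ 2 * M + ‖f‖) + |γ| * M + |μ| * (M + V) := by
      intro s
      have n1 : ‖incl ((w s).rep * star (w s).rep * (w s).rep)‖ ≤ C ^ 2 * M := by
        refine (norm_cubic_le _).trans ?_
        rw [(w s).incl_rep]
        exact mul_le_mul (pow_le_pow_left₀ (norm_nonneg _) (ha s) 2) (hfM s) (norm_nonneg _)
          (by positivity)
      have n2 : ‖(w s).dxx + incl ((w s).rep * star (w s).rep * (w s).rep) - f‖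
          ≤ M + C ^ 2 * M + ‖f‖ := by
        refine (norm_sub_le _ _).trans (add_le_add ((norm_add_le _ _).trans ?_) le_rfl)
        exact add_le_add (hgM s) n1
      have n3 : ‖modeProj L m (w s).fn - v s‖ ≤ M + V :=
        (norm_sub_le _ _).trans (add_le_add ((norm_modeProj_le _).trans (hfM s)) (hV s))
      rw [heqn s, (w s).incl_rep]
      refine (norm_sub_le _ _).trans (add_le_add ((norm_sub_le _ _).trans (add_le_add ?_ ?_)) ?_)
      · rw [norm_I_smul]; exact n2
      · rw [norm_smul, Real.norm_eq_abs]
        exact mul_le_mul_of_nonneg_left (hfM s) (abs_nonneg _)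
      · rw [norm_smul, Real.norm_eq_abs]
        exact mul_le_mul_of_nonneg_left n3 (abs_nonneg _)
    refine ⟨max C (max M ((M + C ^ 2 * M + ‖f‖) + |γ| * M + |μ| * (M + V))), fun s =>
      ⟨(ha s).trans (le_max_left _ _), (hb s).trans (le_max_left _ _), ?_, ?_⟩⟩
    · exact (hgM s).trans ((le_max_left _ _).trans (le_max_right _ _))
    · exact (hz s).trans ((le_max_right _ _).trans (le_max_right _ _))

end Transfer

/-! ### The difference of two solutions -/

section Difference

variable {L : ℝ} [Fact (0 < L)] {γ μ : ℝ} {m : ℕ} {f : L2per L} {v v' : ℝ → L2per L}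
  {a b a₁ b₁ : ℝ → C(AddCircle L, ℂ)} {g z g₁ z₁ : ℝ → L2per L}

/-- The increment of the cubic nonlinearity. -/
lemma cubic_sub {X : Type*} [TopologicalSpace X] (p q : C(X, ℂ)) :
    p * star p * p - q * star q * q
      = (p * star p + q * star q) * (p - q) + p * q * star (p - q) := by
  rw [star_sub]; ring

lemma norm_mul_star_le {X : Type*} [TopologicalSpace X] [CompactSpace X] (p : C(X, ℂ)) :
    ‖p * star p‖ ≤ ‖p‖ ^ 2 :=
  (norm_mul_le _ _).trans (by rw [norm_star, sq])

lemma norm_cubic_sub_le (p q : C(AddCircle L, ℂ)) :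
    ‖incl (p * star p * p - q * star q * q)‖
      ≤ (‖p‖ ^ 2 + ‖q‖ ^ 2 + ‖p‖ * ‖q‖) * ‖incl (p - q)‖ := by
  rw [cubic_sub, map_add, ← mulL_incl, ← mulL_incl, ← conjL_incl, add_mul (‖p‖ ^ 2 + ‖q‖ ^ 2)]
  refine (norm_add_le _ _).trans (add_le_add ?_ ?_)
  · refine (norm_mulL_le _ _).trans (mul_le_mul_of_nonneg_right ?_ (norm_nonneg _))
    exact (norm_add_le _ _).trans (add_le_add (norm_mul_star_le p) (norm_mul_star_le q))
  · refine (norm_mulL_le _ _).trans ?_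
    rw [norm_conjL]
    exact mul_le_mul_of_nonneg_right (norm_mul_le _ _) (norm_nonneg _)

/-- In the `L²` balance of the difference only the term `w u \bar δ` of the nonlinearity
contributes. -/
lemma real_inner_I_smul_cubic_sub_le (p q : C(AddCircle L, ℂ)) :
    inner ℝ (incl (p - q)) (Complex.I • incl (p * star p * p - q * star q * q))
      ≤ ‖p‖ * ‖q‖ * ‖incl (p - q)‖ ^ 2 := by
  have h1 : star (p * star p + q * star q) = p * star p + q * star q := by
    rw [star_add, star_mul_star_self, star_mul_star_self]
  rw [cubic_sub, map_add, ← mulL_incl, smul_add, inner_add_right, real_inner_I_smul_mulL_self h1,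
    zero_add]
  refine (real_inner_le_norm _ _).trans ?_
  rw [norm_I_smul, ← mulL_incl, ← conjL_incl]
  have h2 := norm_mulL_le (p * q) (conjL (incl (p - q)))
  rw [norm_conjL] at h2
  have h3 := mul_le_mul_of_nonneg_right (norm_mul_le p q) (norm_nonneg (incl (p - q)))
  calc _ ≤ ‖incl (p - q)‖ * (‖p‖ * ‖q‖ * ‖incl (p - q)‖) :=
        mul_le_mul_of_nonneg_left (h2.trans h3) (norm_nonneg _)
    _ = _ := by ring

/-- The potential energy `½‖w‖₄⁴ - ½‖u‖₄⁴ - 2 Re ⟨|u|²u, w - u⟩` of the difference, at fixed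
time, as a sum of squares. -/
lemma potential_eq (p q : C(AddCircle L, ℂ)) :
    1 / 2 * ‖incl (p * p)‖ ^ 2 - 1 / 2 * ‖incl (q * q)‖ ^ 2
        - 2 * inner ℝ (incl (q * star q * q)) (incl (p - q))
      = ‖mulL q (incl (p - q))‖ ^ 2 + 1 / 2 * ‖incl (p * star p - q * star q)‖ ^ 2 := by
  have hJ : ∀ x y : C(AddCircle L, ℂ),
      inner ℝ (incl x) (incl y) = inner ℝ (incl 1) (incl (star x * y)) := by
    intro x y
    rw [← mulL_incl (star x) y, real_inner_mulL, star_star, mulL_incl, mul_one]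
  have hJs : ∀ x : C(AddCircle L, ℂ),
      inner ℝ (incl 1) (incl (star x)) = inner ℝ (incl 1) (incl x) := by
    intro x
    rw [← real_inner_conjL, conjL_incl, conjL_incl, star_star, star_one]
  have hsum : inner ℝ (incl 1) (incl (star (q * star q * q) * (p - q)))
      = 1 / 2 * inner ℝ (incl 1) (incl (star (q * star q * q) * (p - q)
        + star (star (q * star q * q) * (p - q)))) := by
    rw [map_add, inner_add_right, hJs]
    ring
  have htwo : ∀ x : C(AddCircle L, ℂ), inner ℝ (incl 1) (incl x)
      = 1 / 2 * inner ℝ (incl 1) (incl (x + x)) := by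
    intro x
    rw [map_add, inner_add_right]; ring
  rw [mulL_incl]
  simp only [← real_inner_self_eq_norm_sq]
  rw [hJ (p * p), hJ (q * q), hJ (q * star q * q), hsum, hJ (q * (p - q)),
    hJ (p * star p - q * star q), htwo (star (q * (p - q)) * (q * (p - q)))]
  have key : star (p * p) * (p * p) - star (q * q) * (q * q)
      - (star (q * star q * q) * (p - q) + star (star (q * star q * q) * (p - q)))
      - (star (q * star q * q) * (p - q) + star (star (q * star q * q) * (p - q)))
      = (star (q * (p - q)) * (q * (p - q)) + star (q * (p - q)) * (q * (p - q)))
        + star (p * star p - q * star q) * (p * star p - q * star q) := by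
    simp only [star_mul, star_sub, star_star]
    ring
  have h := congrArg (fun x => inner ℝ (incl (1 : C(AddCircle L, ℂ))) (incl x)) key
  simp only [map_sub, map_add, inner_sub_right, inner_add_right] at h ⊢
  linarith

lemma potential_nonneg (p q : C(AddCircle L, ℂ)) :
    0 ≤ 1 / 2 * ‖incl (p * p)‖ ^ 2 - 1 / 2 * ‖incl (q * q)‖ ^ 2
        - 2 * inner ℝ (incl (q * star q * q)) (incl (p - q)) := by
  rw [potential_eq]; positivity

lemma potential_le (p q : C(AddCircle L, ℂ)) :
    1 / 2 * ‖incl (p * p)‖ ^ 2 - 1 / 2 * ‖incl (q * q)‖ ^ 2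
        - 2 * inner ℝ (incl (q * star q * q)) (incl (p - q))
      ≤ 2 * (‖p‖ ^ 2 + ‖q‖ ^ 2) * ‖incl (p - q)‖ ^ 2 := by
  rw [potential_eq]
  have h1 : ‖mulL q (incl (p - q))‖ ^ 2 ≤ ‖q‖ ^ 2 * ‖incl (p - q)‖ ^ 2 := by
    rw [← mul_pow]
    exact pow_le_pow_left₀ (norm_nonneg _) (norm_mulL_le _ _) 2
  have h2 : ‖incl (p * star p - q * star q)‖ ≤ (‖p‖ + ‖q‖) * ‖incl (p - q)‖ := by
    have e : p * star p - q * star q = star p * (p - q) + q * star (p - q) := by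
      rw [star_sub]; ring
    rw [e, map_add, ← mulL_incl, ← mulL_incl, ← conjL_incl, add_mul]
    refine (norm_add_le _ _).trans (add_le_add ?_ ?_)
    · refine (norm_mulL_le _ _).trans ?_
      rw [norm_star]
    · refine (norm_mulL_le _ _).trans ?_
      rw [norm_conjL]
  have h3 := pow_le_pow_left₀ (norm_nonneg _) h2 2
  have h4 : (‖p‖ + ‖q‖) ^ 2 * ‖incl (p - q)‖ ^ 2
      ≤ 2 * (‖p‖ ^ 2 + ‖q‖ ^ 2) * ‖incl (p - q)‖ ^ 2 := by
    refine mul_le_mul_of_nonneg_right ?_ (sq_nonneg _)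
    linarith [sq_nonneg (‖p‖ - ‖q‖)]
  have h5 : 0 ≤ ‖p‖ ^ 2 * ‖incl (p - q)‖ ^ 2 := by positivity
  rw [mul_pow] at h3
  linarith

/-- The remainder of the cubic nonlinearity after its linearisation at `q`. -/
lemma norm_cubic_remainder_le (p q : C(AddCircle L, ℂ)) :
    ‖incl (p * star p * p - q * star q * q) - cubicD q (incl (p - q))‖
      ≤ ‖p - q‖ * (‖p‖ + 2 * ‖q‖) * ‖incl (p - q)‖ := by
  have e : incl (p * star p * p - q * star q * q) - cubicD q (incl (p - q))
      = mulL ((p - q) * star p) (incl (p - q))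
        + (mulL ((p - q) * q) (incl (star (p - q)))
          + mulL ((p - q) * q) (incl (star (p - q)))) := by
    rw [cubicD, conjL_incl, mulL_incl, mulL_incl, mulL_incl, mulL_incl, ← map_add, ← map_add,
      ← map_add, ← map_sub]
    congr 1
    rw [star_sub]
    ring
  have h1 : ‖mulL ((p - q) * star p) (incl (p - q))‖ ≤ ‖p - q‖ * ‖p‖ * ‖incl (p - q)‖ := by
    refine (norm_mulL_le _ _).trans (mul_le_mul_of_nonneg_right ?_ (norm_nonneg _))
    exact (norm_mul_le _ _).trans (by rw [norm_star])
  have h2 : ‖mulL ((p - q) * q) (incl (star (p - q)))‖ ≤ ‖p - q‖ * ‖q‖ * ‖incl (p - q)‖ := by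
    refine (norm_mulL_le _ _).trans ?_
    rw [← conjL_incl, norm_conjL]
    exact mul_le_mul_of_nonneg_right (norm_mul_le _ _) (norm_nonneg _)
  rw [e]
  refine (norm_add_le _ _).trans ((add_le_add h1 ((norm_add_le _ _).trans (add_le_add h2 h2))).trans
    (le_of_eq ?_))
  ring

lemma real_inner_cubicD (q : C(AddCircle L, ℂ)) (x y : L2per L) :
    inner ℝ (cubicD q x) y = inner ℝ x (cubicD q y) := by
  have h1 : inner ℝ (mulL (q * q) (conjL x)) y = inner ℝ x (mulL (q * q) (conjL y)) := by
    rw [real_inner_mulL (q * q) x, ← real_inner_conjL, conjL_mulL, conjL_conjL]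
  have h2 : star (q * star q + q * star q) = q * star q + q * star q := by
    rw [star_add, star_mul_star_self]
  rw [cubicD, cubicD, inner_add_left, inner_add_right, h1,
    real_inner_mulL (q * star q + q * star q), h2]

/-- The equation for the difference of two solutions with the same data. -/
lemma IsSol.sub_eqn (S : IsSol γ μ m f v v' a b g z) (S₁ : IsSol γ μ m f v v' a₁ b₁ g₁ z₁) (s : ℝ) :
    z s - z₁ s = Complex.I • ((g s - g₁ s)
        + incl (a s * star (a s) * a s - a₁ s * star (a₁ s) * a₁ s))
      - γ • incl (a s - a₁ s) - μ • modeProj L m (incl (a s - a₁ s)) := by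
  rw [S.eqn s, S₁.eqn s]
  simp only [map_sub, smul_sub, smul_add]
  abel

lemma IsSol.hasDerivAt_sub (S : IsSol γ μ m f v v' a b g z)
    (S₁ : IsSol γ μ m f v v' a₁ b₁ g₁ z₁) (s : ℝ) :
    HasDerivAt (fun t => incl (a t - a₁ t)) (z s - z₁ s) s := by
  have h := (S.deriv_a s).fun_sub (S₁.deriv_a s)
  simpa only [map_sub] using h

lemma IsSol.hasWD_sub (S : IsSol γ μ m f v v' a b g z)
    (S₁ : IsSol γ μ m f v v' a₁ b₁ g₁ z₁) (s : ℝ) :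
    HasWD (incl (a s - a₁ s)) (incl (b s - b₁ s)) := by
  rw [map_sub, map_sub]; exact (S.wd_a s).sub (S₁.wd_a s)

lemma IsSol.hasWD_sub' (S : IsSol γ μ m f v v' a b g z)
    (S₁ : IsSol γ μ m f v v' a₁ b₁ g₁ z₁) (s : ℝ) :
    HasWD (incl (b s - b₁ s)) (g s - g₁ s) := by
  rw [map_sub]; exact (S.wd_b s).sub (S₁.wd_b s)

/-- The `L²` estimate of the difference: the feedback damps the low modes, so that the growth
comes from the high modes only, which the Poincaré inequality turns into a small multiple of the
`H¹` seminorm. -/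
lemma IsSol.sub_inner_le {A r : ℝ} (S : IsSol γ μ m f v v' a b g z)
    (S₁ : IsSol γ μ m f v v' a₁ b₁ g₁ z₁) (hr : r = L / (2 * Real.pi * ((m : ℝ) + 1)))
    (hA : ∀ s, ‖a s‖ * ‖a₁ s‖ ≤ A) (hAμ : A ≤ μ) (s : ℝ) :
    2 * inner ℝ (incl (a s - a₁ s)) (z s - z₁ s)
      ≤ - 2 * γ * ‖incl (a s - a₁ s)‖ ^ 2 + 2 * A * r ^ 2 * ‖incl (b s - b₁ s)‖ ^ 2 := by
  have hA0 : 0 ≤ A := le_trans (by positivity) (hA s)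
  have h1 := (S.hasWD_sub S₁ s).real_inner_I_smul_self (S.hasWD_sub' S₁ s)
  have h2 := real_inner_I_smul_cubic_sub_le (a s) (a₁ s)
  have h3 := mul_le_mul_of_nonneg_right (hA s) (sq_nonneg ‖incl (a s - a₁ s)‖)
  have h4 := norm_sq_eq_add_modeProj (m := m) (incl (a s - a₁ s))
  have h5 : ‖incl (a s - a₁ s) - modeProj L m (incl (a s - a₁ s))‖ ^ 2
      ≤ r ^ 2 * ‖incl (b s - b₁ s)‖ ^ 2 := by
    have hL : (0 : ℝ) < L := Fact.out
    have hpi := Real.pi_pos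
    have e1 := (S.hasWD_sub S₁ s).norm_sub_modeProj_le m
    rw [← hr] at e1
    have e2 : 0 ≤ r := by rw [hr]; positivity
    rw [← mul_pow]
    refine pow_le_pow_left₀ (norm_nonneg _) (e1.trans ?_) 2
    exact mul_le_mul_of_nonneg_left (norm_modeProj_sub_le m _) e2
  have h6 := mul_le_mul_of_nonneg_left h5 hA0
  have h7 := mul_nonneg (sub_nonneg.mpr hAμ) (sq_nonneg ‖modeProj L m (incl (a s - a₁ s))‖)
  rw [S.sub_eqn S₁ s, smul_add, inner_sub_right, inner_sub_right, inner_add_right, h1,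
    inner_smul_right, inner_smul_right, real_inner_self_eq_norm_sq,
    real_inner_comm (modeProj L m _), real_inner_modeProj_self]
  have h8 : A * ‖incl (a s - a₁ s)‖ ^ 2 = A * ‖modeProj L m (incl (a s - a₁ s))‖ ^ 2
      + A * ‖incl (a s - a₁ s) - modeProj L m (incl (a s - a₁ s))‖ ^ 2 := by
    rw [← mul_add, ← h4]
  linarith

/-- The `H¹` energy of the difference. Expanding about `a₁`, only the velocity of `a₁` enters. -/
lemma IsSol.hasDerivAt_sub_energy (S : IsSol γ μ m f v v' a b g z)
    (S₁ : IsSol γ μ m f v v' a₁ b₁ g₁ z₁) (s : ℝ) :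
    HasDerivAt (fun t => ‖incl (b t - b₁ t)‖ ^ 2
        - (1 / 2 * ‖incl (a t * a t)‖ ^ 2 - 1 / 2 * ‖incl (a₁ t * a₁ t)‖ ^ 2
          - 2 * inner ℝ (incl (a₁ t * star (a₁ t) * a₁ t)) (incl (a t - a₁ t))))
      (2 * γ * (- ‖incl (b s - b₁ s)‖ ^ 2 + inner ℝ (incl (a s - a₁ s))
            (incl (a s * star (a s) * a s - a₁ s * star (a₁ s) * a₁ s)))
        + 2 * μ * (- ‖modeProj L m (incl (b s - b₁ s))‖ ^ 2
          + inner ℝ (modeProj L m (incl (a s - a₁ s)))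
            (incl (a s * star (a s) * a s - a₁ s * star (a₁ s) * a₁ s)))
        - 2 * inner ℝ (z₁ s) (incl (a s * star (a s) * a s - a₁ s * star (a₁ s) * a₁ s)
          - cubicD (a₁ s) (incl (a s - a₁ s)))) s := by
  have hd := S.hasDerivAt_sub S₁
  have h1 := hasDerivAt_norm_sq_dx (a := fun t => a t - a₁ t) (b := fun t => b t - b₁ t)
    (g := fun t => g t - g₁ t) (z := fun t => z t - z₁ t) (s := s)
    (S.cont_g.sub S₁.cont_g) (S.hasWD_sub S₁) (S.hasWD_sub' S₁) (hd s)
  have h2 := (hasDerivAt_incl_sq S.cont_a (S.deriv_a s)).norm_sq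
  have h3 := (hasDerivAt_incl_sq S₁.cont_a (S₁.deriv_a s)).norm_sq
  have h4 := (hasDerivAt_cubic S₁.cont_a (S₁.deriv_a s)).inner ℝ (hd s)
  have h5 := h1.sub (((h2.const_mul (1 / 2)).sub (h3.const_mul (1 / 2))).sub (h4.const_mul 2))
  refine h5.congr_deriv ?_
  have hsq : ∀ (p : C(AddCircle L, ℂ)) (x : L2per L), inner ℝ (incl (p * p)) (mulL (p + p) x)
      = 2 * inner ℝ (incl (p * star p * p)) x := by
    intro p x
    rw [mulL_add_left, inner_add_right, real_inner_mulL, mulL_incl]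
    have e : star p * (p * p) = p * star p * p := by ring
    rw [e]; ring
  rw [hsq, hsq]
  obtain ⟨H, hH⟩ : ∃ H, H = incl (a s * star (a s) * a s - a₁ s * star (a₁ s) * a₁ s) := ⟨_, rfl⟩
  have hH' : H = incl (a s * star (a s) * a s) - incl (a₁ s * star (a₁ s) * a₁ s) := by
    rw [hH, map_sub]
  have e1 := S.sub_eqn S₁ s
  rw [← hH] at e1
  have e2 : inner ℝ (z s - z₁ s) (g s - g₁ s + H)
      = - γ * (- ‖incl (b s - b₁ s)‖ ^ 2 + inner ℝ (incl (a s - a₁ s)) H)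
        - μ * (- ‖modeProj L m (incl (b s - b₁ s))‖ ^ 2
          + inner ℝ (modeProj L m (incl (a s - a₁ s))) H) := by
    have k1 : inner ℝ (incl (a s - a₁ s)) (g s - g₁ s) = - ‖incl (b s - b₁ s)‖ ^ 2 := by
      rw [(S.hasWD_sub S₁ s).real_inner_eq (S.hasWD_sub' S₁ s), real_inner_self_eq_norm_sq]
    have k2 : inner ℝ (modeProj L m (incl (a s - a₁ s))) (g s - g₁ s)
        = - ‖modeProj L m (incl (b s - b₁ s))‖ ^ 2 := by
      rw [((S.hasWD_sub S₁ s).modeProj m).real_inner_eq (S.hasWD_sub' S₁ s),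
        real_inner_modeProj_self]
    conv_lhs => rw [e1]
    rw [inner_sub_left, inner_sub_left, real_inner_I_smul_self, inner_smul_left, inner_smul_left,
      inner_add_right, inner_add_right, k1, k2]
    simp
  have e3 : inner ℝ (z s - z₁ s) (g s - g₁ s + H) = inner ℝ (z s - z₁ s) (g s - g₁ s)
      + inner ℝ (incl (a s * star (a s) * a s)) (z s)
      - inner ℝ (incl (a s * star (a s) * a s)) (z₁ s)
      - inner ℝ (incl (a₁ s * star (a₁ s) * a₁ s)) (z s)
      + inner ℝ (incl (a₁ s * star (a₁ s) * a₁ s)) (z₁ s) := by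
    rw [inner_add_right, real_inner_comm H, hH', inner_sub_left (incl (a s * star (a s) * a s)),
      inner_sub_right _ (z s), inner_sub_right _ (z s)]
    ring
  have e4 : inner ℝ (z₁ s) (H - cubicD (a₁ s) (incl (a s - a₁ s)))
      = inner ℝ (incl (a s * star (a s) * a s)) (z₁ s)
        - inner ℝ (incl (a₁ s * star (a₁ s) * a₁ s)) (z₁ s)
        - inner ℝ (cubicD (a₁ s) (z₁ s)) (incl (a s - a₁ s)) := by
    rw [inner_sub_right, real_inner_comm H, hH', inner_sub_left, real_inner_cubicD]
  rw [← hH, inner_sub_right (incl (a₁ s * star (a₁ s) * a₁ s))]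
  linear_combination (2 : ℝ) * e3 - (2 : ℝ) * e2 + (2 : ℝ) * e4

/-- Young's inequality with exponents `4` and `4/3`, in the form needed below: `T` plays the role of
`γ^{-1/3} β^{4/3}`. -/
lemma young_absorb {γ β T ℓ n X D : ℝ} (hγ : 0 < γ) (hβ : 0 ≤ β) (hT : 0 ≤ T) (hℓ : 0 ≤ ℓ)
    (hTβ : T ^ 3 * γ = β ^ 4) (hD : D ^ 2 ≤ ℓ * n ^ 2 + 2 * n * X) :
    6 * β * (D * n) ≤ γ * X ^ 2 + 11 * (1 + ℓ) * (β + T) * n ^ 2 := by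
  have hx : 0 ≤ γ * X ^ 2 := by positivity
  have hy : 0 ≤ T * n ^ 2 := by positivity
  -- the pure `β` part and the Young part of the right side
  set P := 11 * (1 + ℓ) * β * n ^ 2 with hP
  set Q := γ * X ^ 2 + 11 * (T * n ^ 2) with hQ
  have hP0 : 0 ≤ P := by positivity
  have hQ0 : 0 ≤ Q := by positivity
  have h1 : 36 * β ^ 2 * (ℓ * n ^ 4) ≤ P ^ 2 := by
    have : 36 * ℓ ≤ 121 * (1 + ℓ) ^ 2 := by linarith [sq_nonneg ℓ]
    have := mul_le_mul_of_nonneg_right this (by positivity : 0 ≤ β ^ 2 * n ^ 4)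
    rw [hP]
    linarith
  have h2 : 72 * β ^ 2 * (n ^ 3 * X) ≤ Q ^ 2 := by
    refine (abs_le_of_sq_le_sq' ?_ (sq_nonneg Q)).2
    have e : (72 * β ^ 2 * (n ^ 3 * X)) ^ 2 = 5184 * ((γ * X ^ 2) * (T * n ^ 2) ^ 3) := by
      calc _ = 5184 * (β ^ 4 * (n ^ 6 * X ^ 2)) := by ring
        _ = _ := by rw [← hTβ]; ring
    have e2 : 4 * ((γ * X ^ 2) * (11 * (T * n ^ 2)) ^ 3) ≤ (Q ^ 2) ^ 2 := by
      obtain ⟨x, hx'⟩ : ∃ x, x = γ * X ^ 2 := ⟨_, rfl⟩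
      obtain ⟨y, hy'⟩ : ∃ y, y = 11 * (T * n ^ 2) := ⟨_, rfl⟩
      have y0 : 0 ≤ y := by rw [hy']; positivity
      have x0 : 0 ≤ x := by rw [hx']; exact hx
      rw [hQ, ← hx', ← hy']
      have : 0 ≤ x ^ 4 + 4 * x ^ 3 * y + 6 * x ^ 2 * y ^ 2 + y ^ 4 := by positivity
      linarith
    have e3 : 0 ≤ (γ * X ^ 2) * (T * n ^ 2) ^ 3 := by positivity
    rw [e]
    linarith
  have h3 : (6 * β * (D * n)) ^ 2 ≤ (P + Q) ^ 2 := by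
    have := mul_le_mul_of_nonneg_left hD (by positivity : 0 ≤ 36 * β ^ 2 * n ^ 2)
    have := mul_nonneg hP0 hQ0
    linarith
  have h4 := (abs_le_of_sq_le_sq' h3 (by positivity)).2
  have h5 : 0 ≤ 11 * ℓ * (T * n ^ 2) := by positivity
  rw [hP, hQ] at h4
  linarith

/-- Two bounded solutions with the same data coincide if the high modes are damped strongly enough.
The bounds are `R` for `‖a‖²` and `‖a₁‖²`, `R⁰` for `‖a₁‖²`, and `Rp` for the velocity of `a₁`. -/
lemma IsSol.incl_eq {A R R' Rp T J ℓ r : ℝ} (S : IsSol γ μ m f v v' a b g z)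
    (S₁ : IsSol γ μ m f v v' a₁ b₁ g₁ z₁) (hγ : 0 < γ) (hμ : 0 ≤ μ) (hℓ : 1 / L ≤ ℓ)
    (hr : r = L / (2 * Real.pi * ((m : ℝ) + 1))) (hAdef : A = √R * √R')
    (haR : ∀ s, ‖a s‖ ^ 2 ≤ R) (ha₁R : ∀ s, ‖a₁ s‖ ^ 2 ≤ R) (ha₁R' : ∀ s, ‖a₁ s‖ ^ 2 ≤ R')
    (hzp : ∀ s, ‖z₁ s‖ ≤ Rp) (hAμ : A ≤ μ) (hT : 0 ≤ T) (hTp : T ^ 3 * γ = (√R * Rp) ^ 4)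
    (hJ : (μ + γ) * (R + R' + A) + √R * Rp + T ≤ J)
    (hsmall : 44 * (1 + ℓ) * (A * J) * r ^ 2 ≤ γ ^ 2 / 2) (s : ℝ) :
    incl (a s) = incl (a₁ s) := by
  have hL : (0 : ℝ) < L := Fact.out
  have hℓ0 : 0 ≤ ℓ := (by positivity : 0 ≤ 1 / L).trans hℓ
  have hR0 : 0 ≤ R := (sq_nonneg _).trans (haR 0)
  have hR'0 : 0 ≤ R' := (sq_nonneg _).trans (ha₁R' 0)
  have hRp0 : 0 ≤ Rp := (norm_nonneg _).trans (hzp 0)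
  have hA0 : 0 ≤ A := by rw [hAdef]; positivity
  have hS0 : 0 ≤ R + R' + A := by positivity
  have hβ0 : 0 ≤ √R * Rp := by positivity
  have hJ0 : 0 ≤ J := le_trans (by positivity) hJ
  have ha : ∀ s, ‖a s‖ ≤ √R := fun s => Real.le_sqrt_of_sq_le (haR s)
  have ha₁ : ∀ s, ‖a₁ s‖ ≤ √R := fun s => Real.le_sqrt_of_sq_le (ha₁R s)
  have hA : ∀ s, ‖a s‖ * ‖a₁ s‖ ≤ A := fun s => by
    rw [hAdef]
    exact mul_le_mul (ha s) (Real.le_sqrt_of_sq_le (ha₁R' s)) (norm_nonneg _) (Real.sqrt_nonneg _)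
  -- the weight of the `L²` norm in the final functional
  obtain ⟨θ, hθ⟩ : ∃ θ, θ = 22 * (1 + ℓ) * J / γ := ⟨_, rfl⟩
  have hθ0 : 0 ≤ θ := by rw [hθ]; positivity
  have hγθ : γ * θ = 22 * (1 + ℓ) * J := by rw [hθ, mul_div_cancel₀ _ hγ.ne']
  have hy := fun s => (S.hasDerivAt_sub S₁ s).norm_sq
  have hL2 := S.sub_inner_le S₁ hr hA hAμ
  have hθ2 : 2 * (R + R') ≤ θ := by
    rw [hθ, le_div_iff₀ hγ]
    have h1 : γ * (R + R') ≤ J := by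
      have : 0 ≤ μ * (R + R' + A) + γ * A + √R * Rp + T := by positivity
      linarith
    have : 0 ≤ ℓ * J := by positivity
    linarith
  have hpot : ∀ s, 1 / 2 * ‖incl (a s * a s)‖ ^ 2 - 1 / 2 * ‖incl (a₁ s * a₁ s)‖ ^ 2
      - 2 * inner ℝ (incl (a₁ s * star (a₁ s) * a₁ s)) (incl (a s - a₁ s))
      ≤ θ * ‖incl (a s - a₁ s)‖ ^ 2 := fun s => by
    refine (potential_le _ _).trans (mul_le_mul_of_nonneg_right ?_ (sq_nonneg _))
    linarith [haR s, ha₁R' s]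
  obtain ⟨C, hC⟩ := S.bdd
  obtain ⟨C₁, hC₁⟩ := S₁.bdd
  have hdecay := fun s => le_of_deriv_le (K := 0) (M := L * (C + C₁) ^ 2 + θ * (L * (C + C₁) ^ 2))
    (half_pos hγ) (fun s => (S.hasDerivAt_sub_energy S₁ s).fun_add ((hy s).const_mul θ))
    (fun s => by
      have h1 := hL2 s
      have h2 := potential_nonneg (a s) (a₁ s)
      set n := ‖incl (a s - a₁ s)‖
      set X := ‖incl (b s - b₁ s)‖
      have hn0 : 0 ≤ n := norm_nonneg _
      have hX0 : 0 ≤ X := norm_nonneg _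
      have hH : ‖incl (a s * star (a s) * a s - a₁ s * star (a₁ s) * a₁ s)‖
          ≤ (R + R' + A) * n := by
        refine (norm_cubic_sub_le _ _).trans (mul_le_mul_of_nonneg_right ?_ hn0)
        linarith [haR s, ha₁R' s, hA s]
      have h3 : inner ℝ (incl (a s - a₁ s))
          (incl (a s * star (a s) * a s - a₁ s * star (a₁ s) * a₁ s)) ≤ (R + R' + A) * n ^ 2 := by
        refine (real_inner_le_norm _ _).trans ((mul_le_mul_of_nonneg_left hH hn0).trans
          (le_of_eq ?_))
        ring
      have h4 : inner ℝ (modeProj L m (incl (a s - a₁ s)))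
          (incl (a s * star (a s) * a s - a₁ s * star (a₁ s) * a₁ s)) ≤ (R + R' + A) * n ^ 2 := by
        refine (real_inner_le_norm _ _).trans ((mul_le_mul (norm_modeProj_le _) hH (norm_nonneg _)
          hn0).trans (le_of_eq ?_))
        ring
      have h5 : - inner ℝ (z₁ s) (incl (a s * star (a s) * a s - a₁ s * star (a₁ s) * a₁ s)
          - cubicD (a₁ s) (incl (a s - a₁ s))) ≤ 3 * (√R * Rp) * (‖a s - a₁ s‖ * n) := by
        refine (neg_le_abs _).trans ((abs_real_inner_le_norm _ _).trans ?_)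
        have e1 : ‖a s - a₁ s‖ * (‖a s‖ + 2 * ‖a₁ s‖) * n ≤ ‖a s - a₁ s‖ * (3 * √R) * n := by
          refine mul_le_mul_of_nonneg_right (mul_le_mul_of_nonneg_left ?_ (norm_nonneg _)) hn0
          linarith [ha s, ha₁ s]
        calc _ ≤ Rp * (‖a s - a₁ s‖ * (3 * √R) * n) :=
              mul_le_mul (hzp s) ((norm_cubic_remainder_le _ _).trans e1) (norm_nonneg _) hRp0
          _ = _ := by ring
      have hag : ‖a s - a₁ s‖ ^ 2 ≤ ℓ * n ^ 2 + 2 * n * X := by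
        have e1 := (S.hasWD_sub S₁ s).norm_sq_le
        have e2 : n ^ 2 / L ≤ ℓ * n ^ 2 := by
          rw [div_eq_mul_one_div, mul_comm]
          exact mul_le_mul_of_nonneg_right hℓ (sq_nonneg n)
        linarith
      have h6 := young_absorb hγ hβ0 hT hℓ0 hTp hag
      have h7 := mul_le_mul_of_nonneg_left h3 hγ.le
      have h8 := mul_le_mul_of_nonneg_left h4 hμ
      have h9 := mul_nonneg hμ (sq_nonneg ‖modeProj L m (incl (b s - b₁ s))‖)
      have h10 := mul_le_mul_of_nonneg_left h1 hθ0
      have h11 : 2 * θ * A * r ^ 2 ≤ γ / 2 := by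
        rw [hθ]
        have e : 2 * (22 * (1 + ℓ) * J / γ) * A * r ^ 2
            = 44 * (1 + ℓ) * (A * J) * r ^ 2 / γ := by ring
        rw [e, div_le_iff₀ hγ]
        linarith
      have h12 := mul_le_mul_of_nonneg_right h11 (sq_nonneg X)
      have h13 : 2 * ((μ + γ) * (R + R' + A)) + 11 * (1 + ℓ) * (√R * Rp + T)
          ≤ 11 * (1 + ℓ) * J := by
        have e1 : 0 ≤ (μ + γ) * (R + R' + A) := by positivity
        have e2 := mul_le_mul_of_nonneg_left hJ (by positivity : 0 ≤ 11 * (1 + ℓ))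
        have e3 : 0 ≤ ℓ * ((μ + γ) * (R + R' + A)) := by positivity
        linarith
      have h14 := mul_le_mul_of_nonneg_right h13 (sq_nonneg n)
      have h15 : γ * θ * n ^ 2 = 22 * (1 + ℓ) * J * n ^ 2 := by rw [hγθ]
      have h16 := mul_nonneg hγ.le h2
      have h17 : 0 ≤ γ * θ * n ^ 2 := by positivity
      linarith)
    (fun s => by
      have e1 : ‖incl (b s - b₁ s)‖ ^ 2 ≤ L * (C + C₁) ^ 2 :=
        (norm_incl_le _).trans (mul_le_mul_of_nonneg_left (pow_le_pow_left₀ (norm_nonneg _)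
          ((norm_sub_le _ _).trans (add_le_add (hC s).2.1 (hC₁ s).2.1)) 2) hL.le)
      have e2 : ‖incl (a s - a₁ s)‖ ^ 2 ≤ L * (C + C₁) ^ 2 :=
        (norm_incl_le _).trans (mul_le_mul_of_nonneg_left (pow_le_pow_left₀ (norm_nonneg _)
          ((norm_sub_le _ _).trans (add_le_add (hC s).1 (hC₁ s).1)) 2) hL.le)
      have e3 := mul_le_mul_of_nonneg_left e2 hθ0
      have e4 := potential_nonneg (a s) (a₁ s)
      linarith) s
  have hX : ∀ s, ‖incl (b s - b₁ s)‖ ^ 2 ≤ 0 := fun s => by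
    have := hdecay s
    have := hpot s
    linarith
  -- the `H¹` seminorm of the difference vanishes, so its `L²` norm decays freely
  have hfin := le_of_deriv_le (κ := 2 * γ) (K := 0) (M := L * (C + C₁) ^ 2) (by positivity) hy
    (fun s => by
      have h1 := hL2 s
      have h2 : ‖incl (b s - b₁ s)‖ ^ 2 = 0 := le_antisymm (hX s) (sq_nonneg _)
      rw [h2] at h1
      linarith)
    (fun s => (norm_incl_le _).trans (mul_le_mul_of_nonneg_left (pow_le_pow_left₀ (norm_nonneg _)
      ((norm_sub_le _ _).trans (add_le_add (hC s).1 (hC₁ s).1)) 2) hL.le)) s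
  have h0 : incl (a s - a₁ s) = 0 := by
    rw [← norm_eq_zero]
    exact pow_eq_zero_iff (two_ne_zero) |>.mp (le_antisymm hfin (sq_nonneg _))
  rw [map_sub] at h0
  exact sub_eq_zero.mp h0

end Difference

/-! ### Solutions on the attractor and the constants of the uniqueness criterion -/

/-- The smallness condition on `K₉`, rewritten with the constant `r` of the Poincaré inequality on
the modes above `m`. -/
lemma gap_condition {c L γ K ℓ M r : ℝ} (hγ : 0 < γ) (hM : 0 < M) (hK : 0 ≤ K)
    (hr : r = L / (2 * Real.pi * M)) (hc : 22 * (1 + ℓ) ≤ c)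
    (h : c * L ^ 2 * K / (γ ^ 2 * M ^ 2) ≤ 1) : 44 * (1 + ℓ) * K * r ^ 2 ≤ γ ^ 2 / 2 := by
  rw [div_le_one (by positivity)] at h
  have hpi : (1 : ℝ) ≤ Real.pi ^ 2 := one_le_pow₀ (by linarith [Real.pi_gt_three])
  have h1 := mul_le_mul_of_nonneg_right hc (by positivity : 0 ≤ L ^ 2 * K)
  have h2 := mul_le_mul_of_nonneg_right hpi (by positivity : 0 ≤ γ ^ 2 * M ^ 2)
  have e : 44 * (1 + ℓ) * K * r ^ 2
      = 22 * (1 + ℓ) * (L ^ 2 * K) / (2 * (Real.pi ^ 2 * M ^ 2)) := by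
    rw [hr]; field_simp; ring
  rw [e, div_le_iff₀ (by positivity)]
  linarith

section Conclusion

variable {L : ℝ} [Fact (0 < L)]

lemma Rinf_nonneg {c γ F μ V : ℝ} (hc : 0 ≤ c) (hF : 0 ≤ F) (hV : 0 ≤ V) : 0 ≤ Rinf c γ F μ V :=
  mul_nonneg hc (mul_nonneg (R0_nonneg hF hV) (R1_nonneg _ _ _ _ _))

lemma Rprime_nonneg {c γ F μ V : ℝ} (hc : 0 ≤ c) (hγ : 0 < γ) (hμ : 0 ≤ μ) (hF : 0 ≤ F)
    (hV : 0 ≤ V) : 0 ≤ Rprime c γ F μ V := by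
  have hR0 := R0_nonneg (γ := γ) (μ := μ) hF hV
  have hR1 := R1_nonneg c γ F μ V
  rw [Rprime, R2, R2form]
  positivity

lemma rpow_third_cube {x : ℝ} (hx : 0 ≤ x) (k : ℕ) : (x ^ ((k : ℝ) / 3)) ^ 3 = x ^ k := by
  rw [← Real.rpow_natCast, ← Real.rpow_mul hx, ← Real.rpow_natCast]
  congr 1
  push_cast
  ring

/-- The term of `K₈` that comes from Young's inequality with exponents `4` and `4/3`. -/
lemma young_term_cube {γ R Rp : ℝ} (hγ : 0 < γ) (hR : 0 ≤ R) (hRp : 0 ≤ Rp) :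
    (1 / γ ^ (1 / 3 : ℝ) * R ^ (2 / 3 : ℝ) * Rp ^ (4 / 3 : ℝ)) ^ 3 * γ = (√R * Rp) ^ 4 := by
  have h1 := rpow_third_cube hγ.le 1
  have h2 := rpow_third_cube hR 2
  have h4 := rpow_third_cube hRp 4
  norm_num only [Nat.cast_one, Nat.cast_ofNat] at h1 h2 h4
  have h5 : (√R * Rp) ^ 4 = R ^ 2 * Rp ^ 4 := by
    rw [mul_pow, show √R ^ 4 = (√R ^ 2) ^ 2 by ring, Real.sq_sqrt hR]
  rw [h5, mul_pow, mul_pow, div_pow, h1, h2, h4]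
  field_simp

/-- A compact subset of `H²_per` is bounded in the norm of `H²`. -/
lemma exists_norm_le_of_isCompact {A : Set (H2per L)} (hA : IsCompact A) :
    ∃ M, ∀ p ∈ A, p.norm ≤ M := by
  obtain ⟨M, hM⟩ := (hA.image H2per.continuous_norm).bddAbove
  exact ⟨M, fun p hp => hM ⟨p, hp, rfl⟩⟩

/-- The norm of `X` bounds `v` and `v_s`, provided that these are bounded: a supremum of an
unbounded function would be `0` by convention. -/
lemma le_normX {v v' : ℝ → L2per L} {C : ℝ} (hv : ∀ s, HasDerivAt v (v' s) s)
    (hC : ∀ s, ‖v s‖ ≤ C) (hC' : ∀ s, ‖v' s‖ ≤ C) (s : ℝ) :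
    ‖v s‖ ≤ normX v ∧ ‖v' s‖ ≤ normX v := by
  have hd : ∀ s, deriv v s = v' s := fun s => (hv s).deriv
  have h1 : ‖v s‖ ≤ ⨆ s, ‖v s‖ :=
    le_ciSup (f := fun s => ‖v s‖) ⟨C, by rintro _ ⟨s, rfl⟩; exact hC s⟩ s
  have h2 : ‖v' s‖ ≤ ⨆ s, ‖deriv v s‖ := by
    rw [← hd]
    exact le_ciSup (f := fun s => ‖deriv v s‖)
      ⟨C, by rintro _ ⟨s, rfl⟩; exact (congrArg norm (hd s)).trans_le (hC' s)⟩ s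
  have h3 := norm_nonneg (v s)
  have h4 := norm_nonneg (v' s)
  rw [normX]
  constructor <;> linarith

/-- Uniqueness for solutions in terms of continuous representatives, with the bounding expressions
of the criterion. -/
lemma IsSol.incl_eq_of_criterion {γ μ ℓ c V : ℝ} {m : ℕ} {f : L2per L} {v v' : ℝ → L2per L}
    {a b a₁ b₁ : ℝ → C(AddCircle L, ℂ)} {g z g₁ z₁ : ℝ → L2per L}
    (S : IsSol γ μ m f v v' a b g z) (S₁ : IsSol γ μ m f v v' a₁ b₁ g₁ z₁)
    (S₀ : IsSol γ 0 m f v v' a₁ b₁ g₁ z₁) (hγ : 0 < γ) (hℓ : 1 / L ≤ ℓ)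
    (hc : 2000000 * (ℓ + 4) ^ 4 ≤ c) (hv : ∀ s, ‖v s‖ ≤ V) (hv' : ∀ s, ‖v' s‖ ≤ V)
    (hmix : RinfMix c γ ‖f‖ μ V < μ)
    (h1 : R1tt c γ ‖f‖ μ V * L / (2 * Real.pi * ((m : ℝ) + 1)) ≤ 1)
    (h2 : R2t c γ ‖f‖ μ V * L / (2 * Real.pi * ((m : ℝ) + 1)) ≤ 1)
    (h3 : c * L ^ 2 * K9 c γ ‖f‖ μ V / (γ ^ 2 * ((m : ℝ) + 1) ^ 2) ≤ 1) (s : ℝ) :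
    incl (a s) = incl (a₁ s) := by
  have hL : (0 : ℝ) < L := Fact.out
  have hℓ0 : 0 ≤ ℓ := (by positivity : 0 ≤ 1 / L).trans hℓ
  have hc₁ : 44 * (1 + ℓ) ≤ 2000000 * (ℓ + 4) ^ 4 := by
    have e1 : ℓ + 4 ≤ (ℓ + 4) ^ 4 := le_self_pow₀ (by linarith) (by norm_num)
    linarith
  have hc₄ : 4 * (1 + ℓ) ≤ c := by linarith
  have hc0 : 0 ≤ c := by linarith
  have hF := norm_nonneg f
  have hV : 0 ≤ V := (norm_nonneg _).trans (hv 0)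
  have hA0 : 0 ≤ RinfMix c γ ‖f‖ μ V := by rw [RinfMix]; positivity
  have hμ : 0 ≤ μ := hA0.trans hmix.le
  have hRi := Rinf_nonneg (γ := γ) (μ := μ) hc0 hF hV
  have hRi0 := Rinf_nonneg (γ := γ) (μ := 0) hc0 hF hV
  have hRp := Rprime_nonneg hc0 hγ hμ hF hV
  have hRp0 := Rprime_nonneg hc0 hγ le_rfl hF hV
  have hK8 : 0 ≤ μ * (Rinf c γ ‖f‖ μ V + Rinf c γ ‖f‖ 0 V) + μ * RinfMix c γ ‖f‖ μ V
      + √(Rinf c γ ‖f‖ 0 V) * Rprime c γ ‖f‖ μ V := by positivity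
  have hK8' : 0 ≤ 1 / γ ^ (1 / 3 : ℝ) * Rinf c γ ‖f‖ 0 V ^ (2 / 3 : ℝ)
      * Rprime c γ ‖f‖ μ V ^ (4 / 3 : ℝ) := by positivity
  have hK8'' : 0 ≤ √(Rinf c γ ‖f‖ 0 V) * Rprime c γ ‖f‖ μ V := by positivity
  have hT0 : 0 ≤ 1 / γ ^ (1 / 3 : ℝ) * Rinf c γ ‖f‖ μ V ^ (2 / 3 : ℝ)
      * Rprime c γ ‖f‖ 0 V ^ (4 / 3 : ℝ) := by positivity
  have hβ0 : 0 ≤ √(Rinf c γ ‖f‖ μ V) * Rprime c γ ‖f‖ 0 V := by positivity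
  have hK9 : 0 ≤ K9 c γ ‖f‖ μ V := by
    have : 0 ≤ K8 c γ ‖f‖ μ V := by rw [K8]; linarith
    rw [K9]
    positivity
  refine S.incl_eq S₁ hγ hμ hℓ rfl rfl
    (S.norm_sq_le_Rinf_of_modes hγ hμ hℓ hc₄ hc hv hv' h1 h2)
    (S₁.norm_sq_le_Rinf_of_modes hγ hμ hℓ hc₄ hc hv hv' h1 h2)
    (fun s => (S₀.bounds_of_no_feedback hγ hℓ hc₄ hc hv hv' s).1)
    (fun s => (S₀.bounds_of_no_feedback hγ hℓ hc₄ hc hv hv' s).2) hmix.le hT0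
    (young_term_cube hγ hRi hRp0)
    (J := K8 c γ ‖f‖ μ V + γ * (Rinf c γ ‖f‖ μ V + Rinf c γ ‖f‖ 0 V + RinfMix c γ ‖f‖ μ V))
    ?_ ?_ s
  · rw [K8, RinfMix]
    linarith
  · exact gap_condition hγ (by positivity) hK9 rfl (by linarith) h3

end Conclusion

end DampedNLS

end

theorem proposition5p1 (L₀ : ℝ) (hL₀ : 0 < L₀) :
    ∃ c : ℝ, 0 < c ∧
      ∀ (L : ℝ) [Fact (0 < L)], L₀ ≤ L →
      ∀ (γ μ : ℝ) (m : ℕ) (f : DampedNLS.L2per L) (A : Set (DampedNLS.H2per L))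
        (u w : ℝ → DampedNLS.H2per L) (v : ℝ → DampedNLS.L2per L),
        0 < γ → f ≠ 0 →
        DampedNLS.IsGlobalAttractor γ f A →
        DampedNLS.IsTrajectoryOn γ f A u →
        (∀ s, v s = DampedNLS.modeProj L m (u s).fn) →
        DampedNLS.IsBoundedFeedbackSolution γ μ m f v w →
        √(DampedNLS.Rinf c γ ‖f‖ μ (DampedNLS.normX v))
            * √(DampedNLS.Rinf c γ ‖f‖ 0 (DampedNLS.normX v)) < μ →
        max (DampedNLS.R1tt c γ ‖f‖ μ (DampedNLS.normX v) * L / (2 * Real.pi * ((m : ℝ) + 1)))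
            (DampedNLS.R2t c γ ‖f‖ μ (DampedNLS.normX v) * L / (2 * Real.pi * ((m : ℝ) + 1)))
            ≤ 1 →
        c * L ^ 2 * DampedNLS.K9 c γ ‖f‖ μ (DampedNLS.normX v) / (γ ^ 2 * ((m : ℝ) + 1) ^ 2) ≤ 1 →
        w = u := by
  refine ⟨2000000 * (1 / L₀ + 4) ^ 4, by positivity, ?_⟩
  intro L _ hL γ μ m f A u w v hγ _ hA hu hv hw h0 h12 h3
  obtain ⟨C, hC⟩ := DampedNLS.exists_norm_le_of_isCompact hA.1.1
  obtain ⟨C', hC'⟩ := hw.2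
  have hzero : DampedNLS.SolvesOn Set.univ γ
      (fun s => f - (Complex.I * ((0 : ℝ) : ℂ)) • (DampedNLS.modeProj L m (u s).fn - 0)) u := by
    simpa using hu.1
  -- no feedback and no datum; the regularity of `u_s` so obtained makes `P_m u` a datum
  have Su := DampedNLS.SolvesOn.isSol (v := fun _ => 0) (v' := fun _ => 0) (V := 0) hzero
    (fun s => hC _ (hu.2 s)) (fun s => hasDerivAt_const s 0) continuous_const
    (fun _ => map_zero _) (fun _ => map_zero _) (fun _ => norm_zero.le)
  obtain ⟨z, hz⟩ : ∃ z, z = fun s => deriv (fun t => (u t).fn) s := ⟨_, rfl⟩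
  rw [← hz] at Su
  have hveq : v = fun s => DampedNLS.modeProj L m (DampedNLS.incl (u s).rep) :=
    funext fun s => by rw [hv s, (u s).incl_rep]
  have hvd : ∀ s, HasDerivAt v (DampedNLS.modeProj L m (z s)) s := fun s => by
    rw [hveq]
    exact ((DampedNLS.modeProj L m).restrictScalars ℝ).hasFDerivAt.comp_hasDerivAt s (Su.deriv_a s)
  have hvc : Continuous fun s => DampedNLS.modeProj L m (z s) :=
    (DampedNLS.modeProj L m).continuous.comp Su.cont_z
  have hP : ∀ s, DampedNLS.modeProj L m (v s) = v s := fun s => by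
    rw [hv s, DampedNLS.modeProj_modeProj]
  have hP' := fun s => DampedNLS.modeProj_modeProj (m := m) (z s)
  obtain ⟨K, hK⟩ := Su.bdd
  have hbound := DampedNLS.le_normX (C := max C K) hvd
    (fun s => by
      rw [hv s]
      exact (DampedNLS.norm_modeProj_le _).trans
        (((u s).norm_fn_le.trans (hC _ (hu.2 s))).trans (le_max_left _ _)))
    (fun s => (DampedNLS.norm_modeProj_le _).trans ((hK s).2.2.2.trans (le_max_right _ _)))
  have S₀ := Su.change_feedback (μ' := 0) hvd hvc hP hP' fun s => zero_smul _ _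
  have S₁ := Su.change_feedback (μ' := μ) hvd hvc hP hP' fun s => by
    rw [hv s, (u s).incl_rep, sub_self, smul_zero]
  have S := hw.1.isSol hC' hvd hvc hP hP' fun s => (hbound s).1
  refine funext fun s => DampedNLS.H2per.ext_fn ?_
  rw [← (w s).incl_rep, ← (u s).incl_rep]
  exact S.incl_eq_of_criterion S₁ S₀ hγ (one_div_le_one_div_of_le hL₀ hL) le_rfl
    (fun s => (hbound s).1) (fun s => (hbound s).2) h0 ((le_max_left _ _).trans h12)
    ((le_max_right _ _).trans h12) h3 s
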